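/- Let $d\in\mathbb N$ and $1\le p,q<\infty$. Let $w:\mathbb R^{2d}\to[0,\infty)$ be a locally integrable function, not identically zero, that is submultiplicative, i.e. $w(x+y)\le w(x)w(y)$ for all $x,y\in\mathbb R^{2d}$, and polynomially moderate, i.e. there are $s\in\mathbb R$ and a constant $C$ such that $w(x+y)\le C\,v_s(x)\,w(y)$ for all $x,y\in\mathbb R^{2d}$, where $v_s(x,\xi)=(1+|x|^2+|\xi|^2)^{s/2}$. Let $g\in\mathcal S(\mathbb R^d)$, $g\ne0$, and for $f\in\mathcal S'(\mathbb R^d)$ let $V_gf(x,\xi)=\int_{\mathbb R^d}f(t)\,\overline{g(t-x)}\,e^{-i t\cdot\xi}\,dt$ (in the sense of distributions) be its short-time Fourier transform. Let $\mathcal M^{p,q}_w(\mathbb R^d)$ be the space of all $f\in\mathcal S'(\mathbb R^d)$ with $$\|f\|_{\mathcal M^{p,q}_w}=\left(\int_{\mathbb R^d}\left(\int_{\mathbb R^d}|V_gf(x,\xi)|^p\,w(x,\xi)^p\,dx\right)^{q/p}d\xi\right)^{1/q}<\infty ,$$ and let $\mathcal W^{p,q}_w(\mathbb R^d)$ be the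 space of all $f\in\mathcal S'(\mathbb R^d)$ with $$\|f\|_{\mathcal W^{p,q}_w}=\left(\int_{\mathbb R^d}\left(\int_{\mathbb R^d}|V_gf(x,\xi)|^q\,w(x,\xi)^q\,d\xi\right)^{p/q}dx\right)^{1/p}<\infty .$$ Then the modulation space $\mathcal M^{p,q}_w(\mathbb R^d)$ and the Wiener amalgam space $\mathcal W^{p,q}_w(\mathbb R^d)$, with these norms, are Banach spaces with the metric approximation property. (A Banach space $B$ has the metric approximation property if for every compact $K\subset B$ and every $\varepsilon>0$ there is a bounded finite rank linear operator $F:B\to B$ with $\|F\|\le1$ and $\|x-Fx\|<\varepsilon$ for all $x\in K$.) -/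

import Mathlib

open MeasureTheory
open scoped SchwartzMap ENNReal ComplexConjugate

noncomputable section

/-- The Euclidean space `ℝᵈ`. -/
abbrev Rd (d : ℕ) : Type := EuclideanSpace ℝ (Fin d)

/-! ### The metric approximation property -/

/-- Every compact set is approximated, up to any `ε > 0`, by a bounded finite rank operator of
operator norm at most `1`. -/
def MetricApproximationProperty (X : Type*) [SeminormedAddCommGroup X] [NormedSpace ℂ X] : Prop :=
  ∀ K : Set X, IsCompact K → ∀ ε : ℝ, 0 < ε →
    ∃ F : X →L[ℂ] X, FiniteDimensional ℂ (LinearMap.range (F : X →ₗ[ℂ] X)) ∧ ‖F‖ ≤ 1 ∧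
      ∀ x ∈ K, ‖x - F x‖ < ε

/-! ### Weights on `ℝ²ᵈ = ℝᵈ × ℝᵈ` -/

/-- A weight function: non-negative and locally integrable. -/
def IsWeight {d : ℕ} (w : Rd d × Rd d → ℝ) : Prop :=
  (∀ z, 0 ≤ w z) ∧ LocallyIntegrable w volume

/-- `w (x + y) ≤ w x * w y`. -/
def IsSubmultiplicative {d : ℕ} (w : Rd d × Rd d → ℝ) : Prop :=
  ∀ x y, w (x + y) ≤ w x * w y

/-- `w` is `v`-moderate: `w (x + y) ≤ C v(x) w(y)` for a constant `C`. -/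
def IsModerate {d : ℕ} (v w : Rd d × Rd d → ℝ) : Prop :=
  ∃ C : ℝ, ∀ x y, w (x + y) ≤ C * v x * w y

/-- The polynomial weight `v_s(x, ξ) = (1 + |x|² + |ξ|²)^(s/2)`. -/
def polyWeight {d : ℕ} (s : ℝ) (z : Rd d × Rd d) : ℝ :=
  (1 + ‖z.1‖ ^ 2 + ‖z.2‖ ^ 2) ^ (s / 2)

/-- `w` is polynomially moderate: it is `v_s`-moderate for some `s`. -/
def IsPolynomiallyModerate {d : ℕ} (w : Rd d × Rd d → ℝ) : Prop :=
  ∃ s : ℝ, IsModerate (polyWeight s) w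

/-! ### Mixed-norm Lebesgue spaces on `ℝᵈ × ℝᵈ` -/

/-- The `L^{(p,q)}` norm, with exponent `p` in the first (inner) variable and `q` in the second
(outer) one: `(∫ (∫ |F(x, ξ)|^p dx)^{q/p} dξ)^{1/q}`, as an extended non-negative number. -/
def mixedNorm {d : ℕ} (p q : ℝ) (F : Rd d × Rd d → ℂ) : ℝ≥0∞ :=
  (∫⁻ ξ, (∫⁻ x, ‖F (x, ξ)‖ₑ ^ p) ^ (q / p)) ^ (1 / q)

lemma mixedNorm_add_le {d : ℕ} {p q : ℝ} (hp : 1 ≤ p) (hq : 1 ≤ q) {F G : Rd d × Rd d → ℂ}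
    (hF : AEStronglyMeasurable F volume) (hG : AEStronglyMeasurable G volume) :
    mixedNorm p q (F + G) ≤ mixedNorm p q F + mixedNorm p q G := by
  have hp0 : 0 < p := by linarith
  have hq0 : 0 < q := by linarith
  have key (H : Rd d × Rd d → ℂ) : mixedNorm p q H =
      (∫⁻ ξ, ((∫⁻ x, ‖H (x, ξ)‖ₑ ^ p) ^ (1 / p)) ^ q) ^ (1 / q) := by
    unfold mixedNorm
    congr 1
    refine lintegral_congr fun ξ => ?_
    rw [← ENNReal.rpow_mul]
    congr 1
    field_simp
  have sec {H : Rd d × Rd d → ℂ} (hH : AEStronglyMeasurable H volume) :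
      ∀ᵐ ξ : Rd d, AEStronglyMeasurable (fun x : Rd d => H (x, ξ)) volume := by
    have h1 : AEStronglyMeasurable (fun z : Rd d × Rd d => H z.swap)
        ((volume : Measure (Rd d)).prod (volume : Measure (Rd d))) :=
      AEStronglyMeasurable.prod_swap hH
    exact h1.prodMk_left
  have outer {H : Rd d × Rd d → ℂ} (hH : AEStronglyMeasurable H volume) :
      AEMeasurable (fun ξ : Rd d => (∫⁻ x, ‖H (x, ξ)‖ₑ ^ p) ^ (1 / p)) volume := by
    have h1 : AEMeasurable (fun z : Rd d × Rd d => ‖H z‖ₑ ^ p)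
        ((volume : Measure (Rd d)).prod (volume : Measure (Rd d))) :=
      hH.enorm.pow_const p
    exact (h1.lintegral_prod_left' ).pow_const _
  rw [key, key, key]
  refine le_trans ?_ (ENNReal.lintegral_Lp_add_le (outer hF) (outer hG) hq)
  gcongr ?_ ^ _
  refine lintegral_mono_ae ?_
  filter_upwards [sec hF, sec hG] with ξ h1 h2
  refine ENNReal.rpow_le_rpow ?_ hq0.le
  refine le_trans ?_ (ENNReal.lintegral_Lp_add_le h1.enorm h2.enorm hp)
  gcongr with x
  exact enorm_add_le _ _

lemma mixedNorm_smul {d : ℕ} {p q : ℝ} (hp : 1 ≤ p) (hq : 1 ≤ q) (c : ℂ) (F : Rd d × Rd d → ℂ) :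
    mixedNorm p q (c • F) = ‖c‖ₑ * mixedNorm p q F := by
  have hp0 : 0 < p := by linarith
  have hq0 : 0 < q := by linarith
  have h1 : ‖c‖ₑ ^ p ≠ ∞ := ENNReal.rpow_ne_top_of_nonneg hp0.le enorm_ne_top
  have h2 : (‖c‖ₑ ^ p) ^ (q / p) ≠ ∞ := ENNReal.rpow_ne_top_of_nonneg (by positivity) h1
  unfold mixedNorm
  simp only [Pi.smul_apply, enorm_smul, ENNReal.mul_rpow_of_nonneg _ _ hp0.le]
  simp only [lintegral_const_mul' _ _ h1,
    ENNReal.mul_rpow_of_nonneg _ _ (show 0 ≤ q / p by positivity)]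
  rw [lintegral_const_mul' _ _ h2, ENNReal.mul_rpow_of_nonneg _ _ (show 0 ≤ 1 / q by positivity)]
  congr 1
  rw [← ENNReal.rpow_mul, ← ENNReal.rpow_mul]
  convert ENNReal.rpow_one _ using 2
  field_simp

lemma mixedNorm_zero {d : ℕ} {p q : ℝ} (hp : 1 ≤ p) (hq : 1 ≤ q) :
    mixedNorm p q (0 : Rd d × Rd d → ℂ) = 0 := by
  simpa using mixedNorm_smul hp hq 0 (0 : Rd d × Rd d → ℂ)

/-- The space of measurable functions with finite `L^{(p,q)}` norm. -/
def mixedLp (d : ℕ) (p q : ℝ) [hp : Fact (1 ≤ p)] [hq : Fact (1 ≤ q)] :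
    Submodule ℂ (Rd d × Rd d → ℂ) where
  carrier := {F | AEStronglyMeasurable F volume ∧ mixedNorm p q F < ∞}
  add_mem' := fun hF hG => ⟨hF.1.add hG.1,
    (mixedNorm_add_le hp.out hq.out hF.1 hG.1).trans_lt (ENNReal.add_lt_top.2 ⟨hF.2, hG.2⟩)⟩
  zero_mem' := ⟨aestronglyMeasurable_const, by simp [mixedNorm_zero hp.out hq.out]⟩
  smul_mem' := fun c F hF => ⟨hF.1.const_smul c, by
    rw [mixedNorm_smul hp.out hq.out]; exact ENNReal.mul_lt_top enorm_lt_top hF.2⟩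

/-- The `L^{(p,q)}` norm on the functions for which it is finite. -/
def mixedSeminorm (d : ℕ) (p q : ℝ) [hp : Fact (1 ≤ p)] [hq : Fact (1 ≤ q)] :
    Seminorm ℂ (mixedLp d p q) :=
  Seminorm.of (fun F => (mixedNorm p q (F : Rd d × Rd d → ℂ)).toReal)
    (fun F G => by
      rw [← ENNReal.toReal_add F.2.2.ne G.2.2.ne]
      exact ENNReal.toReal_mono (ENNReal.add_ne_top.2 ⟨F.2.2.ne, G.2.2.ne⟩)
        (mixedNorm_add_le hp.out hq.out F.2.1 G.2.1))
    (fun c F => by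
      have h := mixedNorm_smul hp.out hq.out c (F : Rd d × Rd d → ℂ)
      simp only [Submodule.coe_smul, h, ENNReal.toReal_mul, toReal_enorm])

/-! ### The short-time Fourier transform -/

lemma hasTemperateGrowth_cexp : (fun r : ℝ => Complex.exp (-(r * Complex.I))).HasTemperateGrowth := by
  have h (n : ℕ) : iteratedDeriv n (fun r : ℝ => Complex.exp (-(r * Complex.I))) =
      fun r : ℝ => (-Complex.I) ^ n * Complex.exp (-(r * Complex.I)) := by
    induction n with
    | zero => simp
    | succ n ih =>
      rw [iteratedDeriv_succ, ih]
      funext r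
      have h0 : HasDerivAt (fun r : ℝ => (r : ℂ)) 1 r := Complex.ofRealCLM.hasDerivAt
      have h1 := ((h0.mul_const Complex.I).neg.cexp.const_mul ((-Complex.I) ^ n)).deriv
      refine h1.trans ?_
      simp only [Pi.neg_apply]
      ring
  have h2 : ContDiff ℝ (⊤ : ℕ∞) (fun r : ℝ => (r : ℂ)) := Complex.ofRealCLM.contDiff
  refine ⟨(h2.mul contDiff_const).neg.cexp, fun n => ⟨0, 1, fun r => ?_⟩⟩
  rw [norm_iteratedFDeriv_eq_norm_iteratedDeriv, h]
  simp [Complex.norm_exp]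

/-- The character `t ↦ e^{-i t·ξ}`. -/
def character {d : ℕ} (ξ : Rd d) (t : Rd d) : ℂ :=
  Complex.exp (-((inner ℝ t ξ : ℝ) * Complex.I))

lemma hasTemperateGrowth_character {d : ℕ} (ξ : Rd d) : (character ξ).HasTemperateGrowth :=
  hasTemperateGrowth_cexp.comp (Function.hasTemperateGrowth_inner_left ξ)

/-- The Schwartz function `t ↦ e^{-i t·ξ} conj (g (t - x))`. -/
def stftAtom {d : ℕ} (g : 𝓢(Rd d, ℂ)) (x ξ : Rd d) : 𝓢(Rd d, ℂ) :=
  SchwartzMap.smulLeftCLM ℂ (character ξ)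
    (SchwartzMap.compSubConstCLM ℝ x
      (SchwartzMap.postcompCLM (𝕜 := ℝ) (Complex.conjCLE : ℂ →L[ℝ] ℂ) g))

lemma stftAtom_apply {d : ℕ} (g : 𝓢(Rd d, ℂ)) (x ξ t : Rd d) :
    stftAtom g x ξ t = Complex.exp (-((inner ℝ t ξ : ℝ) * Complex.I)) * conj (g (t - x)) := by
  simp [stftAtom, SchwartzMap.smulLeftCLM_apply_apply (hasTemperateGrowth_character ξ), character]

/-- The short-time Fourier transform `V_g f (x, ξ)` of a tempered distribution `f` with respect to
the window `g`, that is `∫ f(t) conj (g (t - x)) e^{-i t·ξ} dt` in the sense of distributions. -/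
def stft {d : ℕ} (g : 𝓢(Rd d, ℂ)) (f : 𝓢'(Rd d, ℂ)) (z : Rd d × Rd d) : ℂ :=
  f (stftAtom g z.1 z.2)

/-- The linear map `f ↦ V_g f · w`. -/
def weightedStft {d : ℕ} (w : Rd d × Rd d → ℝ) (g : 𝓢(Rd d, ℂ)) :
    𝓢'(Rd d, ℂ) →ₗ[ℂ] (Rd d × Rd d → ℂ) where
  toFun f := fun z => stft g f z * (w z : ℂ)
  map_add' f f' := by
    funext z
    exact add_mul (f (stftAtom g z.1 z.2)) (f' (stftAtom g z.1 z.2)) _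
  map_smul' c f := by
    funext z
    exact mul_assoc c (f (stftAtom g z.1 z.2)) _

/-- The coordinate flip `F ↦ ((x, ξ) ↦ F (ξ, x))`. -/
def flipMap (d : ℕ) : (Rd d × Rd d → ℂ) →ₗ[ℂ] (Rd d × Rd d → ℂ) :=
  LinearMap.funLeft ℂ ℂ Prod.swap

/-! ### Modulation spaces -/

/-- The modulation space `M_w^{p,q}(ℝᵈ)`: the tempered distributions `f` with
`V_g f · w ∈ L^{(p,q)}`, with the norm `‖V_g f · w‖_{L^{(p,q)}}` given by the window `g`. -/
def ModulationSpace {d : ℕ} (p q : ℝ) [Fact (1 ≤ p)] [Fact (1 ≤ q)]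
    (w : Rd d × Rd d → ℝ) (g : 𝓢(Rd d, ℂ)) : Type :=
  ((mixedLp d p q).comap (weightedStft w g) : Submodule ℂ 𝓢'(Rd d, ℂ))

namespace ModulationSpace

variable {d : ℕ} (p q : ℝ) [Fact (1 ≤ p)] [Fact (1 ≤ q)] (w : Rd d × Rd d → ℝ) (g : 𝓢(Rd d, ℂ))

instance : AddCommGroup (ModulationSpace p q w g) :=
  Submodule.addCommGroup ((mixedLp d p q).comap (weightedStft w g))

instance : Module ℂ (ModulationSpace p q w g) :=
  Submodule.module ((mixedLp d p q).comap (weightedStft w g))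

/-- The linear map `f ↦ V_g f · w` into `L^{(p,q)}`. -/
def toMixedLp : ModulationSpace p q w g →ₗ[ℂ] mixedLp d p q :=
  (weightedStft w g).restrict (fun _ h => h)

/-- The norm of the modulation space. -/
def seminorm : Seminorm ℂ (ModulationSpace p q w g) :=
  (mixedSeminorm d p q).comp (toMixedLp p q w g)

instance : SeminormedAddCommGroup (ModulationSpace p q w g) :=
  AddGroupSeminorm.toSeminormedAddCommGroup (seminorm p q w g).toAddGroupSeminorm

instance : NormedSpace ℂ (ModulationSpace p q w g) where
  norm_smul_le c f := (map_smul_eq_mul (seminorm p q w g) c f).le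

variable {p q w g}

/-- The tempered distribution underlying an element of the modulation space. -/
def toDistribution (f : ModulationSpace p q w g) : 𝓢'(Rd d, ℂ) :=
  Subtype.val f

lemma norm_def (f : ModulationSpace p q w g) :
    ‖f‖ = (mixedNorm p q (fun z => stft g f.toDistribution z * (w z : ℂ))).toReal :=
  rfl

end ModulationSpace

/-! ### Wiener amalgam spaces -/

/-- The Wiener amalgam space `W_w^{p,q}(ℝᵈ)`: the tempered distributions `f` such that the
coordinate flip of `V_g f · w` lies in `L^{(q,p)}`, with the norm given by the window `g`. Thus
the frequency variable is integrated first, with exponent `q`, and then the space variable, with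
exponent `p`. -/
def WienerAmalgamSpace {d : ℕ} (p q : ℝ) [Fact (1 ≤ p)] [Fact (1 ≤ q)]
    (w : Rd d × Rd d → ℝ) (g : 𝓢(Rd d, ℂ)) : Type :=
  ((mixedLp d q p).comap (flipMap d ∘ₗ weightedStft w g) : Submodule ℂ 𝓢'(Rd d, ℂ))

namespace WienerAmalgamSpace

variable {d : ℕ} (p q : ℝ) [Fact (1 ≤ p)] [Fact (1 ≤ q)] (w : Rd d × Rd d → ℝ) (g : 𝓢(Rd d, ℂ))

instance : AddCommGroup (WienerAmalgamSpace p q w g) :=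
  Submodule.addCommGroup ((mixedLp d q p).comap (flipMap d ∘ₗ weightedStft w g))

instance : Module ℂ (WienerAmalgamSpace p q w g) :=
  Submodule.module ((mixedLp d q p).comap (flipMap d ∘ₗ weightedStft w g))

/-- The linear map sending `f` to the coordinate flip of `V_g f · w` in `L^{(q,p)}`. -/
def toMixedLp : WienerAmalgamSpace p q w g →ₗ[ℂ] mixedLp d q p :=
  (flipMap d ∘ₗ weightedStft w g).restrict (fun _ h => h)

/-- The norm of the Wiener amalgam space. -/
def seminorm : Seminorm ℂ (WienerAmalgamSpace p q w g) :=
  (mixedSeminorm d q p).comp (toMixedLp p q w g)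

instance : SeminormedAddCommGroup (WienerAmalgamSpace p q w g) :=
  AddGroupSeminorm.toSeminormedAddCommGroup (seminorm p q w g).toAddGroupSeminorm

instance : NormedSpace ℂ (WienerAmalgamSpace p q w g) where
  norm_smul_le c f := (map_smul_eq_mul (seminorm p q w g) c f).le

variable {p q w g}

/-- The tempered distribution underlying an element of the Wiener amalgam space. -/
def toDistribution (f : WienerAmalgamSpace p q w g) : 𝓢'(Rd d, ℂ) :=
  Subtype.val f

lemma norm_def (f : WienerAmalgamSpace p q w g) :
    ‖f‖ = (mixedNorm q p
      (fun z => stft g f.toDistribution (z.2, z.1) * (w (z.2, z.1) : ℂ))).toReal :=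
  rfl

end WienerAmalgamSpace

end

/-! The short-time Fourier transform satisfies a reproducing formula c · V_g f(z) = ∫ K(z,z') V_g
f(z') dz', where c = (2π)ᵈ‖g‖₂² > 0 and |K(z,z')| is a rapidly decreasing function of z' - z
(`integral_stftKernel_mul_stft`, `norm_stftKernel`). A polynomially moderate weight can be moved
through such a kernel at polynomial cost. Both spaces are therefore governed by a few properties of
the norm on phase space: solidity, a Young inequality, Fatou, dominated convergence (the exponents
are finite) and a Hölder pairing with a fixed decaying function. These are collected in
`AdmissibleNorm`; the Wiener amalgam norm is the modulation norm with exponents exchanged and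
variables swapped, so one argument serves both spaces.

The reproducing formula must hold for every tempered distribution f. Since |f φ| is dominated by
finitely many sup norms ‖P_i φ‖∞, with P_i composed of derivatives and coordinate multiplications,
Hahn–Banach factors f through a Banach space of tuples of bounded continuous functions
(`exists_factorization`). There the formula is a Bochner integral identity, tested against Schwartz
functions and reduced to the orthogonality relation; f is then a bounded functional that may be
taken inside the integral.

The formula yields a continuous embedding of the space into the tempered distributions, and with
Fatou this gives completeness.

For the approximation property let χ_δ be a δ-Lipschitz, compactly supported cutoff with 0 ≤ χ_δ ≤
1. Discretising the localisation operator f ↦ c⁻¹ ∫ χ_δ(z') V_g f(z') π(z')g dz', where π(z')g is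
the window shifted to z', gives a finite rank operator T_δ. On the transform side T_δ is
multiplication by χ_δ up to an error of norm O(δ)‖f‖ (`IsStftSpace.exists_finiteRank`): commuting
χ_δ past K costs δ‖z - z'‖, which the decay of K absorbs, and the discretisation error is as small
as desired. Multiplication by χ_δ is a contraction for a solid norm, so ‖T_δ‖ ≤ 1 + Aδ. By dominated
convergence T_δ → id strongly, and division by 1 + Aδ gives contractions converging strongly, hence
uniformly on compact sets. -/

noncomputable section

open Filter Topology
open scoped LineDeriv BoundedContinuousFunction FourierTransform

/-! ### Lebesgue norms of extended non-negative functions -/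

/-- The `Lᵖ` norm of an extended non-negative function. -/
def lpN {α : Type*} [MeasurableSpace α] (p : ℝ) (μ : Measure α) (f : α → ℝ≥0∞) : ℝ≥0∞ :=
  (∫⁻ x, f x ^ p ∂μ) ^ (1 / p)

section lpN

variable {α β : Type*} [MeasurableSpace α] [MeasurableSpace β] {μ : Measure α} {ν : Measure β}
  {p : ℝ}

lemma lpN_mono_ae (hp : 1 ≤ p) {f g : α → ℝ≥0∞} (h : f ≤ᵐ[μ] g) : lpN p μ f ≤ lpN p μ g := by
  have hp0 : 0 < p := by linarith
  refine ENNReal.rpow_le_rpow (lintegral_mono_ae ?_) (by positivity)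
  filter_upwards [h] with x hx
  exact ENNReal.rpow_le_rpow hx hp0.le

lemma lpN_const_mul (hp : 1 ≤ p) {c : ℝ≥0∞} (hc : c ≠ ∞) (f : α → ℝ≥0∞) :
    lpN p μ (fun x => c * f x) = c * lpN p μ f := by
  have hp0 : 0 < p := by linarith
  have h1 : c ^ p ≠ ∞ := ENNReal.rpow_ne_top_of_nonneg hp0.le hc
  unfold lpN
  simp only [ENNReal.mul_rpow_of_nonneg _ _ hp0.le]
  rw [lintegral_const_mul' _ _ h1, ENNReal.mul_rpow_of_nonneg _ _ (by positivity),
    ← ENNReal.rpow_mul]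
  congr 1
  convert ENNReal.rpow_one c using 2
  field_simp

lemma lpN_liminf_le (hp : 1 ≤ p) {f : ℕ → α → ℝ≥0∞} (hf : ∀ n, AEMeasurable (f n) μ) :
    lpN p μ (fun x => liminf (fun n => f n x) atTop) ≤ liminf (fun n => lpN p μ (f n)) atTop := by
  have hp0 : 0 < p := by linarith
  have h1 (r : ℝ) (hr : 0 < r) (u : ℕ → ℝ≥0∞) :
      (liminf u atTop) ^ r = liminf (fun n => u n ^ r) atTop :=
    OrderIso.liminf_apply (ENNReal.orderIsoRpow r hr)
  unfold lpN
  rw [← h1 (1 / p) (by positivity)]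
  refine ENNReal.rpow_le_rpow ?_ (by positivity)
  simp only [h1 p hp0]
  exact lintegral_liminf_le' fun n => (hf n).pow_const p

lemma lpN_lt_top_iff (hp : 1 ≤ p) {f : α → ℝ≥0∞} : lpN p μ f < ∞ ↔ ∫⁻ x, f x ^ p ∂μ < ∞ := by
  have hp0 : 0 < p := by linarith
  exact ENNReal.rpow_lt_top_iff_of_pos (by positivity)

lemma tendsto_lpN_zero (hp : 1 ≤ p) {f : ℕ → α → ℝ≥0∞} {F : α → ℝ≥0∞}
    (hf : ∀ n, AEMeasurable (f n) μ) (hle : ∀ n, f n ≤ᵐ[μ] F) (hF : lpN p μ F < ∞)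
    (hlim : ∀ᵐ x ∂μ, Tendsto (fun n => f n x) atTop (𝓝 0)) :
    Tendsto (fun n => lpN p μ (f n)) atTop (𝓝 0) := by
  have hp0 : 0 < p := by linarith
  have h0 : Tendsto (fun n => ∫⁻ x, f n x ^ p ∂μ) atTop (𝓝 (∫⁻ _, 0 ∂μ)) := by
    refine tendsto_lintegral_of_dominated_convergence' (fun x => F x ^ p)
      (fun n => (hf n).pow_const p) (fun n => ?_) ((lpN_lt_top_iff hp).1 hF).ne ?_
    · filter_upwards [hle n] with x hx
      exact ENNReal.rpow_le_rpow hx hp0.le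
    · filter_upwards [hlim] with x hx
      have := (ENNReal.continuous_rpow_const (y := p)).tendsto 0 |>.comp hx
      simpa [ENNReal.zero_rpow_of_pos hp0, Function.comp_def] using this
  have := (ENNReal.continuous_rpow_const (y := 1 / p)).tendsto _ |>.comp h0
  simpa [lpN, hp0, Function.comp_def] using this

/-- Hölder's inequality: a function bounded by 1 and integrable lies in every dual Lebesgue space.
The case p = 1 is separate because the dual exponent is then infinite. -/
lemma lintegral_mul_le_lpN (hp : 1 ≤ p) {ρ : α → ℝ≥0∞} (hρ : AEMeasurable ρ μ)
    (hρ1 : ∀ x, ρ x ≤ 1) (hρi : ∫⁻ x, ρ x ∂μ < ∞) :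
    ∃ C : ℝ≥0∞, C ≠ ∞ ∧ ∀ f : α → ℝ≥0∞, AEMeasurable f μ → ∫⁻ x, ρ x * f x ∂μ ≤ C * lpN p μ f := by
  rcases hp.eq_or_lt with rfl | hp1
  · refine ⟨1, ENNReal.one_ne_top, fun f _ => ?_⟩
    simp only [lpN, ENNReal.rpow_one, one_div, inv_one, one_mul]
    exact lintegral_mono fun x => mul_le_of_le_one_left' (hρ1 x)
  · have hc := Real.HolderConjugate.conjExponent hp1
    refine ⟨(∫⁻ x, ρ x ^ p.conjExponent ∂μ) ^ (1 / p.conjExponent), ?_, fun f hf => ?_⟩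
    · refine (ENNReal.rpow_lt_top_of_nonneg (by have := hc.symm.pos; positivity) ?_).ne
      refine (lt_of_le_of_lt (lintegral_mono fun x => ?_) hρi).ne
      exact ENNReal.rpow_le_self_of_le_one (hρ1 x) hc.symm.lt.le
    · exact ENNReal.lintegral_mul_le_Lp_mul_Lq μ hc.symm hρ hf

/-- Minkowski's integral inequality, by duality: a power of a test function below the p-th power of
the left-hand integrand is inserted, the integrals are exchanged, and Hölder is applied in x for
each fixed y. -/
lemma lpN_lintegral_le [SFinite μ] [SigmaFinite μ] [SFinite ν] (hp : 1 ≤ p) {h : α → β → ℝ≥0∞}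
    (hh : Measurable (Function.uncurry h)) :
    lpN p μ (fun x => ∫⁻ y, h x y ∂ν) ≤ ∫⁻ y, lpN p μ (fun x => h x y) ∂ν := by
  rcases hp.eq_or_lt with rfl | hp1
  · simp only [lpN, ENNReal.rpow_one, one_div, inv_one]
    exact (lintegral_lintegral_swap hh.aemeasurable).le
  have hp0 : 0 < p := by linarith
  have hc := Real.HolderConjugate.conjExponent hp1
  have hc0 := hc.symm.pos
  set p' := p.conjExponent
  set M := ∫⁻ y, lpN p μ (fun x => h x y) ∂ν with hM
  -- Simple functions g with finite integral A are tested because A ≤ M · A^(1/p') has to be divided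
  -- by A^(1/p'), which is impossible for A = ∞. Approximation from below recovers the full
  -- integral.
  have key (g : SimpleFunc α NNReal) (hg : ∀ x, (g x : ℝ≥0∞) ≤ (∫⁻ y, h x y ∂ν) ^ p)
      (hgi : ∫⁻ x, g x ∂μ < ∞) : ∫⁻ x, g x ∂μ ≤ M ^ p := by
    set A := ∫⁻ x, (g x : ℝ≥0∞) ∂μ with hA
    rcases eq_or_ne A 0 with h0 | h0
    · rw [h0]; exact zero_le
    have gm : Measurable (fun x => (g x : ℝ≥0∞)) := g.measurable.coe_nnreal_ennreal
    have h1 : A ≤ M * A ^ (1 / p') := by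
      calc A ≤ ∫⁻ x, (∫⁻ y, h x y ∂ν) * (g x : ℝ≥0∞) ^ (1 / p') ∂μ := by
            refine lintegral_mono fun x => ?_
            have e1 : (g x : ℝ≥0∞) = (g x : ℝ≥0∞) ^ (1 / p) * (g x : ℝ≥0∞) ^ (1 / p') := by
              rw [← ENNReal.rpow_add_of_nonneg _ _ (by positivity) (by positivity)]
              have : 1 / p + 1 / p' = 1 := by
                simpa using hc.inv_add_inv_eq_one
              rw [this, ENNReal.rpow_one]
            conv_lhs => rw [e1]
            gcongr
            refine (ENNReal.rpow_le_rpow (hg x) (by positivity)).trans_eq ?_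
            rw [← ENNReal.rpow_mul, mul_one_div_cancel hp0.ne', ENNReal.rpow_one]
        _ = ∫⁻ x, ∫⁻ y, h x y * (g x : ℝ≥0∞) ^ (1 / p') ∂ν ∂μ := by
            refine lintegral_congr fun x => (lintegral_mul_const' _ _ ?_).symm
            exact ENNReal.rpow_ne_top_of_nonneg (by positivity) ENNReal.coe_ne_top
        _ = ∫⁻ y, ∫⁻ x, h x y * (g x : ℝ≥0∞) ^ (1 / p') ∂μ ∂ν := by
            refine lintegral_lintegral_swap (Measurable.aemeasurable ?_)
            exact hh.mul ((gm.comp measurable_fst).pow_const _)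
        _ ≤ ∫⁻ y, lpN p μ (fun x => h x y) * A ^ (1 / p') ∂ν := by
            refine lintegral_mono fun y => ?_
            refine (ENNReal.lintegral_mul_le_Lp_mul_Lq μ hc (f := fun x => h x y)
              (g := fun x => (g x : ℝ≥0∞) ^ (1 / p')) ?_ (gm.pow_const _).aemeasurable).trans_eq ?_
            · exact (hh.comp (measurable_id.prodMk measurable_const)).aemeasurable
            · simp only [← ENNReal.rpow_mul, one_div_mul_cancel hc0.ne', ENNReal.rpow_one]
              rfl
        _ = M * A ^ (1 / p') := by
            refine lintegral_mul_const' _ _ ?_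
            exact ENNReal.rpow_ne_top_of_nonneg (by positivity) hgi.ne
    have h2 : A ^ (1 / p') ≠ 0 := by simp [h0, hgi.ne]
    have h3 : A ^ (1 / p') ≠ ∞ := ENNReal.rpow_ne_top_of_nonneg (by positivity) hgi.ne
    have e1 : A = A ^ (1 / p) * A ^ (1 / p') := by
      rw [← ENNReal.rpow_add_of_nonneg _ _ (by positivity) (by positivity)]
      have : 1 / p + 1 / p' = 1 := by
        simpa using hc.inv_add_inv_eq_one
      rw [this, ENNReal.rpow_one]
    have h4 : A ^ (1 / p) ≤ M := by
      have h5 : A ^ (1 / p) * A ^ (1 / p') ≤ M * A ^ (1 / p') := e1 ▸ h1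
      exact (ENNReal.mul_le_mul_iff_left h2 h3).1 h5
    have := ENNReal.rpow_le_rpow h4 hp0.le
    rwa [← ENNReal.rpow_mul, one_div_mul_cancel hp0.ne', ENNReal.rpow_one] at this
  have main : ∫⁻ x, (∫⁻ y, h x y ∂ν) ^ p ∂μ ≤ M ^ p := by
    rw [lintegral_eq_nnreal]
    refine iSup₂_le fun φ hφ => le_of_forall_lt fun L hL => ?_
    rw [← SimpleFunc.lintegral_eq_lintegral] at hL
    obtain ⟨g, hg1, hg2, hg3⟩ := exists_lt_lintegral_simpleFunc_of_lt_lintegral (f := φ) hL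
    exact hg3.trans_le (key g (fun x => (ENNReal.coe_le_coe.2 (hg1 x)).trans (hφ x)) hg2)
  have := ENNReal.rpow_le_rpow main (show 0 ≤ 1 / p by positivity)
  rwa [← ENNReal.rpow_mul, mul_one_div_cancel hp0.ne', ENNReal.rpow_one] at this

lemma measurable_lpN_left [SFinite μ] {F : α × β → ℝ≥0∞} (hF : Measurable F) :
    Measurable fun y => lpN p μ fun x => F (x, y) :=
  ((hF.pow_const p).lintegral_prod_left').pow_const _

lemma aemeasurable_lpN_left [SFinite μ] [SFinite ν] {F : α × β → ℝ≥0∞}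
    (hF : AEMeasurable F (μ.prod ν)) : AEMeasurable (fun y => lpN p μ fun x => F (x, y)) ν :=
  ((hF.pow_const p).lintegral_prod_left').pow_const _

end lpN

/-! ### Mixed norms -/

instance volume_prod_isAddHaarMeasure {d : ℕ} :
    (volume : Measure (Rd d × Rd d)).IsAddHaarMeasure :=
  inferInstanceAs ((volume : Measure (Rd d)).prod (volume : Measure (Rd d))).IsAddHaarMeasure

instance volume_prod_isNegInvariant {d : ℕ} :
    (volume : Measure (Rd d × Rd d)).IsNegInvariant := by
  constructor
  have h : Measure.map (Neg.neg : Rd d → Rd d) volume = volume :=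
    Measure.map_neg_eq_self (volume : Measure (Rd d))
  have h2 := Measure.map_prod_map (volume : Measure (Rd d)) (volume : Measure (Rd d))
    (measurable_neg (G := Rd d)) (measurable_neg (G := Rd d))
  rw [h] at h2
  exact h2.symm

lemma ae_ae_section {α β : Type*} [MeasurableSpace α] [MeasurableSpace β] {μ : Measure α}
    {ν : Measure β} [SFinite μ] [SFinite ν] {P : α × β → Prop} (h : ∀ᵐ z ∂μ.prod ν, P z) :
    ∀ᵐ y ∂ν, ∀ᵐ x ∂μ, P (x, y) := by
  rw [← Measure.prod_swap] at h
  exact Measure.ae_ae_of_ae_prod (ae_of_ae_map measurable_swap.aemeasurable h)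

/-- The `L^{(p,q)}` norm of an extended non-negative function. -/
def mixN {d : ℕ} (p q : ℝ) (F : Rd d × Rd d → ℝ≥0∞) : ℝ≥0∞ :=
  lpN q volume fun ξ => lpN p volume fun x => F (x, ξ)

lemma mixedNorm_eq_mixN {d : ℕ} {p q : ℝ} (hp : 1 ≤ p) (F : Rd d × Rd d → ℂ) :
    mixedNorm p q F = mixN p q fun z => ‖F z‖ₑ := by
  have hp0 : 0 < p := by linarith
  unfold mixedNorm mixN lpN
  congr 1
  refine lintegral_congr fun ξ => ?_
  rw [← ENNReal.rpow_mul]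
  congr 1
  field_simp

/-- The function `(1 + |x|)(1 + |ξ|)` on phase space. -/
def phaseWeight {d : ℕ} (z : Rd d × Rd d) : ℝ := (1 + ‖z.1‖) * (1 + ‖z.2‖)

/-- The integrable function `((1 + |x|)(1 + |ξ|))^{-(d+1)}` on phase space. -/
def phaseDecay {d : ℕ} (z : Rd d × Rd d) : ℝ≥0∞ := ENNReal.ofReal ((phaseWeight z ^ (d + 1))⁻¹)

/-- The factor `(1 + |x|)^{-(d+1)}` of `phaseDecay`. -/
def spaceDecay {d : ℕ} (x : Rd d) : ℝ≥0∞ := ENNReal.ofReal (((1 + ‖x‖) ^ (d + 1))⁻¹)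

lemma phaseDecay_eq {d : ℕ} (x ξ : Rd d) : phaseDecay (x, ξ) = spaceDecay x * spaceDecay ξ := by
  unfold phaseDecay spaceDecay phaseWeight
  rw [mul_pow, mul_inv, ENNReal.ofReal_mul (by positivity)]

lemma measurable_spaceDecay {d : ℕ} : Measurable (spaceDecay (d := d)) := by
  unfold spaceDecay; fun_prop

lemma measurable_phaseDecay {d : ℕ} : Measurable (phaseDecay (d := d)) := by
  unfold phaseDecay phaseWeight; fun_prop

lemma spaceDecay_le_one {d : ℕ} (x : Rd d) : spaceDecay x ≤ 1 := by
  refine ENNReal.ofReal_le_one.2 (inv_le_one_of_one_le₀ (one_le_pow₀ ?_))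
  linarith [norm_nonneg x]

lemma lintegral_spaceDecay_lt_top {d : ℕ} : ∫⁻ x : Rd d, spaceDecay x < ∞ := by
  have h : Integrable (fun x : Rd d => (1 + ‖x‖) ^ (-((d + 1 : ℕ) : ℝ))) volume :=
    integrable_one_add_norm (by simp)
  have h2 := h.lintegral_lt_top
  refine lt_of_le_of_lt (lintegral_mono fun x => ?_) h2
  rw [spaceDecay, Real.rpow_neg (by positivity), Real.rpow_natCast]

lemma lintegral_phaseDecay_lt_top {d : ℕ} : ∫⁻ z : Rd d × Rd d, phaseDecay z < ∞ := by
  rw [Measure.volume_eq_prod, lintegral_prod _ measurable_phaseDecay.aemeasurable]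
  simp only [phaseDecay_eq]
  simp_rw [lintegral_const_mul _ measurable_spaceDecay]
  rw [lintegral_mul_const _ measurable_spaceDecay]
  exact ENNReal.mul_lt_top lintegral_spaceDecay_lt_top lintegral_spaceDecay_lt_top

lemma lpN_spaceDecay_lt_top {d : ℕ} {p : ℝ} (hp : 1 ≤ p) :
    lpN p volume (spaceDecay (d := d)) < ∞ := by
  refine (lpN_lt_top_iff hp).2 (lt_of_le_of_lt (lintegral_mono fun x => ?_)
    lintegral_spaceDecay_lt_top)
  exact ENNReal.rpow_le_self_of_le_one (spaceDecay_le_one x) hp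

/-- The properties of the norm of a translation invariant solid function space on phase space that
are used here. -/
structure AdmissibleNorm {d : ℕ} (N : (Rd d × Rd d → ℝ≥0∞) → ℝ≥0∞) : Prop where
  mono_ae : ∀ {F G : Rd d × Rd d → ℝ≥0∞}, F ≤ᵐ[volume] G → N F ≤ N G
  add_le : ∀ {F G : Rd d × Rd d → ℝ≥0∞}, AEMeasurable F → AEMeasurable G →
    N (fun z => F z + G z) ≤ N F + N G
  const_mul : ∀ {c : ℝ≥0∞}, c ≠ ∞ → ∀ F : Rd d × Rd d → ℝ≥0∞, N (fun z => c * F z) = c * N F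
  liminf_le : ∀ {F : ℕ → Rd d × Rd d → ℝ≥0∞}, (∀ n, AEMeasurable (F n)) →
    N (fun z => liminf (fun n => F n z) atTop) ≤ liminf (fun n => N (F n)) atTop
  tendsto_zero : ∀ {F : ℕ → Rd d × Rd d → ℝ≥0∞} {G : Rd d × Rd d → ℝ≥0∞},
    (∀ n, AEMeasurable (F n)) → AEMeasurable G → (∀ n, F n ≤ᵐ[volume] G) → N G < ∞ →
    (∀ᵐ z, Tendsto (fun n => F n z) atTop (𝓝 0)) → Tendsto (fun n => N (F n)) atTop (𝓝 0)
  conv_le : ∀ {k F : Rd d × Rd d → ℝ≥0∞}, Measurable k → (∀ z, k z ≠ ∞) → AEMeasurable F →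
    N (fun z => ∫⁻ z', k (z - z') * F z') ≤ (∫⁻ z, k z) * N F
  lintegral_le : ∃ C : ℝ≥0∞, C ≠ ∞ ∧ ∀ F : Rd d × Rd d → ℝ≥0∞, AEMeasurable F →
    ∫⁻ z, phaseDecay z * F z ≤ C * N F
  decay_lt_top : N phaseDecay < ∞

section mixN

variable {d : ℕ} {p q : ℝ}

lemma mixN_mono_ae (hp : 1 ≤ p) (hq : 1 ≤ q) {F G : Rd d × Rd d → ℝ≥0∞} (h : F ≤ᵐ[volume] G) :
    mixN p q F ≤ mixN p q G := by
  refine lpN_mono_ae hq ?_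
  filter_upwards [ae_ae_section h] with ξ hξ
  exact lpN_mono_ae hp hξ

lemma mixN_congr_ae (hp : 1 ≤ p) (hq : 1 ≤ q) {F G : Rd d × Rd d → ℝ≥0∞} (h : F =ᵐ[volume] G) :
    mixN p q F = mixN p q G :=
  le_antisymm (mixN_mono_ae hp hq h.le) (mixN_mono_ae hp hq h.symm.le)

lemma aemeasurable_section {F : Rd d × Rd d → ℝ≥0∞} (hF : AEMeasurable F) :
    ∀ᵐ ξ : Rd d, AEMeasurable fun x => F (x, ξ) := by
  filter_upwards [ae_ae_section hF.ae_eq_mk] with ξ hξ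
  exact ⟨_, hF.measurable_mk.comp (measurable_id.prodMk measurable_const), hξ⟩

lemma mixN_add_le (hp : 1 ≤ p) (hq : 1 ≤ q) {F G : Rd d × Rd d → ℝ≥0∞} (hF : AEMeasurable F)
    (hG : AEMeasurable G) : mixN p q (fun z => F z + G z) ≤ mixN p q F + mixN p q G := by
  refine (lpN_mono_ae hq ?_).trans (ENNReal.lintegral_Lp_add_le
    (aemeasurable_lpN_left hF) (aemeasurable_lpN_left hG) hq)
  filter_upwards [aemeasurable_section hF, aemeasurable_section hG] with ξ h1 h2
  exact ENNReal.lintegral_Lp_add_le h1 h2 hp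

lemma mixN_translate (F : Rd d × Rd d → ℝ≥0∞) (y : Rd d × Rd d) :
    mixN p q (fun z => F (z - y)) = mixN p q F := by
  obtain ⟨y, η⟩ := y
  have h1 (ξ : Rd d) : ∫⁻ x, F (x - y, ξ - η) ^ p = ∫⁻ x, F (x, ξ - η) ^ p :=
    lintegral_sub_right_eq_self (fun x => F (x, ξ - η) ^ p) y
  unfold mixN lpN
  simp only [Prod.mk_sub_mk, h1]
  rw [lintegral_sub_right_eq_self (fun ξ => ((∫⁻ x, F (x, ξ) ^ p) ^ (1 / p)) ^ q) η]

lemma mixN_lintegral_le {β : Type*} [MeasurableSpace β] {ν : Measure β} [SFinite ν] (hp : 1 ≤ p)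
    (hq : 1 ≤ q) {h : Rd d × Rd d → β → ℝ≥0∞} (hh : Measurable (Function.uncurry h)) :
    mixN p q (fun z => ∫⁻ y, h z y ∂ν) ≤ ∫⁻ y, mixN p q (fun z => h z y) ∂ν := by
  refine (lpN_mono_ae hq (g := fun ξ => ∫⁻ y, lpN p volume (fun x => h (x, ξ) y) ∂ν)
    (Eventually.of_forall fun ξ => lpN_lintegral_le hp ?_)).trans (lpN_lintegral_le hq ?_)
  · exact hh.comp ((measurable_fst.prodMk measurable_const).prodMk measurable_snd)
  · refine measurable_lpN_left (F := fun a : Rd d × (Rd d × β) => h (a.1, a.2.1) a.2.2) ?_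
    exact hh.comp ((measurable_fst.prodMk (measurable_fst.comp measurable_snd)).prodMk
      (measurable_snd.comp measurable_snd))

/-- Young's inequality: a convolution is a superposition of translates of F, the mixed norm is
translation invariant, and Minkowski's inequality moves the norm inside the integral. -/
lemma mixN_conv_le (hp : 1 ≤ p) (hq : 1 ≤ q) {k F : Rd d × Rd d → ℝ≥0∞} (hk : Measurable k)
    (hk' : ∀ z, k z ≠ ∞) (hF : AEMeasurable F) :
    mixN p q (fun z => ∫⁻ z', k (z - z') * F z') ≤ (∫⁻ z, k z) * mixN p q F := by
  -- Besides the substitution z' = z - y, F is replaced by its measurable representative, since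
  -- Minkowski's inequality needs joint measurability in (z, y).
  have e (z : Rd d × Rd d) : ∫⁻ z', k (z - z') * F z' = ∫⁻ y, k y * hF.mk F (z - y) := by
    rw [← lintegral_sub_left_eq_self _ z]
    simp only [sub_sub_cancel]
    refine lintegral_congr_ae ?_
    have := (Measure.measurePreserving_sub_left (volume : Measure (Rd d × Rd d)) z).quasiMeasurePreserving.ae
      hF.ae_eq_mk
    filter_upwards [this] with y hy
    rw [hy]
  simp only [e]
  refine (mixN_lintegral_le hp hq ?_).trans ?_
  · exact (hk.comp measurable_snd).mul
      (hF.measurable_mk.comp (measurable_fst.sub measurable_snd))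
  · rw [← lintegral_mul_const _ hk]
    refine lintegral_mono fun y => ?_
    have h1 : mixN p q (fun z => k y * hF.mk F (z - y)) =
        k y * mixN p q (fun z => hF.mk F (z - y)) := by
      unfold mixN
      simp only [lpN_const_mul hp (hk' y), lpN_const_mul hq (hk' y)]
    rw [h1, mixN_translate, ← mixN_congr_ae hp hq hF.ae_eq_mk]

lemma admissibleNorm_mixN (hp : 1 ≤ p) (hq : 1 ≤ q) : AdmissibleNorm (mixN (d := d) p q) where
  mono_ae := mixN_mono_ae hp hq
  add_le := mixN_add_le hp hq
  const_mul hc F := by unfold mixN; simp only [lpN_const_mul hp hc, lpN_const_mul hq hc]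
  liminf_le {F} hF := by
    refine (lpN_mono_ae hq ?_).trans (lpN_liminf_le hq fun n => aemeasurable_lpN_left (hF n))
    filter_upwards [ae_all_iff.2 fun n => aemeasurable_section (hF n)] with ξ hξ
    exact lpN_liminf_le hp hξ
  tendsto_zero {F G} hF hG hle hfin hlim := by
    refine tendsto_lpN_zero hq (F := fun ξ => lpN p volume fun x => G (x, ξ))
      (fun n => aemeasurable_lpN_left (hF n)) (fun n => ?_) hfin ?_
    · filter_upwards [ae_ae_section (hle n)] with ξ hξ
      exact lpN_mono_ae hp hξ
    · have h1 := (lpN_lt_top_iff hq).1 hfin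
      have h2 : ∀ᵐ ξ : Rd d, (lpN p volume fun x => G (x, ξ)) ^ q < ∞ :=
        ae_lt_top' ((aemeasurable_lpN_left hG).pow_const q) h1.ne
      filter_upwards [h2, ae_all_iff.2 fun n => aemeasurable_section (hF n),
        ae_all_iff.2 fun n => ae_ae_section (hle n), ae_ae_section hlim] with ξ h3 h4 h5 h6
      exact tendsto_lpN_zero hp h4 h5
        ((ENNReal.rpow_lt_top_iff_of_pos (by linarith)).1 h3) h6
  conv_le := mixN_conv_le hp hq
  lintegral_le := by
    obtain ⟨C, hC, h⟩ := lintegral_mul_le_lpN (μ := (volume : Measure (Rd d))) hp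
      measurable_spaceDecay.aemeasurable spaceDecay_le_one lintegral_spaceDecay_lt_top
    obtain ⟨D, hD, h'⟩ := lintegral_mul_le_lpN (μ := (volume : Measure (Rd d))) hq
      measurable_spaceDecay.aemeasurable spaceDecay_le_one lintegral_spaceDecay_lt_top
    refine ⟨C * D, ENNReal.mul_ne_top hC hD, fun F hF => ?_⟩
    rw [Measure.volume_eq_prod, lintegral_prod_symm (fun z => phaseDecay z * F z)
      ((measurable_phaseDecay.aemeasurable).mul hF)]
    calc ∫⁻ ξ : Rd d, ∫⁻ x : Rd d, phaseDecay (x, ξ) * F (x, ξ)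
        ≤ ∫⁻ ξ : Rd d, C * (spaceDecay ξ * lpN p volume fun x => F (x, ξ)) := by
          refine lintegral_mono_ae ?_
          filter_upwards [aemeasurable_section hF] with ξ hξ
          simp only [phaseDecay_eq, mul_comm (spaceDecay _) (spaceDecay ξ), mul_assoc]
          rw [lintegral_const_mul' _ _ (show spaceDecay ξ ≠ ∞ from ENNReal.ofReal_ne_top),
            mul_left_comm]
          gcongr
          exact h _ hξ
      _ = C * ∫⁻ ξ : Rd d, (spaceDecay ξ * lpN p volume fun x => F (x, ξ)) :=
          lintegral_const_mul' _ _ hC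
      _ ≤ C * (D * mixN p q F) := by
          gcongr
          exact h' _ (aemeasurable_lpN_left hF)
      _ = C * D * mixN p q F := (mul_assoc _ _ _).symm
  decay_lt_top := by
    unfold mixN
    have h0 (x ξ : Rd d) : phaseDecay (x, ξ) = spaceDecay ξ * spaceDecay x := by
      rw [phaseDecay_eq, mul_comm]
    simp only [h0]
    have h1 (ξ : Rd d) : spaceDecay ξ ≠ ∞ := ENNReal.ofReal_ne_top
    simp only [lpN_const_mul hp (h1 _)]
    simp only [mul_comm _ (lpN p volume _)]
    rw [lpN_const_mul hq (lpN_spaceDecay_lt_top hp).ne]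
    exact ENNReal.mul_lt_top (lpN_spaceDecay_lt_top hp) (lpN_spaceDecay_lt_top hq)

/-- Admissibility is preserved by exchanging the space and frequency variables. -/
lemma AdmissibleNorm.swap {N : (Rd d × Rd d → ℝ≥0∞) → ℝ≥0∞} (hN : AdmissibleNorm N) :
    AdmissibleNorm fun F : Rd d × Rd d → ℝ≥0∞ => N fun z => F z.swap := by
  have hs : MeasurePreserving (Prod.swap : Rd d × Rd d → Rd d × Rd d) volume volume :=
    Measure.measurePreserving_swap
  have hq := hs.quasiMeasurePreserving
  have hm {F : Rd d × Rd d → ℝ≥0∞} (hF : AEMeasurable F) : AEMeasurable fun z : Rd d × Rd d => F z.swap :=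
    hF.comp_quasiMeasurePreserving hq
  have hi (F : Rd d × Rd d → ℝ≥0∞) : ∫⁻ z : Rd d × Rd d, F z.swap = ∫⁻ z, F z :=
    hs.lintegral_comp_emb MeasurableEquiv.prodComm.measurableEmbedding F
  have hd (z : Rd d × Rd d) : phaseDecay z.swap = phaseDecay z := by
    simp only [phaseDecay, phaseWeight, Prod.fst_swap, Prod.snd_swap]
    rw [mul_comm]
  constructor
  · exact fun h => hN.mono_ae (hq.ae h)
  · exact fun hF hG => hN.add_le (hm hF) (hm hG)
  · exact fun hc F => hN.const_mul hc _
  · exact fun hF => hN.liminf_le fun n => hm (hF n)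
  · exact fun hF hG hle hfin hlim => hN.tendsto_zero (fun n => hm (hF n)) (hm hG)
      (fun n => hq.ae (hle n)) hfin (hq.ae hlim)
  · intro k F hk hk' hF
    have := hN.conv_le (hk.comp measurable_swap) (fun z => hk' z.swap) (hm hF)
    simp only [Function.comp_def, hi, Prod.swap_sub] at this
    refine le_trans (le_of_eq ?_) this
    congr 1
    funext z
    exact (hi fun z' => k (z.swap - z') * F z').symm
  · obtain ⟨C, hC, h⟩ := hN.lintegral_le
    refine ⟨C, hC, fun F hF => le_trans (le_of_eq ?_) (h _ (hm hF))⟩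
    rw [← hi]
    simp only [hd]
  · simp only [hd]
    exact hN.decay_lt_top

end mixN

/-! ### Derivatives and coordinate multiplications of Schwartz functions -/

section Operators

variable {d : ℕ}

/-- The directional derivative as an operator on Schwartz functions. -/
def dirDeriv (v : Rd d) : 𝓢(Rd d, ℂ) →L[ℂ] 𝓢(Rd d, ℂ) := LineDeriv.lineDerivOpCLM ℂ 𝓢(Rd d, ℂ) v

lemma dirDeriv_apply (v : Rd d) (φ : 𝓢(Rd d, ℂ)) (t : Rd d) :
    dirDeriv v φ t = fderiv ℝ φ t v :=
  SchwartzMap.lineDerivOp_apply_eq_fderiv v φ t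

lemma hasTemperateGrowth_ofReal_inner (v : Rd d) :
    (fun t : Rd d => ((inner ℝ t v : ℝ) : ℂ)).HasTemperateGrowth :=
  (Complex.ofRealCLM.hasTemperateGrowth).comp (Function.hasTemperateGrowth_inner_left v)

/-- Multiplication by the linear function `t ↦ ⟨t, v⟩`. -/
def coordMul (v : Rd d) : 𝓢(Rd d, ℂ) →L[ℂ] 𝓢(Rd d, ℂ) :=
  SchwartzMap.smulLeftCLM ℂ fun t : Rd d => ((inner ℝ t v : ℝ) : ℂ)

lemma coordMul_apply (v : Rd d) (φ : 𝓢(Rd d, ℂ)) (t : Rd d) :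
    coordMul v φ t = (inner ℝ t v : ℝ) * φ t := by
  simp [coordMul, SchwartzMap.smulLeftCLM_apply_apply (hasTemperateGrowth_ofReal_inner v)]

/-- Complex conjugation of Schwartz functions. -/
def conjS (φ : 𝓢(Rd d, ℂ)) : 𝓢(Rd d, ℂ) :=
  SchwartzMap.postcompCLM (𝕜 := ℝ) (Complex.conjCLE : ℂ →L[ℝ] ℂ) φ

@[simp]
lemma conjS_apply (φ : 𝓢(Rd d, ℂ)) (t : Rd d) : conjS φ t = conj (φ t) := rfl

lemma dirDeriv_conjS (v : Rd d) (φ : 𝓢(Rd d, ℂ)) : dirDeriv v (conjS φ) = conjS (dirDeriv v φ) := by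
  ext t
  rw [dirDeriv_apply, conjS_apply, dirDeriv_apply]
  have h : HasFDerivAt (conjS φ) ((Complex.conjCLE : ℂ →L[ℝ] ℂ).comp (fderiv ℝ φ t)) t :=
    (Complex.conjCLE : ℂ →L[ℝ] ℂ).hasFDerivAt.comp t (φ.differentiableAt.hasFDerivAt)
  rw [h.fderiv]
  rfl

/-- The product rule: the derivative falls on the modulation, giving a scalar linear in ξ, or on the
window. Atoms are thus reproduced up to linear factors and a change of window, so every statement
about atoms below is made for all windows at once. -/
lemma dirDeriv_stftAtom (v : Rd d) (g : 𝓢(Rd d, ℂ)) (x ξ : Rd d) :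
    dirDeriv v (stftAtom g x ξ) =
      (-((inner ℝ v ξ : ℝ) * Complex.I)) • stftAtom g x ξ + stftAtom (dirDeriv v g) x ξ := by
  ext t
  rw [dirDeriv_apply]
  have h1 : HasFDerivAt (fun t : Rd d => ((inner ℝ t ξ : ℝ) : ℂ))
      (Complex.ofRealCLM.comp (innerSL ℝ ξ)) t := by
    have := (Complex.ofRealCLM.comp (innerSL ℝ ξ)).hasFDerivAt (x := t)
    refine this.congr_of_eventuallyEq (Eventually.of_forall fun s => ?_)
    simp [real_inner_comm]
  have h2 : HasFDerivAt (fun t : Rd d => conj (g (t - x)))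
      ((Complex.conjCLE : ℂ →L[ℝ] ℂ).comp (fderiv ℝ g (t - x))) t := by
    have h3 : HasFDerivAt (fun t => g (t - x)) (fderiv ℝ g (t - x)) t := by
      have := (g.differentiableAt (x := t - x)).hasFDerivAt.comp t
        ((hasFDerivAt_id t).sub_const x)
      rwa [ContinuousLinearMap.comp_id] at this
    exact (Complex.conjCLE : ℂ →L[ℝ] ℂ).hasFDerivAt.comp t h3
  have h4 := ((h1.mul_const Complex.I).neg.cexp).mul h2
  have h5 : (stftAtom g x ξ : Rd d → ℂ) =
      (fun t => Complex.exp (-((inner ℝ t ξ : ℝ) * Complex.I))) * fun t => conj (g (t - x)) := by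
    funext t; exact stftAtom_apply g x ξ t
  have h6 : fderiv ℝ ((fun t : Rd d => Complex.exp (-((inner ℝ t ξ : ℝ) * Complex.I))) *
      fun t => conj (g (t - x))) t = _ := h4.fderiv
  rw [h5, h6]
  simp only [_root_.add_apply, _root_.smul_apply, stftAtom_apply, dirDeriv_apply]
  simp [real_inner_comm]
  ring

lemma coordMul_stftAtom (v : Rd d) (g : 𝓢(Rd d, ℂ)) (x ξ : Rd d) :
    coordMul v (stftAtom g x ξ) =
      ((inner ℝ x v : ℝ) : ℂ) • stftAtom g x ξ + stftAtom (coordMul v g) x ξ := by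
  ext t
  simp only [_root_.add_apply, _root_.smul_apply, stftAtom_apply, coordMul_apply,
    inner_sub_left, map_mul, Complex.conj_ofReal, smul_eq_mul]
  push_cast
  ring

/-- The embedding of Schwartz functions into bounded continuous functions. -/
abbrev toBCF : 𝓢(Rd d, ℂ) →L[ℂ] (Rd d →ᵇ ℂ) :=
  SchwartzMap.toBoundedContinuousFunctionCLM ℂ (Rd d) ℂ

lemma norm_stftAtom_apply (g : 𝓢(Rd d, ℂ)) (x ξ t : Rd d) : ‖stftAtom g x ξ t‖ = ‖g (t - x)‖ := by
  rw [stftAtom_apply, norm_mul, Complex.norm_exp]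
  simp

lemma one_le_phaseWeight (z : Rd d × Rd d) : 1 ≤ phaseWeight z := by
  have h1 := norm_nonneg z.1
  have h2 := norm_nonneg z.2
  unfold phaseWeight
  nlinarith

lemma norm_fst_le_phaseWeight (z : Rd d × Rd d) : ‖z.1‖ ≤ phaseWeight z := by
  have h1 := norm_nonneg z.1
  have h2 := norm_nonneg z.2
  unfold phaseWeight
  nlinarith

lemma norm_snd_le_phaseWeight (z : Rd d × Rd d) : ‖z.2‖ ≤ phaseWeight z := by
  have h1 := norm_nonneg z.1
  have h2 := norm_nonneg z.2
  unfold phaseWeight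
  nlinarith

/-- Changing ξ alters the character by up to ‖t‖‖ξ' - ξ‖, which is unbounded in t. The window is
concentrated near x, so ‖t‖ is absorbed at the price of the factor 1 + ‖x‖. -/
lemma norm_stftAtom_sub_le (g : 𝓢(Rd d, ℂ)) : ∃ A B : ℝ, 0 ≤ A ∧ 0 ≤ B ∧
    ∀ (x x' ξ ξ' : Rd d), ‖toBCF (stftAtom g x' ξ') - toBCF (stftAtom g x ξ)‖ ≤
      A * (1 + ‖x‖) * ‖ξ' - ξ‖ + B * ‖x' - x‖ := by
  set A0 := SchwartzMap.seminorm ℝ 0 0 g with hA0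
  set A1 := SchwartzMap.seminorm ℝ 1 0 g with hA1
  set B := SchwartzMap.seminorm ℝ 0 1 g with hB
  have a0 : 0 ≤ A0 := apply_nonneg _ _
  have a1 : 0 ≤ A1 := apply_nonneg _ _
  have b0 : 0 ≤ B := apply_nonneg _ _
  have hlip (s t : Rd d) : ‖g s - g t‖ ≤ B * ‖s - t‖ := by
    refine Convex.norm_image_sub_le_of_norm_fderiv_le (𝕜 := ℝ) (s := Set.univ)
      (fun x _ => g.differentiableAt) (fun x _ => ?_) convex_univ (Set.mem_univ _) (Set.mem_univ _)
    have := SchwartzMap.le_seminorm ℝ 0 1 g x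
    simpa [norm_iteratedFDeriv_one] using this
  refine ⟨A0 + A1, B, by positivity, b0, fun x x' ξ ξ' => ?_⟩
  refine (BoundedContinuousFunction.norm_le (by positivity)).2 fun t => ?_
  have e : (toBCF (stftAtom g x' ξ') - toBCF (stftAtom g x ξ)) t =
      Complex.exp (-((inner ℝ t ξ' : ℝ) * Complex.I)) * conj (g (t - x') - g (t - x)) +
      (Complex.exp (-((inner ℝ t ξ' : ℝ) * Complex.I)) -
        Complex.exp (-((inner ℝ t ξ : ℝ) * Complex.I))) * conj (g (t - x)) := by
    change stftAtom g x' ξ' t - stftAtom g x ξ t = _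
    rw [stftAtom_apply, stftAtom_apply, map_sub (starRingEnd ℂ)]
    ring
  have h1 : ‖Complex.exp (-((inner ℝ t ξ' : ℝ) * Complex.I)) -
      Complex.exp (-((inner ℝ t ξ : ℝ) * Complex.I))‖ ≤ ‖t‖ * ‖ξ' - ξ‖ := by
    have e2 : Complex.exp (-((inner ℝ t ξ' : ℝ) * Complex.I)) -
        Complex.exp (-((inner ℝ t ξ : ℝ) * Complex.I)) =
        Complex.exp (-((inner ℝ t ξ : ℝ) * Complex.I)) *
          (Complex.exp (Complex.I * ((inner ℝ t (ξ - ξ') : ℝ) : ℂ)) - 1) := by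
      rw [mul_sub, ← Complex.exp_add, mul_one, inner_sub_right]
      congr 2
      push_cast
      ring
    rw [e2, norm_mul, Complex.norm_exp]
    simp only [Complex.neg_re, Complex.mul_re, Complex.ofReal_re, Complex.I_re, mul_zero,
      Complex.ofReal_im, Complex.I_im, mul_one, sub_self, neg_zero, Real.exp_zero, one_mul]
    refine Real.norm_exp_I_mul_ofReal_sub_one_le.trans ((norm_inner_le_norm _ _).trans_eq ?_)
    rw [norm_sub_rev]
  have h2 : ‖t‖ * ‖g (t - x)‖ ≤ (A0 + A1) * (1 + ‖x‖) := by
    have h3 : ‖g (t - x)‖ ≤ A0 := SchwartzMap.norm_le_seminorm ℝ g _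
    have h4 : ‖t - x‖ * ‖g (t - x)‖ ≤ A1 := by
      simpa using SchwartzMap.le_seminorm ℝ 1 0 g (t - x)
    have h5 : ‖t‖ ≤ ‖t - x‖ + ‖x‖ := by simpa using norm_add_le (t - x) x
    have h6 := norm_nonneg x
    nlinarith [norm_nonneg (g (t - x)), mul_nonneg a1 h6, mul_nonneg a0 h6]
  rw [e]
  refine (norm_add_le _ _).trans ?_
  rw [norm_mul, norm_mul, Complex.norm_exp, RCLike.norm_conj, RCLike.norm_conj, add_comm]
  simp only [Complex.neg_re, Complex.mul_re, Complex.ofReal_re, Complex.I_re, mul_zero,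
      Complex.ofReal_im, Complex.I_im, mul_one, sub_self, neg_zero, Real.exp_zero, one_mul]
  refine add_le_add ?_ ?_
  · calc _ ≤ ‖t‖ * ‖ξ' - ξ‖ * ‖g (t - x)‖ := by gcongr
      _ = ‖t‖ * ‖g (t - x)‖ * ‖ξ' - ξ‖ := by ring
      _ ≤ _ := by gcongr
  · refine (hlip _ _).trans_eq ?_
    rw [sub_sub_sub_cancel_left, norm_sub_rev]

lemma continuous_toBCF_stftAtom (g : 𝓢(Rd d, ℂ)) :
    Continuous fun z : Rd d × Rd d => toBCF (stftAtom g z.1 z.2) := by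
  obtain ⟨A, B, -, -, h⟩ := norm_stftAtom_sub_le g
  refine continuous_iff_continuousAt.2 fun z => tendsto_iff_norm_sub_tendsto_zero.2 ?_
  refine squeeze_zero (fun _ => norm_nonneg _) (fun z' => h z.1 z'.1 z.2 z'.2) ?_
  have : Continuous fun z' : Rd d × Rd d =>
      A * (1 + ‖z.1‖) * ‖z'.2 - z.2‖ + B * ‖z'.1 - z.1‖ := by fun_prop
  simpa using this.tendsto z

/-- Operators on Schwartz functions which act continuously and with polynomial bounds on
time-frequency shifts, and which have a transpose. -/
structure IsTame (P : 𝓢(Rd d, ℂ) →L[ℂ] 𝓢(Rd d, ℂ)) : Prop where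
  continuous_atom : ∀ g : 𝓢(Rd d, ℂ),
    Continuous fun z : Rd d × Rd d => toBCF (P (stftAtom g z.1 z.2))
  norm_atom_le : ∀ g : 𝓢(Rd d, ℂ), ∃ (C : ℝ) (n : ℕ), 0 ≤ C ∧
    ∀ z : Rd d × Rd d, ‖toBCF (P (stftAtom g z.1 z.2))‖ ≤ C * phaseWeight z ^ n
  transpose : ∃ Q : 𝓢(Rd d, ℂ) → 𝓢(Rd d, ℂ), ∀ φ ψ : 𝓢(Rd d, ℂ),
    ∫ t, ψ t * P φ t = ∫ t, Q ψ t * φ t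

lemma isTame_id : IsTame (ContinuousLinearMap.id ℂ 𝓢(Rd d, ℂ)) where
  continuous_atom := continuous_toBCF_stftAtom
  norm_atom_le g := by
    refine ⟨SchwartzMap.seminorm ℝ 0 0 g, 0, apply_nonneg _ _, fun z => ?_⟩
    rw [pow_zero, mul_one]
    refine (BoundedContinuousFunction.norm_le (apply_nonneg _ _)).2 fun t => ?_
    refine (norm_stftAtom_apply g z.1 z.2 t).trans_le ?_
    exact SchwartzMap.norm_le_seminorm ℝ g _
  transpose := ⟨id, fun _ _ => rfl⟩

lemma norm_smul_add_le_phaseWeight {P : 𝓢(Rd d, ℂ) →L[ℂ] 𝓢(Rd d, ℂ)} (hP : IsTame P)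
    {c : Rd d × Rd d → ℂ} {A : ℝ} (hA : 0 ≤ A) (hc : ∀ z, ‖c z‖ ≤ A * phaseWeight z)
    (g g' : 𝓢(Rd d, ℂ)) : ∃ (C : ℝ) (n : ℕ), 0 ≤ C ∧ ∀ z : Rd d × Rd d,
      ‖toBCF (P (c z • stftAtom g z.1 z.2 + stftAtom g' z.1 z.2))‖ ≤ C * phaseWeight z ^ n := by
  obtain ⟨C, n, hC, h⟩ := hP.norm_atom_le g
  obtain ⟨C', n', hC', h'⟩ := hP.norm_atom_le g'
  refine ⟨A * C + C', n + n' + 1, by positivity, fun z => ?_⟩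
  have h1 := one_le_phaseWeight z
  rw [map_add, map_smul, map_add, map_smul]
  refine (norm_add_le _ _).trans ?_
  rw [norm_smul, add_mul]
  refine add_le_add ?_ ((h' z).trans ?_)
  · calc _ ≤ (A * phaseWeight z) * (C * phaseWeight z ^ n) := by
          gcongr
          · exact hc z
          · exact h z
      _ = A * C * phaseWeight z ^ (n + 1) := by ring
      _ ≤ _ := by
          gcongr ?_ * ?_
          exact pow_le_pow_right₀ h1 (by omega)
  · gcongr ?_ * ?_
    exact pow_le_pow_right₀ h1 (by omega)

lemma continuous_smul_add {P : 𝓢(Rd d, ℂ) →L[ℂ] 𝓢(Rd d, ℂ)} (hP : IsTame P)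
    {c : Rd d × Rd d → ℂ} (hc : Continuous c) (g g' : 𝓢(Rd d, ℂ)) :
    Continuous fun z : Rd d × Rd d =>
      toBCF (P (c z • stftAtom g z.1 z.2 + stftAtom g' z.1 z.2)) := by
  simp only [map_add, map_smul]
  exact (hc.smul (hP.continuous_atom g)).add (hP.continuous_atom g')

/-- The new operator is composed on the right so that it meets the atom first. It returns atoms for
two windows, to which the hypothesis on P applies; the transpose comes from integration by parts. -/
lemma IsTame.comp_dirDeriv {P : 𝓢(Rd d, ℂ) →L[ℂ] 𝓢(Rd d, ℂ)} (hP : IsTame P) (v : Rd d) :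
    IsTame (P.comp (dirDeriv v)) where
  continuous_atom g := by
    simp only [ContinuousLinearMap.comp_apply, dirDeriv_stftAtom]
    exact continuous_smul_add hP (by fun_prop) _ _
  norm_atom_le g := by
    simp only [ContinuousLinearMap.comp_apply, dirDeriv_stftAtom]
    refine norm_smul_add_le_phaseWeight hP (norm_nonneg v) (fun z => ?_) _ _
    simp only [norm_neg, norm_mul, Complex.norm_real, Complex.norm_I, mul_one]
    refine (norm_inner_le_norm _ _).trans ?_
    gcongr
    exact norm_snd_le_phaseWeight z
  transpose := by
    obtain ⟨Q, hQ⟩ := hP.transpose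
    refine ⟨fun ψ => -dirDeriv v (Q ψ), fun φ ψ => ?_⟩
    rw [ContinuousLinearMap.comp_apply, hQ]
    refine (SchwartzMap.integral_mul_lineDerivOp_right_eq_neg_left (μ := volume) (Q ψ) φ v).trans ?_
    rw [← integral_neg]
    refine integral_congr_ae (Eventually.of_forall fun t => ?_)
    simp only [_root_.neg_apply, neg_mul]
    rfl

lemma IsTame.comp_coordMul {P : 𝓢(Rd d, ℂ) →L[ℂ] 𝓢(Rd d, ℂ)} (hP : IsTame P) (v : Rd d) :
    IsTame (P.comp (coordMul v)) where
  continuous_atom g := by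
    simp only [ContinuousLinearMap.comp_apply, coordMul_stftAtom]
    exact continuous_smul_add hP (by fun_prop) _ _
  norm_atom_le g := by
    simp only [ContinuousLinearMap.comp_apply, coordMul_stftAtom]
    refine norm_smul_add_le_phaseWeight hP (norm_nonneg v) (fun z => ?_) _ _
    simp only [Complex.norm_real]
    refine (norm_inner_le_norm _ _).trans ?_
    rw [mul_comm]
    gcongr
    exact norm_fst_le_phaseWeight z
  transpose := by
    obtain ⟨Q, hQ⟩ := hP.transpose
    refine ⟨fun ψ => coordMul v (Q ψ), fun φ ψ => ?_⟩
    rw [ContinuousLinearMap.comp_apply, hQ]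
    refine integral_congr_ae (Eventually.of_forall fun t => ?_)
    simp only [coordMul_apply]
    ring

end Operators

/-! ### Tempered distributions factor through bounded continuous functions -/

section Factorization

variable {d : ℕ}

/-- A function on the Schwartz space is tamely bounded if it is dominated by finitely many sup norms
of tame operators. -/
def TamelyBounded (q : 𝓢(Rd d, ℂ) → ℝ) : Prop :=
  ∃ (ι : Type) (_ : Fintype ι) (P : ι → 𝓢(Rd d, ℂ) →L[ℂ] 𝓢(Rd d, ℂ)) (C : ℝ), 0 ≤ C ∧
    (∀ i, IsTame (P i)) ∧ ∀ φ, q φ ≤ C * ∑ i, ‖toBCF (P i φ)‖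

lemma TamelyBounded.mono {q q' : 𝓢(Rd d, ℂ) → ℝ} (h : TamelyBounded q') (hle : ∀ φ, q φ ≤ q' φ) :
    TamelyBounded q := by
  obtain ⟨ι, hι, P, C, hC, hP, h⟩ := h
  exact ⟨ι, hι, P, C, hC, hP, fun φ => (hle φ).trans (h φ)⟩

lemma TamelyBounded.const_mul {q : 𝓢(Rd d, ℂ) → ℝ} (h : TamelyBounded q) {c : ℝ} (hc : 0 ≤ c) :
    TamelyBounded fun φ => c * q φ := by
  obtain ⟨ι, hι, P, C, hC, hP, h⟩ := h
  refine ⟨ι, hι, P, c * C, by positivity, hP, fun φ => ?_⟩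
  rw [mul_assoc]
  exact mul_le_mul_of_nonneg_left (h φ) hc

lemma TamelyBounded.sum {κ : Type} (s : Finset κ) {q : κ → 𝓢(Rd d, ℂ) → ℝ}
    (h : ∀ k, TamelyBounded (q k)) : TamelyBounded fun φ => ∑ k ∈ s, q k φ := by
  choose ι hι P C hC hP h using h
  refine ⟨Σ k : s, ι k, inferInstance, fun a => P a.1 a.2, ∑ k ∈ s, C k,
    Finset.sum_nonneg fun k _ => hC k, fun a => hP _ _, fun φ => ?_⟩
  rw [Finset.sum_mul]
  refine Finset.sum_le_sum fun k hk => (h k φ).trans ?_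
  refine mul_le_mul_of_nonneg_left ?_ (hC k)
  rw [Fintype.sum_sigma]
  exact Finset.single_le_sum (f := fun k : s => ∑ i, ‖toBCF (P k i φ)‖)
    (fun _ _ => Finset.sum_nonneg fun _ _ => norm_nonneg _) (Finset.mem_univ (⟨k, hk⟩ : s))

lemma TamelyBounded.comp {q : 𝓢(Rd d, ℂ) → ℝ} (h : TamelyBounded q)
    {Q : 𝓢(Rd d, ℂ) →L[ℂ] 𝓢(Rd d, ℂ)} (hQ : ∀ P, IsTame P → IsTame (P.comp Q)) :
    TamelyBounded fun φ => q (Q φ) := by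
  obtain ⟨ι, hι, P, C, hC, hP, h⟩ := h
  exact ⟨ι, hι, fun i => (P i).comp Q, C, hC, fun i => hQ _ (hP i), fun φ => h (Q φ)⟩

lemma norm_le_sum_abs_inner (t : Rd d) :
    ‖t‖ ≤ ∑ j, |inner ℝ t (EuclideanSpace.basisFun (Fin d) ℝ j)| := by
  set b := EuclideanSpace.basisFun (Fin d) ℝ
  calc ‖t‖ = ‖∑ j, inner ℝ (b j) t • b j‖ := by rw [b.sum_repr']
    _ ≤ ∑ j, ‖inner ℝ (b j) t • b j‖ := norm_sum_le _ _
    _ = _ := by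
      refine Finset.sum_congr rfl fun j _ => ?_
      rw [norm_smul, b.orthonormal.1 j, mul_one, real_inner_comm, Real.norm_eq_abs]

lemma tamelyBounded_pow_mul (k : ℕ) : ∃ q : 𝓢(Rd d, ℂ) → ℝ, TamelyBounded q ∧
    ∀ φ t, ‖t‖ ^ k * ‖φ t‖ ≤ q φ := by
  induction k with
  | zero =>
    refine ⟨fun φ => ‖toBCF φ‖, ⟨Unit, inferInstance, fun _ => ContinuousLinearMap.id ℂ _, 1,
      zero_le_one, fun _ => isTame_id, fun φ => by simp⟩, fun φ t => ?_⟩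
    rw [pow_zero, one_mul]
    exact (toBCF φ).norm_coe_le_norm t
  | succ k ih =>
    obtain ⟨q, hq, h⟩ := ih
    refine ⟨fun φ => ∑ j, q (coordMul (EuclideanSpace.basisFun (Fin d) ℝ j) φ),
      TamelyBounded.sum _ fun j => hq.comp fun P hP => hP.comp_coordMul _, fun φ t => ?_⟩
    calc ‖t‖ ^ (k + 1) * ‖φ t‖ = ‖t‖ * (‖t‖ ^ k * ‖φ t‖) := by ring
      _ ≤ (∑ j, |inner ℝ t (EuclideanSpace.basisFun (Fin d) ℝ j)|) * (‖t‖ ^ k * ‖φ t‖) := by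
          gcongr
          exact norm_le_sum_abs_inner t
      _ ≤ _ := by
          rw [Finset.sum_mul]
          refine Finset.sum_le_sum fun j _ => ?_
          refine le_trans (le_of_eq ?_) (h _ t)
          rw [coordMul_apply, norm_mul, Complex.norm_real, Real.norm_eq_abs]
          ring

lemma IsTame.comp_iteratedLineDeriv {n : ℕ} (m : Fin n → Rd d) :
    ∀ {P : 𝓢(Rd d, ℂ) →L[ℂ] 𝓢(Rd d, ℂ)}, IsTame P →
      IsTame (P.comp (LineDeriv.iteratedLineDerivOpCLM ℂ 𝓢(Rd d, ℂ) m)) := by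
  induction n with
  | zero =>
    intro P hP
    convert hP using 1
    ext φ t
    simp
  | succ n ih =>
    intro P hP
    convert ih (Fin.tail m) (hP.comp_dirDeriv (m 0)) using 1
    ext φ t
    simp only [ContinuousLinearMap.comp_apply, LineDeriv.iteratedLineDerivOpCLM_apply,
      LineDeriv.iteratedLineDerivOp_succ_left]
    rfl

lemma norm_multilinear_le_sum {n : ℕ} (T : ContinuousMultilinearMap ℝ (fun _ : Fin n => Rd d) ℂ) :
    ‖T‖ ≤ ∑ r : Fin n → Fin d, ‖T fun i => EuclideanSpace.basisFun (Fin d) ℝ (r i)‖ := by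
  set b := EuclideanSpace.basisFun (Fin d) ℝ
  refine ContinuousMultilinearMap.opNorm_le_bound (Finset.sum_nonneg fun _ _ => norm_nonneg _)
    fun v => ?_
  have e : v = fun i => ∑ j, inner ℝ (b j) (v i) • b j := by
    funext i
    exact (b.sum_repr' (v i)).symm
  conv_lhs => rw [e]
  rw [ContinuousMultilinearMap.map_sum, Finset.sum_mul]
  refine (norm_sum_le _ _).trans (Finset.sum_le_sum fun r _ => ?_)
  rw [ContinuousMultilinearMap.map_smul_univ, norm_smul, mul_comm]
  gcongr
  rw [norm_prod]
  refine Finset.prod_le_prod (fun _ _ => norm_nonneg _) fun i _ => ?_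
  refine (norm_inner_le_norm _ _).trans ?_
  rw [b.orthonormal.1, one_mul]

/-- The n-th derivative, as a multilinear map, is controlled by its values on basis vectors, which
are iterated directional derivatives. The factor ‖t‖ ^ k is controlled in the same way by products
of coordinates. -/
lemma tamelyBounded_seminorm (k n : ℕ) :
    TamelyBounded fun φ : 𝓢(Rd d, ℂ) => SchwartzMap.seminorm ℂ k n φ := by
  obtain ⟨q, hq, h⟩ := tamelyBounded_pow_mul (d := d) k
  refine (TamelyBounded.sum Finset.univ fun r : Fin n → Fin d =>
    hq.comp (Q := LineDeriv.iteratedLineDerivOpCLM ℂ 𝓢(Rd d, ℂ)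
      fun i => EuclideanSpace.basisFun (Fin d) ℝ (r i))
      fun P hP => hP.comp_iteratedLineDeriv _).mono fun φ => ?_
  have key (t : Rd d) : ‖t‖ ^ k * ‖iteratedFDeriv ℝ n φ t‖ ≤ ∑ r : Fin n → Fin d,
      q (LineDeriv.iteratedLineDerivOpCLM ℂ 𝓢(Rd d, ℂ)
        (fun i => EuclideanSpace.basisFun (Fin d) ℝ (r i)) φ) := by
    refine (mul_le_mul_of_nonneg_left (norm_multilinear_le_sum _) (by positivity)).trans ?_
    rw [Finset.mul_sum]
    refine Finset.sum_le_sum fun r _ => le_trans (le_of_eq ?_) (h _ t)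
    rw [LineDeriv.iteratedLineDerivOpCLM_apply, SchwartzMap.iteratedLineDerivOp_eq_iteratedFDeriv]
  exact SchwartzMap.seminorm_le_bound ℂ k n φ
    ((by positivity : (0 : ℝ) ≤ ‖(0 : Rd d)‖ ^ k * ‖iteratedFDeriv ℝ n φ 0‖).trans (key 0)) key

lemma seminorm_sum_apply {κ : Type} (s : Finset κ) (q : κ → Seminorm ℂ 𝓢(Rd d, ℂ))
    (φ : 𝓢(Rd d, ℂ)) : (∑ k ∈ s, q k) φ = ∑ k ∈ s, q k φ := by
  induction s using Finset.cons_induction with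
  | empty => rfl
  | cons k s hk ih =>
    rw [Finset.sum_cons, Finset.sum_cons, ← ih]
    rfl

lemma tamelyBounded_of_continuous (q : Seminorm ℂ 𝓢(Rd d, ℂ)) (hq : Continuous q) :
    TamelyBounded q := by
  obtain ⟨s, C, -, h⟩ := Seminorm.bound_of_continuous (schwartz_withSeminorms ℂ (Rd d) ℂ) q hq
  refine ((TamelyBounded.sum s fun m : ℕ × ℕ =>
    tamelyBounded_seminorm (d := d) m.1 m.2).const_mul C.2).mono fun φ => ?_
  refine (h φ).trans ?_
  change (C : ℝ) * _ ≤ _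
  refine mul_le_mul_of_nonneg_left ?_ C.2
  refine (Seminorm.finset_sup_le_sum (schwartzSeminormFamily ℂ (Rd d) ℂ) s φ).trans_eq ?_
  exact seminorm_sum_apply s _ φ

/-- The joint embedding given by finitely many operators. -/
def jointBCF {ι : Type} [Fintype ι] (P : ι → 𝓢(Rd d, ℂ) →L[ℂ] 𝓢(Rd d, ℂ)) :
    𝓢(Rd d, ℂ) →L[ℂ] (ι → Rd d →ᵇ ℂ) :=
  ContinuousLinearMap.pi fun i => toBCF.comp (P i)

/-- Continuity bounds |f φ| by the norm of the tuple (P_i φ), so f descends to a bounded functional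
on the range of this embedding and extends by Hahn–Banach. Distributional pairings of integrals of
atoms thereby become Bochner integrals in a Banach space followed by a bounded functional. -/
lemma exists_factorization (f : 𝓢'(Rd d, ℂ)) :
    ∃ (ι : Type) (_ : Fintype ι) (P : ι → 𝓢(Rd d, ℂ) →L[ℂ] 𝓢(Rd d, ℂ))
      (L : (ι → Rd d →ᵇ ℂ) →L[ℂ] ℂ), (∀ i, IsTame (P i)) ∧ ∀ φ, f φ = L (jointBCF P φ) := by
  have hf : Continuous fun φ : 𝓢(Rd d, ℂ) => f φ := ContinuousLinearMap.continuous f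
  let f' : 𝓢(Rd d, ℂ) →ₗ[ℂ] ℂ := ContinuousLinearMap.toLinearMap f
  obtain ⟨ι, hι, P, C, hC, hP, h⟩ := tamelyBounded_of_continuous
    ((normSeminorm ℂ ℂ).comp f') hf.norm
  have hb (φ : 𝓢(Rd d, ℂ)) : ‖f' φ‖ ≤ C * Fintype.card ι * ‖jointBCF P φ‖ := by
    refine (h φ).trans ?_
    rw [mul_assoc]
    refine mul_le_mul_of_nonneg_left ?_ hC
    refine (Finset.sum_le_sum fun i _ => norm_le_pi_norm (jointBCF P φ) i).trans_eq ?_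
    rw [Finset.sum_const, nsmul_eq_mul]
    rfl
  let J : 𝓢(Rd d, ℂ) →ₗ[ℂ] (ι → Rd d →ᵇ ℂ) := (jointBCF P).toLinearMap
  have hker : LinearMap.ker J ≤ LinearMap.ker f' := fun φ hφ => by
    rw [LinearMap.mem_ker] at hφ ⊢
    have h1 := hb φ
    have h2 : jointBCF P φ = 0 := hφ
    rw [h2, norm_zero, mul_zero] at h1
    exact norm_le_zero_iff.1 h1
  let L0 : LinearMap.range J →ₗ[ℂ] ℂ :=
    ((LinearMap.ker J).liftQ f' hker).comp J.quotKerEquivRange.symm.toLinearMap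
  have hL0 (φ : 𝓢(Rd d, ℂ)) : L0 ⟨J φ, LinearMap.mem_range_self J φ⟩ = f' φ := by
    have : J.quotKerEquivRange.symm ⟨J φ, LinearMap.mem_range_self J φ⟩ =
        (LinearMap.ker J).mkQ φ :=
      J.quotKerEquivRange_symm_apply_image φ (LinearMap.mem_range_self J φ)
    change ((LinearMap.ker J).liftQ f' hker) (J.quotKerEquivRange.symm _) = _
    rw [this]
    rfl
  let L1 : StrongDual ℂ (LinearMap.range J) := L0.mkContinuous (C * Fintype.card ι) (by
    rintro ⟨-, φ, rfl⟩
    rw [hL0]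
    exact hb φ)
  obtain ⟨L, hL, -⟩ := exists_extension_norm_eq (LinearMap.range J) L1
  refine ⟨ι, hι, P, L, hP, fun φ => ?_⟩
  exact ((hL ⟨J φ, LinearMap.mem_range_self J φ⟩).trans (hL0 φ)).symm

lemma continuous_jointBCF_stftAtom {ι : Type} [Fintype ι]
    {P : ι → 𝓢(Rd d, ℂ) →L[ℂ] 𝓢(Rd d, ℂ)} (hP : ∀ i, IsTame (P i)) (g : 𝓢(Rd d, ℂ)) :
    Continuous fun z : Rd d × Rd d => jointBCF P (stftAtom g z.1 z.2) :=
  continuous_pi fun i => (hP i).continuous_atom g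

lemma norm_jointBCF_stftAtom_le {ι : Type} [Fintype ι]
    {P : ι → 𝓢(Rd d, ℂ) →L[ℂ] 𝓢(Rd d, ℂ)} (hP : ∀ i, IsTame (P i)) (g : 𝓢(Rd d, ℂ)) :
    ∃ (C : ℝ) (n : ℕ), 0 ≤ C ∧ ∀ z : Rd d × Rd d,
      ‖jointBCF P (stftAtom g z.1 z.2)‖ ≤ C * phaseWeight z ^ n := by
  choose C n hC h using fun i => (hP i).norm_atom_le g
  refine ⟨∑ i, C i, ∑ i, n i, Finset.sum_nonneg fun i _ => hC i, fun z => ?_⟩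
  have h1 := one_le_phaseWeight z
  refine (pi_norm_le_iff_of_nonneg (mul_nonneg (Finset.sum_nonneg fun i _ => hC i)
    (by positivity))).2 fun i => (h i z).trans ?_
  refine mul_le_mul (Finset.single_le_sum (fun i _ => hC i) (Finset.mem_univ i))
    (pow_le_pow_right₀ h1 (Finset.single_le_sum (fun i _ => Nat.zero_le _) (Finset.mem_univ i)))
    (by positivity) (Finset.sum_nonneg fun i _ => hC i)

lemma continuous_stft (g : 𝓢(Rd d, ℂ)) (f : 𝓢'(Rd d, ℂ)) : Continuous (stft g f) := by
  obtain ⟨ι, _, P, L, hP, h⟩ := exists_factorization f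
  have : stft g f = fun z => L (jointBCF P (stftAtom g z.1 z.2)) := funext fun z => h _
  rw [this]
  exact L.continuous.comp (continuous_jointBCF_stftAtom hP g)

end Factorization

/-! ### Pairings with time-frequency shifts -/

section Pairing

variable {d : ℕ}

/-- The pairing `∫ φ(t) g(t - x) e^{i t·ξ} dt` of a Schwartz function with a time-frequency shift of
the window. -/
def shiftPairing (g φ : 𝓢(Rd d, ℂ)) (z : Rd d × Rd d) : ℂ :=
  ∫ t, φ t * conj (stftAtom g z.1 z.2 t)

lemma integrable_mul_conj (φ ψ : 𝓢(Rd d, ℂ)) : Integrable fun t => φ t * conj (ψ t) := by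
  refine (SchwartzMap.integrable (μ := volume) φ).mul_bdd (c := SchwartzMap.seminorm ℝ 0 0 ψ)
    ?_ (Eventually.of_forall fun t => ?_)
  · exact ((Complex.continuous_conj.comp ψ.continuous)).aestronglyMeasurable
  · rw [RCLike.norm_conj]
    exact SchwartzMap.norm_le_seminorm ℝ ψ t

lemma shiftPairing_coordMul (g φ : 𝓢(Rd d, ℂ)) (v : Rd d) (z : Rd d × Rd d) :
    (inner ℝ z.1 v : ℝ) * shiftPairing g φ z =
      shiftPairing g (coordMul v φ) z - shiftPairing (coordMul v g) φ z := by
  have h : shiftPairing g (coordMul v φ) z =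
      ∫ t, φ t * conj (coordMul v (stftAtom g z.1 z.2) t) := by
    refine integral_congr_ae (Eventually.of_forall fun t => ?_)
    simp only [coordMul_apply, map_mul, Complex.conj_ofReal]
    ring
  rw [h, coordMul_stftAtom, eq_sub_iff_add_eq]
  unfold shiftPairing
  rw [← integral_const_mul, ← integral_add ((integrable_mul_conj _ _).const_mul _)
    (integrable_mul_conj _ _)]
  refine integral_congr_ae (Eventually.of_forall fun t => ?_)
  simp only [_root_.add_apply, _root_.smul_apply, map_add, smul_eq_mul, map_mul,
    Complex.conj_ofReal]
  ring

/-- Integration by parts. Together with the analogous identity for coordinates, it buys one power of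
decay in phase space at the cost of one operator applied to φ or to the window. -/
lemma shiftPairing_dirDeriv (g φ : 𝓢(Rd d, ℂ)) (v : Rd d) (z : Rd d × Rd d) :
    ((inner ℝ v z.2 : ℝ) * Complex.I) * shiftPairing g φ z =
      -shiftPairing g (dirDeriv v φ) z - shiftPairing (dirDeriv v g) φ z := by
  have h : -shiftPairing g (dirDeriv v φ) z =
      ∫ t, φ t * conj (dirDeriv v (stftAtom g z.1 z.2) t) := by
    have := SchwartzMap.integral_mul_lineDerivOp_right_eq_neg_left (μ := volume) φ
      (conjS (stftAtom g z.1 z.2)) v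
    refine this.symm.trans ?_
    change ∫ t, φ t * dirDeriv v (conjS (stftAtom g z.1 z.2)) t = _
    rw [dirDeriv_conjS]
    rfl
  rw [h, dirDeriv_stftAtom, eq_sub_iff_add_eq]
  unfold shiftPairing
  rw [← integral_const_mul, ← integral_add ((integrable_mul_conj _ _).const_mul _)
    (integrable_mul_conj _ _)]
  refine integral_congr_ae (Eventually.of_forall fun t => ?_)
  simp only [_root_.add_apply, _root_.smul_apply, map_add, smul_eq_mul, map_mul, map_neg,
    Complex.conj_ofReal, Complex.conj_I]
  ring

lemma norm_shiftPairing_le (g φ : 𝓢(Rd d, ℂ)) (z : Rd d × Rd d) :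
    ‖shiftPairing g φ z‖ ≤ (∫ t, ‖g t‖) * SchwartzMap.seminorm ℂ 0 0 φ := by
  refine (norm_integral_le_integral_norm _).trans ?_
  rw [← integral_sub_right_eq_self (fun t => ‖g t‖) z.1, mul_comm, ← integral_const_mul]
  refine integral_mono (integrable_mul_conj _ _).norm ?_ fun t => ?_
  · exact ((SchwartzMap.integrable (μ := volume) g).norm.comp_sub_right z.1).const_mul _
  · simp only [norm_mul, RCLike.norm_conj, norm_stftAtom_apply]
    gcongr
    exact SchwartzMap.norm_le_seminorm ℂ φ t

/-- `h(z) |⟨φ, π(z) ḡ⟩|` is bounded by a continuous seminorm of `φ`, for every window. -/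
def PairingDecay (h : Rd d × Rd d → ℝ) : Prop :=
  ∀ g : 𝓢(Rd d, ℂ), ∃ q : Seminorm ℂ 𝓢(Rd d, ℂ), Continuous q ∧
    ∀ φ z, h z * ‖shiftPairing g φ z‖ ≤ q φ

lemma continuous_seminorm_sum {κ : Type} (s : Finset κ) {q : κ → Seminorm ℂ 𝓢(Rd d, ℂ)}
    (hq : ∀ k, Continuous (q k)) : Continuous (∑ k ∈ s, q k : Seminorm ℂ 𝓢(Rd d, ℂ)) := by
  have : ⇑(∑ k ∈ s, q k : Seminorm ℂ 𝓢(Rd d, ℂ)) = fun φ => ∑ k ∈ s, q k φ := by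
    funext φ
    exact seminorm_sum_apply s q φ
  rw [this]
  exact continuous_finsetSum _ fun k _ => hq k

/-- A factor ‖c z‖ is at most the sum of its coordinates, each of which is exchanged for an
application of T to φ or to the window. The term with the modified window is covered because
`PairingDecay` quantifies over all windows. -/
lemma PairingDecay.step {h : Rd d × Rd d → ℝ} (hd : PairingDecay h) (h0 : ∀ z, 0 ≤ h z)
    {c : Rd d × Rd d → Rd d} (T : Rd d → 𝓢(Rd d, ℂ) →L[ℂ] 𝓢(Rd d, ℂ))
    (hT : ∀ v g φ z, |inner ℝ (c z) v| * ‖shiftPairing g φ z‖ ≤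
      ‖shiftPairing g (T v φ) z‖ + ‖shiftPairing (T v g) φ z‖) :
    PairingDecay fun z => (1 + ‖c z‖) * h z := by
  intro g
  obtain ⟨q, hq, hqb⟩ := hd g
  choose r hr hrb using fun j => hd (T (EuclideanSpace.basisFun (Fin d) ℝ j) g)
  refine ⟨q + ∑ j, (q.comp (T (EuclideanSpace.basisFun (Fin d) ℝ j)).toLinearMap + r j), ?_,
    fun φ z => ?_⟩
  · exact hq.add (continuous_seminorm_sum _ fun j =>
      (hq.comp (T (EuclideanSpace.basisFun (Fin d) ℝ j)).continuous).add (hr j))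
  · beta_reduce
    rw [add_mul, add_mul, one_mul]
    change _ ≤ q φ + (∑ j, (q.comp _ + r j) : Seminorm ℂ 𝓢(Rd d, ℂ)) φ
    rw [seminorm_sum_apply]
    refine add_le_add (hqb φ z) ?_
    rw [mul_assoc]
    refine (mul_le_mul_of_nonneg_right (norm_le_sum_abs_inner (c z))
      (mul_nonneg (h0 z) (norm_nonneg _))).trans ?_
    rw [Finset.sum_mul]
    refine Finset.sum_le_sum fun j _ => ?_
    calc _ = h z * (|inner ℝ (c z) (EuclideanSpace.basisFun (Fin d) ℝ j)| *
          ‖shiftPairing g φ z‖) := by ring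
      _ ≤ h z * _ := mul_le_mul_of_nonneg_left (hT _ g φ z) (h0 z)
      _ ≤ _ := by
        rw [mul_add]
        exact add_le_add (hqb _ z) (hrb j φ z)

lemma pairingDecay_phaseWeight_pow (n : ℕ) : PairingDecay (d := d) fun z => phaseWeight z ^ n := by
  induction n with
  | zero =>
    intro g
    have h0 : 0 ≤ ∫ t, ‖g t‖ := integral_nonneg fun _ => norm_nonneg _
    obtain ⟨c, hc⟩ := NNReal.canLift.prf _ h0
    refine ⟨c • (SchwartzMap.seminorm ℂ 0 0 : Seminorm ℂ 𝓢(Rd d, ℂ)), ?_, fun φ z => ?_⟩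
    · exact ((schwartz_withSeminorms ℂ (Rd d) ℂ).continuous_seminorm (0, 0)).const_smul c
    · beta_reduce
      rw [pow_zero, one_mul]
      have := norm_shiftPairing_le g φ z
      rwa [← hc] at this
  | succ n ih =>
    have h0 (z : Rd d × Rd d) : 0 ≤ phaseWeight z ^ n :=
      pow_nonneg (zero_le_one.trans (one_le_phaseWeight z)) n
    have h1 := ih.step h0 (c := Prod.snd) dirDeriv fun v g φ z => by
      have := congrArg norm (shiftPairing_dirDeriv g φ v z)
      rw [norm_mul, norm_mul, Complex.norm_I, mul_one, Complex.norm_real, Real.norm_eq_abs,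
        real_inner_comm] at this
      rw [this]
      refine (norm_sub_le _ _).trans_eq ?_
      rw [norm_neg]
    have h2 := h1.step (fun z => by have := h0 z; positivity) (c := Prod.fst) coordMul
      fun v g φ z => by
        have := congrArg norm (shiftPairing_coordMul g φ v z)
        rw [norm_mul, Complex.norm_real, Real.norm_eq_abs] at this
        rw [this]
        exact norm_sub_le _ _
    have e : (fun z : Rd d × Rd d => phaseWeight z ^ (n + 1)) =
        fun z => (1 + ‖z.1‖) * ((1 + ‖z.2‖) * phaseWeight z ^ n) := by
      funext z
      simp only [phaseWeight]
      ring
    rw [e]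
    exact h2

lemma continuous_shiftPairing (g φ : 𝓢(Rd d, ℂ)) : Continuous (shiftPairing g φ) := by
  have h : shiftPairing g φ = fun z =>
      conj (stft g (SchwartzMap.toTemperedDistributionCLM (Rd d) ℂ volume (conjS φ)) z) := by
    funext z
    unfold stft shiftPairing
    rw [SchwartzMap.toTemperedDistributionCLM_apply_apply (μ := volume), ← integral_conj]
    refine integral_congr_ae (Eventually.of_forall fun t => ?_)
    simp [mul_comm]
  rw [h]
  exact Complex.continuous_conj.comp (continuous_stft g _)

end Pairing

/-! ### The orthogonality relation and the reproducing formula -/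

section Moyal

variable {d : ℕ}

lemma integrable_of_phaseWeight_le {E : Type*} [NormedAddCommGroup E] {F : Rd d × Rd d → E}
    (hF : AEStronglyMeasurable F volume) {C : ℝ}
    (h : ∀ z, phaseWeight z ^ (d + 1) * ‖F z‖ ≤ C) : Integrable F volume := by
  have hm : Measurable fun z : Rd d × Rd d => (phaseWeight z ^ (d + 1))⁻¹ := by
    unfold phaseWeight; fun_prop
  have hpos (z : Rd d × Rd d) : 0 < phaseWeight z := zero_lt_one.trans_le (one_le_phaseWeight z)
  have hi : Integrable (fun z : Rd d × Rd d => (phaseWeight z ^ (d + 1))⁻¹) volume := by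
    refine ⟨hm.aestronglyMeasurable, ?_⟩
    rw [hasFiniteIntegral_iff_ofReal (Eventually.of_forall fun z => by
      have := hpos z; positivity)]
    exact lintegral_phaseDecay_lt_top
  refine (hi.const_mul C).mono' hF (Eventually.of_forall fun z => ?_)
  have := hpos z
  rw [← div_eq_mul_inv, le_div_iff₀ (by positivity), mul_comm]
  exact h z

/-- The integral of a Schwartz function against a time-frequency atom. -/
def atomIntegral (g ψ : 𝓢(Rd d, ℂ)) (z : Rd d × Rd d) : ℂ :=
  ∫ t, ψ t * stftAtom g z.1 z.2 t

lemma atomIntegral_eq_conj (g ψ : 𝓢(Rd d, ℂ)) (z : Rd d × Rd d) :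
    atomIntegral g ψ z = conj (shiftPairing g (conjS ψ) z) := by
  unfold atomIntegral shiftPairing
  rw [← integral_conj]
  refine integral_congr_ae (Eventually.of_forall fun t => ?_)
  simp

/-- The product of `φ` with the window translated by `x`. -/
def windowed (g φ : 𝓢(Rd d, ℂ)) (x : Rd d) : 𝓢(Rd d, ℂ) :=
  SchwartzMap.pairing (ContinuousLinearMap.mul ℂ ℂ) φ (SchwartzMap.compSubConstCLM ℝ x g)

lemma windowed_apply (g φ : 𝓢(Rd d, ℂ)) (x t : Rd d) : windowed g φ x t = φ t * g (t - x) := by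
  simp [windowed]

/-- The dilation by (2π)⁻¹ reconciles the character e^{i t·ξ} with the normalisation e^{2πi t·ξ} of
the Fourier transform; it is the source of (2π)ᵈ in `moyalConst`. -/
lemma shiftPairing_eq_fourierInv (g φ : 𝓢(Rd d, ℂ)) (x ξ : Rd d) :
    shiftPairing g φ (x, ξ) = (𝓕⁻ (windowed g φ x)) ((2 * Real.pi)⁻¹ • ξ) := by
  rw [SchwartzMap.fourierInv_coe, Real.fourierInv_eq']
  refine integral_congr_ae (Eventually.of_forall fun t => ?_)
  have hpi := Real.pi_ne_zero
  simp only [stftAtom_apply, windowed_apply, inner_smul_right, map_mul, Complex.conj_conj,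
    smul_eq_mul, ← Complex.exp_conj, map_neg, Complex.conj_ofReal, Complex.conj_I]
  have : 2 * Real.pi * ((2 * Real.pi)⁻¹ * inner ℝ t ξ) = inner ℝ t ξ := by field_simp
  rw [this]
  simp only [mul_neg, neg_neg]
  ring

lemma atomIntegral_eq_fourier (g φ : 𝓢(Rd d, ℂ)) (x ξ : Rd d) :
    atomIntegral g φ (x, ξ) = (𝓕 (windowed (conjS g) φ x)) ((2 * Real.pi)⁻¹ • ξ) := by
  rw [SchwartzMap.fourier_coe, Real.fourier_eq']
  refine integral_congr_ae (Eventually.of_forall fun t => ?_)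
  have hpi := Real.pi_ne_zero
  simp only [stftAtom_apply, windowed_apply, inner_smul_right, conjS_apply, smul_eq_mul]
  have : -2 * Real.pi * ((2 * Real.pi)⁻¹ * inner ℝ t ξ) = -inner ℝ t ξ := by field_simp
  rw [this]
  push_cast
  rw [neg_mul]
  ring

lemma continuous_atomIntegral (g ψ : 𝓢(Rd d, ℂ)) : Continuous (atomIntegral g ψ) := by
  have : atomIntegral g ψ = fun z => conj (shiftPairing g (conjS ψ) z) :=
    funext (atomIntegral_eq_conj g ψ)
  rw [this]
  exact Complex.continuous_conj.comp (continuous_shiftPairing g _)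

lemma exists_phaseWeight_pow_mul_shiftPairing_le (g φ : 𝓢(Rd d, ℂ)) (n : ℕ) :
    ∃ C : ℝ, 0 ≤ C ∧ ∀ z, phaseWeight z ^ n * ‖shiftPairing g φ z‖ ≤ C := by
  obtain ⟨q, -, h⟩ := pairingDecay_phaseWeight_pow n g
  exact ⟨q φ, apply_nonneg _ _, h φ⟩

/-- The constant `(2π)ᵈ ‖g‖₂²` of the orthogonality relation. -/
def moyalConst (g : 𝓢(Rd d, ℂ)) : ℝ := (2 * Real.pi) ^ d * ∫ t, ‖g t‖ ^ 2

lemma integrable_norm_sq (g : 𝓢(Rd d, ℂ)) : Integrable fun t => ‖g t‖ ^ 2 := by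
  have := (integrable_mul_conj g g).norm
  refine this.congr (Eventually.of_forall fun t => ?_)
  simp [sq]

lemma moyalConst_pos {g : 𝓢(Rd d, ℂ)} (hg : g ≠ 0) : 0 < moyalConst g := by
  refine mul_pos (by positivity) ?_
  refine (integral_pos_iff_support_of_nonneg (fun t => by positivity)
    (integrable_norm_sq g)).2 ?_
  have hc : Continuous fun t => ‖g t‖ ^ 2 := by have := g.continuous; fun_prop
  refine hc.isOpen_support.measure_pos volume ?_
  by_contra h
  refine hg (SchwartzMap.ext fun t => ?_)
  have h1 : t ∉ Function.support fun t => ‖g t‖ ^ 2 := fun ht => h ⟨t, ht⟩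
  simpa using h1

/-- For fixed x the two factors are an inverse and a direct Fourier transform in ξ. Moving the
transform from one factor to the other by the multiplication formula cancels it against the inverse.
-/
lemma integral_shiftPairing_mul_atomIntegral_section (g φ ψ : 𝓢(Rd d, ℂ)) (x : Rd d) :
    ∫ ξ, shiftPairing g φ (x, ξ) * atomIntegral g ψ (x, ξ) =
      (2 * Real.pi : ℝ) ^ d * ∫ t, (φ t * ψ t) * (‖g (t - x)‖ ^ 2 : ℝ) := by
  simp only [shiftPairing_eq_fourierInv, atomIntegral_eq_fourier]
  have h1 (a b : 𝓢(Rd d, ℂ)) : ∫ ξ : Rd d, a ((2 * Real.pi)⁻¹ • ξ) * b ((2 * Real.pi)⁻¹ • ξ) =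
      (2 * Real.pi) ^ Module.finrank ℝ (Rd d) • ∫ ξ, a ξ * b ξ :=
    Measure.integral_comp_inv_smul_of_nonneg volume (fun ξ => a ξ * b ξ) (by positivity)
  have h := SchwartzMap.integral_fourier_mul_eq (windowed (conjS g) ψ x) (𝓕⁻ (windowed g φ x))
  rw [FourierTransform.fourier_fourierInv_eq] at h
  rw [h1, integral_congr_ae (Eventually.of_forall fun ξ => mul_comm _ _), h,
    finrank_euclideanSpace_fin, Complex.real_smul]
  push_cast
  congr 1
  refine integral_congr_ae (Eventually.of_forall fun t => ?_)
  simp only [windowed_apply, conjS_apply]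
  have := Complex.mul_conj' (g (t - x))
  rw [← this]
  ring

/-- The orthogonality relation for Schwartz functions. -/
lemma integral_shiftPairing_mul_atomIntegral (g φ ψ : 𝓢(Rd d, ℂ)) :
    ∫ z, shiftPairing g φ z * atomIntegral g ψ z = moyalConst g * ∫ t, φ t * ψ t := by
  have hint : Integrable (fun z => shiftPairing g φ z * atomIntegral g ψ z) volume := by
    obtain ⟨C, hC, h⟩ := exists_phaseWeight_pow_mul_shiftPairing_le g φ (d + 1)
    obtain ⟨C', hC', h'⟩ := exists_phaseWeight_pow_mul_shiftPairing_le g (conjS ψ) 0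
    refine integrable_of_phaseWeight_le (C := C * C') ?_ fun z => ?_
    · exact ((continuous_shiftPairing g φ).mul (continuous_atomIntegral g ψ)).aestronglyMeasurable
    · rw [norm_mul, ← mul_assoc, atomIntegral_eq_conj, RCLike.norm_conj]
      have h2 := h' z
      rw [pow_zero, one_mul] at h2
      exact mul_le_mul (h z) h2 (norm_nonneg _) hC
  rw [Measure.volume_eq_prod, integral_prod _ hint]
  simp only [integral_shiftPairing_mul_atomIntegral_section]
  rw [integral_const_mul]
  have hprod : Integrable (fun t => φ t * ψ t) := by
    have := integrable_mul_conj φ (conjS ψ)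
    simpa using this
  -- With |g|² reflected, φ(t)ψ(t)|g(t - x)|² is the integrand of a convolution of integrable
  -- functions. This gives the joint integrability needed for Fubini, after which the integral over
  -- x no longer depends on t.
  have hsq : Integrable (fun s : Rd d => ((‖g (-s)‖ ^ 2 : ℝ) : ℂ)) :=
    (integrable_norm_sq g).comp_neg.ofReal
  have hconv := hprod.convolution_integrand (ContinuousLinearMap.mul ℂ ℂ) hsq
  simp only [ContinuousLinearMap.mul_apply', neg_sub] at hconv
  rw [integral_integral_swap hconv]
  have h1 (t : Rd d) : ∫ x, (φ t * ψ t) * ((‖g (t - x)‖ ^ 2 : ℝ) : ℂ) =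
      (φ t * ψ t) * ((∫ s, ‖g s‖ ^ 2 : ℝ) : ℂ) := by
    rw [integral_const_mul, integral_complex_ofReal,
      integral_sub_left_eq_self (fun s => ‖g s‖ ^ 2) volume t]
  simp only [h1, integral_mul_const, moyalConst]
  push_cast
  ring

lemma eq_zero_of_integral_schwartz_mul_eq_zero {u : Rd d →ᵇ ℂ}
    (h : ∀ ψ : 𝓢(Rd d, ℂ), ∫ t, ψ t * u t = 0) : u = 0 := by
  have h1 : ∀ᵐ t : Rd d, u t = 0 := by
    refine ae_eq_zero_of_integral_contDiff_smul_eq_zero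
      u.continuous.locallyIntegrable fun η hη hs => ?_
    have hc : ContDiff ℝ (⊤ : ℕ∞) fun t => ((η t : ℝ) : ℂ) := Complex.ofRealCLM.contDiff.comp hη
    have hs' : HasCompactSupport fun t => ((η t : ℝ) : ℂ) :=
      hs.comp_left (g := fun r : ℝ => (r : ℂ)) Complex.ofReal_zero
    refine (integral_congr_ae (Eventually.of_forall fun t => ?_)).trans (h (hs'.toSchwartzMap hc))
    simp
  have h2 : (u : Rd d → ℂ) = fun _ => 0 :=
    (Continuous.ae_eq_iff_eq volume u.continuous continuous_const).1 h1
  ext t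
  exact congrFun h2 t

/-- Integration against a Schwartz function, on bounded continuous functions. -/
lemma exists_clm_integral_schwartz (ψ : 𝓢(Rd d, ℂ)) :
    ∃ T : (Rd d →ᵇ ℂ) →L[ℂ] ℂ, ∀ u, T u = ∫ t, ψ t * u t := by
  have hi (u : Rd d →ᵇ ℂ) : Integrable fun t => ψ t * u t :=
    (SchwartzMap.integrable (μ := volume) ψ).mul_bdd u.continuous.aestronglyMeasurable
      (Eventually.of_forall fun t => u.norm_coe_le_norm t)
  refine ⟨LinearMap.mkContinuous
    { toFun := fun u : Rd d →ᵇ ℂ => ∫ t, ψ t * u t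
      map_add' := fun u v => by
        rw [← integral_add (hi u) (hi v)]
        simp only [BoundedContinuousFunction.coe_add, Pi.add_apply, mul_add]
      map_smul' := fun c u => by
        rw [RingHom.id_apply, smul_eq_mul, ← integral_const_mul]
        simp only [BoundedContinuousFunction.coe_smul, smul_eq_mul, mul_left_comm] }
    (∫ t, ‖ψ t‖) fun u => ?_, fun u => rfl⟩
  refine (norm_integral_le_integral_norm _).trans ?_
  rw [← integral_mul_const]
  refine integral_mono (hi u).norm
    ((SchwartzMap.integrable (μ := volume) ψ).norm.mul_const _) fun t => ?_
  simp only [norm_mul]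
  gcongr
  exact u.norm_coe_le_norm t

lemma integrable_shiftPairing_smul (g φ : 𝓢(Rd d, ℂ)) {E : Type*} [NormedAddCommGroup E]
    [NormedSpace ℂ E] {F : Rd d × Rd d → E} (hF : Continuous F) {C : ℝ} {n : ℕ} (hC : 0 ≤ C)
    (h : ∀ z, ‖F z‖ ≤ C * phaseWeight z ^ n) :
    Integrable (fun z => shiftPairing g φ z • F z) volume := by
  obtain ⟨D, hD, hD'⟩ := exists_phaseWeight_pow_mul_shiftPairing_le g φ (d + 1 + n)
  refine integrable_of_phaseWeight_le (C := D * C) ?_ fun z => ?_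
  · exact ((continuous_shiftPairing g φ).smul hF).aestronglyMeasurable
  · have := zero_le_one.trans (one_le_phaseWeight z)
    calc _ ≤ phaseWeight z ^ (d + 1) * (‖shiftPairing g φ z‖ * (C * phaseWeight z ^ n)) := by
          rw [norm_smul]
          gcongr
          exact h z
      _ = phaseWeight z ^ (d + 1 + n) * ‖shiftPairing g φ z‖ * C := by ring
      _ ≤ D * C := by gcongr; exact hD' z

/-- A bounded continuous function is determined by its integrals against Schwartz functions. In each
component the transpose moves P i onto the test function, and the orthogonality relation evaluates
what remains. -/
lemma integral_shiftPairing_smul_jointBCF {ι : Type} [Fintype ι]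
    {P : ι → 𝓢(Rd d, ℂ) →L[ℂ] 𝓢(Rd d, ℂ)} (hP : ∀ i, IsTame (P i)) (g φ : 𝓢(Rd d, ℂ)) :
    ∫ z : Rd d × Rd d, shiftPairing g φ z • jointBCF P (stftAtom g z.1 z.2) =
      (moyalConst g : ℂ) • jointBCF P φ := by
  obtain ⟨C, n, hC, hb⟩ := norm_jointBCF_stftAtom_le hP g
  have hint := integrable_shiftPairing_smul g φ (continuous_jointBCF_stftAtom hP g) hC hb
  funext i
  refine sub_eq_zero.1 (eq_zero_of_integral_schwartz_mul_eq_zero fun ψ => ?_)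
  obtain ⟨T, hT⟩ := exists_clm_integral_schwartz ψ
  rw [← hT, map_sub, sub_eq_zero]
  let S : (ι → Rd d →ᵇ ℂ) →L[ℂ] ℂ := T.comp (ContinuousLinearMap.proj i)
  change S _ = T _
  rw [← S.integral_comp_comm hint]
  obtain ⟨Q, hQ⟩ := (hP i).transpose
  have h1 (z : Rd d × Rd d) : S (shiftPairing g φ z • jointBCF P (stftAtom g z.1 z.2)) =
      shiftPairing g φ z * atomIntegral g (Q ψ) z := by
    rw [map_smul, smul_eq_mul]
    congr 1
    exact (hT _).trans (hQ _ ψ)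
  simp only [h1, integral_shiftPairing_mul_atomIntegral]
  change _ = T ((moyalConst g : ℂ) • toBCF (P i φ))
  rw [map_smul, smul_eq_mul, hT]
  congr 1
  refine Eq.trans ?_ (hQ φ ψ).symm
  simp only [mul_comm]

lemma exists_norm_stft_le (g : 𝓢(Rd d, ℂ)) (f : 𝓢'(Rd d, ℂ)) :
    ∃ (C : ℝ) (n : ℕ), 0 ≤ C ∧ ∀ z, ‖stft g f z‖ ≤ C * phaseWeight z ^ n := by
  obtain ⟨ι, _, P, L, hP, h⟩ := exists_factorization f
  obtain ⟨C, n, hC, hb⟩ := norm_jointBCF_stftAtom_le hP g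
  refine ⟨‖L‖ * C, n, by positivity, fun z => ?_⟩
  have : stft g f z = L (jointBCF P (stftAtom g z.1 z.2)) := h _
  rw [this, mul_assoc]
  exact (L.le_opNorm _).trans (by gcongr; exact hb z)

lemma integrable_shiftPairing_mul_stft (g φ : 𝓢(Rd d, ℂ)) (f : 𝓢'(Rd d, ℂ)) :
    Integrable (fun z => shiftPairing g φ z * stft g f z) volume := by
  obtain ⟨C, n, hC, h⟩ := exists_norm_stft_le g f
  exact integrable_shiftPairing_smul g φ (continuous_stft g f) hC h

/-- The reproducing formula for tempered distributions. -/
lemma integral_shiftPairing_mul_stft (g φ : 𝓢(Rd d, ℂ)) (f : 𝓢'(Rd d, ℂ)) :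
    ∫ z, shiftPairing g φ z * stft g f z = moyalConst g * f φ := by
  obtain ⟨ι, _, P, L, hP, h⟩ := exists_factorization f
  obtain ⟨C, n, hC, hb⟩ := norm_jointBCF_stftAtom_le hP g
  have hint := integrable_shiftPairing_smul g φ (continuous_jointBCF_stftAtom hP g) hC hb
  have h1 (z : Rd d × Rd d) : shiftPairing g φ z * stft g f z =
      L (shiftPairing g φ z • jointBCF P (stftAtom g z.1 z.2)) := by
    rw [map_smul, smul_eq_mul]
    congr 1
    exact h _
  simp only [h1]
  rw [L.integral_comp_comm hint, integral_shiftPairing_smul_jointBCF hP, map_smul, smul_eq_mul,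
    ← h]

end Moyal

/-! ### The reproducing kernel -/

section Kernel

variable {d : ℕ}

/-- The reproducing kernel of the short-time Fourier transform (up to a constant). -/
def stftKernel (g : 𝓢(Rd d, ℂ)) (z z' : Rd d × Rd d) : ℂ :=
  shiftPairing g (stftAtom g z.1 z.2) z'

lemma integral_stftKernel_mul_stft (g : 𝓢(Rd d, ℂ)) (f : 𝓢'(Rd d, ℂ)) (z : Rd d × Rd d) :
    ∫ z', stftKernel g z z' * stft g f z' = moyalConst g * stft g f z :=
  integral_shiftPairing_mul_stft g _ f

/-- Covariance of time-frequency shifts: apart from a unimodular phase the kernel depends only on z'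
- z. Hence it is dominated by a convolution kernel. -/
lemma stftKernel_eq (g : 𝓢(Rd d, ℂ)) (z z' : Rd d × Rd d) :
    stftKernel g z z' = Complex.exp ((inner ℝ z.1 (z'.2 - z.2) : ℝ) * Complex.I) *
      shiftPairing g (conjS g) (z' - z) := by
  unfold stftKernel shiftPairing
  rw [← integral_add_right_eq_self _ z.1, ← integral_const_mul]
  refine integral_congr_ae (Eventually.of_forall fun t => ?_)
  simp only [stftAtom_apply, map_mul, Complex.conj_conj, conjS_apply, Prod.fst_sub, Prod.snd_sub,
    ← Complex.exp_conj, map_neg, Complex.conj_ofReal, Complex.conj_I, add_sub_cancel_right,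
    mul_neg, neg_neg, inner_add_left, inner_sub_right]
  have e : t - (z'.1 - z.1) = t + z.1 - z'.1 := by abel
  rw [e]
  have e2 : Complex.exp (-(((inner ℝ t z.2 + inner ℝ z.1 z.2 : ℝ) : ℂ) * Complex.I)) *
      Complex.exp (((inner ℝ t z'.2 + inner ℝ z.1 z'.2 : ℝ) : ℂ) * Complex.I) =
      Complex.exp (((inner ℝ z.1 z'.2 - inner ℝ z.1 z.2 : ℝ) : ℂ) * Complex.I) *
      Complex.exp (((inner ℝ t z'.2 - inner ℝ t z.2 : ℝ) : ℂ) * Complex.I) := by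
    rw [← Complex.exp_add, ← Complex.exp_add]
    congr 1
    push_cast
    ring
  linear_combination (conj (g t) * g (t + z.1 - z'.1)) * e2

lemma norm_stftKernel (g : 𝓢(Rd d, ℂ)) (z z' : Rd d × Rd d) :
    ‖stftKernel g z z'‖ = ‖shiftPairing g (conjS g) (z' - z)‖ := by
  rw [stftKernel_eq, norm_mul, Complex.norm_exp_ofReal_mul_I, one_mul]

lemma continuous_stftKernel (g : 𝓢(Rd d, ℂ)) :
    Continuous fun a : (Rd d × Rd d) × (Rd d × Rd d) => stftKernel g a.1 a.2 := by
  simp only [stftKernel_eq]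
  have := continuous_shiftPairing g (conjS g)
  fun_prop

/-- The tempered distribution given by a time-frequency shift of the window. -/
def shiftDistribution (g : 𝓢(Rd d, ℂ)) (y : Rd d × Rd d) : 𝓢'(Rd d, ℂ) :=
  SchwartzMap.toTemperedDistributionCLM (Rd d) ℂ volume (conjS (stftAtom g y.1 y.2))

lemma stft_shiftDistribution (g : 𝓢(Rd d, ℂ)) (y z : Rd d × Rd d) :
    stft g (shiftDistribution g y) z = stftKernel g z y := by
  unfold stft shiftDistribution stftKernel shiftPairing
  rw [SchwartzMap.toTemperedDistributionCLM_apply_apply (μ := volume)]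
  rfl

lemma exists_phaseWeight_pow_mul_stftKernel_le (g : 𝓢(Rd d, ℂ)) (n : ℕ) :
    ∃ C : ℝ, 0 ≤ C ∧ ∀ z z', phaseWeight (z - z') ^ n * ‖stftKernel g z z'‖ ≤ C := by
  obtain ⟨C, hC, h⟩ := exists_phaseWeight_pow_mul_shiftPairing_le g (conjS g) n
  refine ⟨C, hC, fun z z' => ?_⟩
  have : phaseWeight (z - z') = phaseWeight (z' - z) := by
    simp only [phaseWeight, Prod.fst_sub, Prod.snd_sub, norm_sub_rev z.1, norm_sub_rev z.2]
  rw [norm_stftKernel, this]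
  exact h _

end Kernel

/-! ### Weights -/

section Weights

variable {d : ℕ}

lemma phaseWeight_pos (z : Rd d × Rd d) : 0 < phaseWeight z :=
  zero_lt_one.trans_le (one_le_phaseWeight z)

lemma phaseWeight_add_le (x y : Rd d × Rd d) :
    phaseWeight (x + y) ≤ phaseWeight x * phaseWeight y := by
  have h (a b : Rd d) : 1 + ‖a + b‖ ≤ (1 + ‖a‖) * (1 + ‖b‖) := by
    have := norm_add_le a b
    nlinarith [norm_nonneg a, norm_nonneg b]
  calc phaseWeight (x + y) ≤ ((1 + ‖x.1‖) * (1 + ‖y.1‖)) * ((1 + ‖x.2‖) * (1 + ‖y.2‖)) :=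
        mul_le_mul (h _ _) (h _ _) (by positivity) (by positivity)
    _ = _ := by unfold phaseWeight; ring

lemma phaseWeight_le_sub_mul (z y : Rd d × Rd d) :
    phaseWeight z ≤ phaseWeight (z - y) * phaseWeight y := by
  simpa using phaseWeight_add_le (z - y) y

lemma norm_le_phaseWeight (z : Rd d × Rd d) : ‖z‖ ≤ phaseWeight z :=
  max_le (norm_fst_le_phaseWeight z) (norm_snd_le_phaseWeight z)

lemma phaseWeight_le_norm (z : Rd d × Rd d) : phaseWeight z ≤ (1 + ‖z‖) * (1 + ‖z‖) := by
  have h1 := norm_fst_le z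
  have h2 := norm_snd_le z
  unfold phaseWeight
  gcongr

lemma polyWeight_le (s : ℝ) : ∃ k : ℕ, ∀ z : Rd d × Rd d, polyWeight s z ≤ phaseWeight z ^ k := by
  refine ⟨⌈|s|⌉₊, fun z => ?_⟩
  have h1 := norm_nonneg z.1
  have h2 := norm_nonneg z.2
  have hb : 1 ≤ 1 + ‖z.1‖ ^ 2 + ‖z.2‖ ^ 2 := by nlinarith
  have hle : 1 + ‖z.1‖ ^ 2 + ‖z.2‖ ^ 2 ≤ phaseWeight z ^ (2 : ℝ) := by
    -- The base of `polyWeight` is at most the square of `phaseWeight`, so the exponent |s|/2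
    -- becomes |s|, and a natural number above |s| suffices.
    rw [Real.rpow_two]
    unfold phaseWeight
    nlinarith [mul_nonneg h1 h2, sq_nonneg (‖z.1‖ * ‖z.2‖), mul_nonneg h1 (mul_nonneg h1 h2),
      mul_nonneg h2 (mul_nonneg h1 h2)]
  have hp := one_le_phaseWeight z
  calc polyWeight s z ≤ (1 + ‖z.1‖ ^ 2 + ‖z.2‖ ^ 2) ^ (|s| / 2) :=
        Real.rpow_le_rpow_of_exponent_le hb (by linarith [le_abs_self s])
    _ ≤ (phaseWeight z ^ (2 : ℝ)) ^ (|s| / 2) :=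
        Real.rpow_le_rpow (by linarith) hle (by positivity)
    _ = phaseWeight z ^ |s| := by
        rw [← Real.rpow_mul (by linarith)]
        congr 1
        ring
    _ ≤ phaseWeight z ^ ((⌈|s|⌉₊ : ℕ) : ℝ) :=
        Real.rpow_le_rpow_of_exponent_le hp (Nat.le_ceil _)
    _ = _ := Real.rpow_natCast _ _

/-- A measurable weight that is moderate with respect to, and bounded above and below by, powers of
`phaseWeight`. -/
structure IsControlledWeight (w : Rd d × Rd d → ℝ) (C : ℝ) (k : ℕ) : Prop where
  aestronglyMeasurable : AEStronglyMeasurable w volume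
  nonneg : ∀ z, 0 ≤ w z
  const_pos : 0 < C
  moderate : ∀ x y, w (x + y) ≤ C * phaseWeight x ^ k * w y
  one_le : ∀ z, 1 ≤ C * phaseWeight z ^ k * w z
  le : ∀ z, w z ≤ C * phaseWeight z ^ k

/-- Moderateness bounds w from both sides: from above by moving 0 to z, and from below by moving z
to a point z0 where w does not vanish. -/
lemma exists_isControlledWeight {w : Rd d × Rd d → ℝ} (hw : IsWeight w) (hw0 : w ≠ 0)
    (hmod : IsPolynomiallyModerate w) : ∃ (C : ℝ) (k : ℕ), IsControlledWeight w C k := by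
  obtain ⟨s, C, hC⟩ := hmod
  obtain ⟨k, hk⟩ := polyWeight_le (d := d) s
  have hn := hw.1
  set D := max C 1 with hD
  have hD1 : 1 ≤ D := le_max_right _ _
  have hpoly (z : Rd d × Rd d) : 0 ≤ polyWeight s z := by unfold polyWeight; positivity
  have h1 (x y : Rd d × Rd d) : w (x + y) ≤ D * phaseWeight x ^ k * w y := by
    refine (hC x y).trans (mul_le_mul_of_nonneg_right ?_ (hn y))
    exact mul_le_mul (le_max_left _ _) (hk x) (hpoly x) (by linarith)
  obtain ⟨z0, hz0⟩ : ∃ z0, w z0 ≠ 0 := by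
    by_contra h
    push Not at h
    exact hw0 (funext h)
  have hz0' : 0 < w z0 := lt_of_le_of_ne (hn z0) (Ne.symm hz0)
  have hP (z : Rd d × Rd d) : 0 < phaseWeight z ^ k := pow_pos (phaseWeight_pos z) k
  -- E is the constant of the lower bound and D * w 0 that of the upper bound; M dominates both of
  -- them and the moderateness constant D.
  set E := D * phaseWeight z0 ^ k / w z0 with hE
  set M := max (max D E) (D * w 0) with hM
  have hDM : D ≤ M := (le_max_left _ _).trans (le_max_left _ _)
  refine ⟨M, k, hw.2.aestronglyMeasurable, hn, by linarith, fun x y => ?_, fun z => ?_,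
    fun z => ?_⟩
  · refine (h1 x y).trans ?_
    have := hn y
    have := hP x
    gcongr
  · have h2 : w z0 ≤ D * (phaseWeight z0 ^ k * phaseWeight z ^ k) * w z := by
      have := h1 (z0 - z) z
      rw [sub_add_cancel] at this
      refine this.trans ?_
      have h3 : phaseWeight (z0 - z) ^ k ≤ phaseWeight z0 ^ k * phaseWeight z ^ k := by
        rw [← mul_pow]
        refine pow_le_pow_left₀ (phaseWeight_pos _).le ?_ k
        have := phaseWeight_le_sub_mul (z0 - z) (-z)
        have e : phaseWeight (-z) = phaseWeight z := by simp [phaseWeight]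
        rw [e, sub_neg_eq_add, sub_add_cancel] at this
        exact this
      have := hn z
      gcongr
    have h4 : 1 ≤ E * phaseWeight z ^ k * w z := by
      rw [hE, div_mul_eq_mul_div, div_mul_eq_mul_div, le_div_iff₀ hz0', one_mul]
      linarith
    refine h4.trans ?_
    have := hn z
    have := hP z
    have : E ≤ M := (le_max_right _ _).trans (le_max_left _ _)
    gcongr
  · have h5 := h1 z 0
    rw [add_zero] at h5
    have h6 : D * w 0 ≤ M := le_max_right _ _
    have := hP z
    nlinarith

end Weights

/-! ### Estimates for weighted short-time Fourier transforms -/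

section Estimates

variable {d : ℕ} {N : (Rd d × Rd d → ℝ≥0∞) → ℝ≥0∞} {w : Rd d × Rd d → ℝ} {C : ℝ} {k : ℕ}

/-- The extended norm of a tempered distribution determined by `N`, the weight and the window. -/
def stftNorm (N : (Rd d × Rd d → ℝ≥0∞) → ℝ≥0∞) (w : Rd d × Rd d → ℝ) (g : 𝓢(Rd d, ℂ))
    (f : 𝓢'(Rd d, ℂ)) : ℝ≥0∞ :=
  N fun z => ‖stft g f z * (w z : ℂ)‖ₑ

lemma AdmissibleNorm.mono (hN : AdmissibleNorm N) {F G : Rd d × Rd d → ℝ≥0∞}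
    (h : ∀ z, F z ≤ G z) : N F ≤ N G :=
  hN.mono_ae (Eventually.of_forall h)

lemma IsControlledWeight.enorm_eq (hw : IsControlledWeight w C k) (z : Rd d × Rd d) :
    ‖(w z : ℂ)‖ₑ = ENNReal.ofReal (w z) := by
  rw [← ofReal_norm, Complex.norm_real, Real.norm_of_nonneg (hw.nonneg z)]

lemma IsControlledWeight.aestronglyMeasurable_mul (hw : IsControlledWeight w C k)
    {F : Rd d × Rd d → ℂ} (hF : Continuous F) :
    AEStronglyMeasurable (fun z => F z * (w z : ℂ)) volume :=
  hF.aestronglyMeasurable.mul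
    (Complex.continuous_ofReal.comp_aestronglyMeasurable hw.aestronglyMeasurable)

lemma IsControlledWeight.aemeasurable_stft (hw : IsControlledWeight w C k) (g : 𝓢(Rd d, ℂ))
    (f : 𝓢'(Rd d, ℂ)) : AEMeasurable fun z => ‖stft g f z * (w z : ℂ)‖ₑ :=
  (hw.aestronglyMeasurable_mul (continuous_stft g f)).enorm

/-- A rapidly decreasing function, multiplied by the weight, is dominated by `phaseDecay`. -/
lemma IsControlledWeight.enorm_mul_le (hw : IsControlledWeight w C k)
    {H : Rd d × Rd d → ℂ} {D : ℝ}
    (h : ∀ z, phaseWeight z ^ (d + 1 + k) * ‖H z‖ ≤ D) (z : Rd d × Rd d) :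
    ‖H z * (w z : ℂ)‖ₑ ≤ ENNReal.ofReal (C * D) * phaseDecay z := by
  have hp := phaseWeight_pos z
  rw [← ofReal_norm, phaseDecay, norm_mul, Complex.norm_real,
    Real.norm_of_nonneg (hw.nonneg z)]
  have hD : 0 ≤ D := le_trans (by positivity) (h z)
  rw [← ENNReal.ofReal_mul (mul_nonneg hw.const_pos.le hD)]
  refine ENNReal.ofReal_le_ofReal ?_
  rw [← div_eq_mul_inv, le_div_iff₀ (by positivity)]
  calc ‖H z‖ * w z * phaseWeight z ^ (d + 1)
      ≤ ‖H z‖ * (C * phaseWeight z ^ k) * phaseWeight z ^ (d + 1) := by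
        gcongr
        exact hw.le z
    _ = C * (phaseWeight z ^ (d + 1 + k) * ‖H z‖) := by ring
    _ ≤ C * D := mul_le_mul_of_nonneg_left (h z) hw.const_pos.le

/-- Rapidly decreasing functions pair with the elements of the space. -/
lemma AdmissibleNorm.lintegral_mul_stft_le (hN : AdmissibleNorm N)
    (hw : IsControlledWeight w C k) (g : 𝓢(Rd d, ℂ)) :
    ∃ A : ℝ, 0 ≤ A ∧ ∀ (f : 𝓢'(Rd d, ℂ)) (H : Rd d × Rd d → ℂ) (D : ℝ),
      (∀ z, phaseWeight z ^ (d + 1 + k) * ‖H z‖ ≤ D) →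
      ∫⁻ z, ‖H z * stft g f z‖ₑ ≤ ENNReal.ofReal (A * D) * stftNorm N w g f := by
  obtain ⟨B, hB, h⟩ := hN.lintegral_le
  refine ⟨B.toReal * C, mul_nonneg ENNReal.toReal_nonneg hw.const_pos.le, fun f H D hH => ?_⟩
  have hD : 0 ≤ D := le_trans (by have := phaseWeight_pos (0 : Rd d × Rd d); positivity) (hH 0)
  have hCD : 0 ≤ C * D := mul_nonneg hw.const_pos.le hD
  calc ∫⁻ z, ‖H z * stft g f z‖ₑ
      ≤ ∫⁻ z, ENNReal.ofReal (C * D) * (phaseDecay z * ‖stft g f z * (w z : ℂ)‖ₑ) := by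
        refine lintegral_mono fun z => ?_
        have hp := phaseWeight_pos z
        rw [enorm_mul, enorm_mul, mul_left_comm (phaseDecay z), mul_left_comm, mul_comm]
        gcongr
        rw [hw.enorm_eq, phaseDecay, ← ENNReal.ofReal_mul (by positivity),
          ← ENNReal.ofReal_mul hCD, ← ofReal_norm]
        refine ENNReal.ofReal_le_ofReal ?_
        have h1 : ‖H z‖ ≤ D * (phaseWeight z ^ (d + 1 + k))⁻¹ := by
          rw [← div_eq_mul_inv, le_div_iff₀ (by positivity), mul_comm]
          exact hH z
        -- The lower bound on the weight exchanges k of the d + 1 + k powers of decay for the factor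
        -- w, leaving the d + 1 powers of `phaseDecay`.
        have h2 := hw.one_le z
        refine h1.trans ?_
        calc D * (phaseWeight z ^ (d + 1 + k))⁻¹
            ≤ D * (phaseWeight z ^ (d + 1 + k))⁻¹ * (C * phaseWeight z ^ k * w z) :=
              le_mul_of_one_le_right (by positivity) h2
          _ = _ := by
              rw [pow_add _ (d + 1) k]
              field_simp
    _ ≤ ENNReal.ofReal (C * D) * (B * stftNorm N w g f) := by
        rw [lintegral_const_mul' _ _ ENNReal.ofReal_ne_top]
        gcongr
        exact h _ (hw.aemeasurable_stft g f)
    _ = _ := by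
        rw [mul_assoc B.toReal, ENNReal.ofReal_mul ENNReal.toReal_nonneg, ENNReal.ofReal_toReal hB,
          ← mul_assoc, mul_comm (ENNReal.ofReal (C * D))]

lemma AdmissibleNorm.integrable_mul_stft (hN : AdmissibleNorm N)
    (hw : IsControlledWeight w C k) {g : 𝓢(Rd d, ℂ)} {f : 𝓢'(Rd d, ℂ)}
    (hf : stftNorm N w g f < ∞) {H : Rd d × Rd d → ℂ} (hm : AEStronglyMeasurable H volume) {D : ℝ}
    (hH : ∀ z, phaseWeight z ^ (d + 1 + k) * ‖H z‖ ≤ D) :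
    Integrable (fun z => H z * stft g f z) volume := by
  obtain ⟨A, -, h⟩ := hN.lintegral_mul_stft_le hw g
  exact ⟨hm.mul (continuous_stft g f).aestronglyMeasurable,
    (h f H D hH).trans_lt (ENNReal.mul_lt_top ENNReal.ofReal_lt_top hf)⟩

lemma norm_le_toReal_of_enorm_le {E : Type*} [SeminormedAddCommGroup E] {x : E} {a : ℝ}
    (ha : 0 ≤ a) {b : ℝ≥0∞} (hb : b < ∞) (h : ‖x‖ₑ ≤ ENNReal.ofReal a * b) :
    ‖x‖ ≤ a * b.toReal := by
  rw [← toReal_enorm]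
  refine (ENNReal.toReal_mono (ENNReal.mul_lt_top ENNReal.ofReal_lt_top hb).ne h).trans_eq ?_
  rw [ENNReal.toReal_mul, ENNReal.toReal_ofReal ha]

lemma AdmissibleNorm.norm_integral_mul_stft_le (hN : AdmissibleNorm N)
    (hw : IsControlledWeight w C k) (g : 𝓢(Rd d, ℂ)) :
    ∃ A : ℝ, 0 ≤ A ∧ ∀ (f : 𝓢'(Rd d, ℂ)) (H : Rd d × Rd d → ℂ) (D : ℝ), stftNorm N w g f < ∞ →
      (∀ z, phaseWeight z ^ (d + 1 + k) * ‖H z‖ ≤ D) →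
      ‖∫ z, H z * stft g f z‖ ≤ A * D * (stftNorm N w g f).toReal := by
  obtain ⟨A, hA, h⟩ := hN.lintegral_mul_stft_le hw g
  refine ⟨A, hA, fun f H D hf hH => ?_⟩
  have hD : 0 ≤ D := le_trans (by have := phaseWeight_pos (0 : Rd d × Rd d); positivity) (hH 0)
  exact norm_le_toReal_of_enorm_le (by positivity) hf
    ((enorm_integral_le_lintegral_enorm _).trans (h f H D hH))

/-- The space embeds continuously into the tempered distributions. -/
lemma AdmissibleNorm.norm_apply_le (hN : AdmissibleNorm N) (hw : IsControlledWeight w C k)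
    {g : 𝓢(Rd d, ℂ)} (hg : g ≠ 0) : ∃ q : Seminorm ℂ 𝓢(Rd d, ℂ), Continuous q ∧
      ∃ A : ℝ, 0 ≤ A ∧ ∀ f : 𝓢'(Rd d, ℂ), stftNorm N w g f < ∞ → ∀ φ,
        ‖f φ‖ ≤ A * q φ * (stftNorm N w g f).toReal := by
  obtain ⟨A, hA, h⟩ := hN.norm_integral_mul_stft_le hw g
  obtain ⟨q, hq, hqb⟩ := pairingDecay_phaseWeight_pow (d + 1 + k) g
  have hM := moyalConst_pos hg
  refine ⟨q, hq, A / moyalConst g, by positivity, fun f hf φ => ?_⟩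
  -- By the reproducing formula the integral bounded here is `moyalConst g` times f φ, and the decay
  -- constant of the pairing is a continuous seminorm of φ.
  have h1 := h f (shiftPairing g φ) (q φ) hf (hqb φ)
  rw [integral_shiftPairing_mul_stft, norm_mul, Complex.norm_real,
    Real.norm_of_nonneg hM.le] at h1
  rw [div_mul_eq_mul_div, div_mul_eq_mul_div, le_div_iff₀ hM, mul_comm]
  exact h1

lemma stft_sub (g : 𝓢(Rd d, ℂ)) (f f' : 𝓢'(Rd d, ℂ)) (z : Rd d × Rd d) :
    stft g (f - f') z = stft g f z - stft g f' z := rfl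

/-- The transform of a shifted window is a column of the reproducing kernel, which decays rapidly
away from y. These elements will span the ranges of the finite rank operators. -/
lemma AdmissibleNorm.stftNorm_shiftDistribution_lt_top (hN : AdmissibleNorm N)
    (hw : IsControlledWeight w C k) (g : 𝓢(Rd d, ℂ)) (y : Rd d × Rd d) :
    stftNorm N w g (shiftDistribution g y) < ∞ := by
  obtain ⟨B, hB, h⟩ := exists_phaseWeight_pow_mul_stftKernel_le g (d + 1 + k)
  have h1 (z : Rd d × Rd d) : phaseWeight z ^ (d + 1 + k) * ‖stft g (shiftDistribution g y) z‖ ≤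
      phaseWeight y ^ (d + 1 + k) * B := by
    rw [stft_shiftDistribution]
    have hp := phaseWeight_pos z
    have hpy := phaseWeight_pos y
    calc _ ≤ (phaseWeight (z - y) * phaseWeight y) ^ (d + 1 + k) * ‖stftKernel g z y‖ := by
          gcongr
          exact phaseWeight_le_sub_mul z y
      _ = phaseWeight y ^ (d + 1 + k) * (phaseWeight (z - y) ^ (d + 1 + k) *
          ‖stftKernel g z y‖) := by ring
      _ ≤ _ := by gcongr; exact h z y
  refine (hN.mono fun z => hw.enorm_mul_le h1 z).trans_lt ?_
  rw [hN.const_mul ENNReal.ofReal_ne_top]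
  exact ENNReal.mul_lt_top ENNReal.ofReal_lt_top hN.decay_lt_top

lemma measurable_conv {κ F : Rd d × Rd d → ℝ≥0∞} (hκ : Measurable κ) (hF : AEMeasurable F) :
    Measurable fun z => ∫⁻ z', κ (z - z') * F z' := by
  have e (z : Rd d × Rd d) : ∫⁻ z', κ (z - z') * F z' = ∫⁻ z', κ (z - z') * hF.mk F z' := by
    refine lintegral_congr_ae ?_
    filter_upwards [hF.ae_eq_mk] with z' hz'
    rw [hz']
  simp only [e]
  exact Measurable.lintegral_prod_right' (f := fun a : (Rd d × Rd d) × (Rd d × Rd d) =>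
    κ (a.1 - a.2) * hF.mk F a.2)
    ((hκ.comp (measurable_fst.sub measurable_snd)).mul (hF.measurable_mk.comp measurable_snd))

/-- The weighted kernel is dominated by a convolution kernel, even after multiplication with
`‖z - z'‖`. -/
lemma IsControlledWeight.exists_kernel_le (hw : IsControlledWeight w C k) (g : 𝓢(Rd d, ℂ)) :
    ∃ B : ℝ, 0 ≤ B ∧ ∀ z z' : Rd d × Rd d,
      ‖z - z'‖ * ‖stftKernel g z z'‖ * w z ≤ B * (phaseWeight (z - z') ^ (d + 1))⁻¹ * w z' := by
  -- The exponent pays for integrability (d + 1), for moving the weight from z to z' (k), and for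
  -- the factor ‖z - z'‖ (1).
  obtain ⟨B, hB, h⟩ := exists_phaseWeight_pow_mul_stftKernel_le g (d + 1 + k + 1)
  have hC := hw.const_pos
  refine ⟨B * C, by positivity, fun z z' => ?_⟩
  have hp := phaseWeight_pos (z - z')
  have hz := hw.nonneg z
  have hz' := hw.nonneg z'
  have h1 : w z ≤ C * phaseWeight (z - z') ^ k * w z' := by
    simpa using hw.moderate (z - z') z'
  calc ‖z - z'‖ * ‖stftKernel g z z'‖ * w z
      ≤ phaseWeight (z - z') * ‖stftKernel g z z'‖ * (C * phaseWeight (z - z') ^ k * w z') := by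
        gcongr
        exact norm_le_phaseWeight _
    _ = (phaseWeight (z - z') ^ (d + 1 + k + 1) * ‖stftKernel g z z'‖) * C *
          (phaseWeight (z - z') ^ (d + 1))⁻¹ * w z' := by
        rw [show d + 1 + k + 1 = (d + 1) + (k + 1) by ring, pow_add _ (d + 1)]
        field_simp
        ring
    _ ≤ _ := by
        gcongr
        exact h z z'

end Estimates

/-! ### Abstract spaces defined by the short-time Fourier transform -/

section Space

variable {d : ℕ} {N : (Rd d × Rd d → ℝ≥0∞) → ℝ≥0∞} {w : Rd d × Rd d → ℝ} {C : ℝ} {k : ℕ}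
  {g : 𝓢(Rd d, ℂ)} {X : Type*} [SeminormedAddCommGroup X] [NormedSpace ℂ X]

/-- `X` is, through `J`, the space of tempered distributions with finite `stftNorm`. -/
structure IsStftSpace (N : (Rd d × Rd d → ℝ≥0∞) → ℝ≥0∞) (w : Rd d × Rd d → ℝ) (g : 𝓢(Rd d, ℂ))
    (J : X →ₗ[ℂ] 𝓢'(Rd d, ℂ)) : Prop where
  injective : Function.Injective J
  lt_top : ∀ x, stftNorm N w g (J x) < ∞
  norm_eq : ∀ x, ‖x‖ = (stftNorm N w g (J x)).toReal
  surj : ∀ f, stftNorm N w g f < ∞ → ∃ x, J x = f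

variable {J : X →ₗ[ℂ] 𝓢'(Rd d, ℂ)}

lemma IsStftSpace.stftNorm_eq (hJ : IsStftSpace N w g J) (x : X) :
    stftNorm N w g (J x) = ENNReal.ofReal ‖x‖ := by
  rw [hJ.norm_eq, ENNReal.ofReal_toReal (hJ.lt_top x).ne]

lemma IsStftSpace.t0Space (hJ : IsStftSpace N w g J) (hN : AdmissibleNorm N)
    (hw : IsControlledWeight w C k) (hg : g ≠ 0) : T0Space X := by
  refine ⟨fun x y hxy => ?_⟩
  obtain ⟨q, -, A, -, h⟩ := hN.norm_apply_le hw hg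
  have h0 : ‖x - y‖ = 0 := by
    rw [← dist_eq_norm]
    exact Metric.inseparable_iff.1 hxy
  refine sub_eq_zero.1 (hJ.injective ?_)
  rw [map_zero]
  refine ContinuousLinearMap.ext fun φ => ?_
  have h1 := h (J (x - y)) (hJ.lt_top _) φ
  rw [← hJ.norm_eq, h0, mul_zero] at h1
  exact norm_le_zero_iff.1 h1

/-- The pointwise limit is linear, and the common bound by one continuous seminorm passes to the
limit and makes it continuous. -/
lemma exists_distribution_of_cauchySeq {f : ℕ → 𝓢'(Rd d, ℂ)} {q : Seminorm ℂ 𝓢(Rd d, ℂ)}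
    (hq : Continuous q) (hf : ∀ φ, CauchySeq fun n => f n φ) {M : ℝ}
    (hM : ∀ n φ, ‖f n φ‖ ≤ M * q φ) :
    ∃ F : 𝓢'(Rd d, ℂ), ∀ φ, Tendsto (fun n => f n φ) atTop (𝓝 (F φ)) := by
  choose F hF using fun φ => cauchySeq_tendsto_of_complete (hf φ)
  have hb (φ : 𝓢(Rd d, ℂ)) : ‖F φ‖ ≤ M * q φ :=
    le_of_tendsto (hF φ).norm (Eventually.of_forall fun n => hM n φ)
  let L : 𝓢(Rd d, ℂ) →ₗ[ℂ] ℂ :=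
    { toFun := F
      map_add' := fun φ ψ => by
        refine tendsto_nhds_unique (hF (φ + ψ)) ?_
        simp only [map_add]
        exact (hF φ).add (hF ψ)
      map_smul' := fun c φ => by
        refine tendsto_nhds_unique (hF (c • φ)) ?_
        simp only [map_smul]
        exact (hF φ).const_smul c }
  have hL : Continuous L := by
    refine continuous_of_continuousAt_zero L ?_
    have h1 : Tendsto (fun φ => M * q φ) (𝓝 0) (𝓝 0) := by
      have := (hq.const_mul M).tendsto 0
      simpa using this
    change Tendsto L (𝓝 0) (𝓝 (L 0))
    rw [map_zero]
    exact squeeze_zero_norm hb h1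
  exact ⟨ContinuousLinearMap.toPointwiseConvergenceCLM _ _ _ _ ⟨L, hL⟩, hF⟩

/-- A Cauchy sequence converges weakly to some distribution because the embedding is continuous. The
transforms then converge pointwise, and Fatou turns the Cauchy condition into norm convergence. -/
lemma IsStftSpace.completeSpace (hJ : IsStftSpace N w g J) (hN : AdmissibleNorm N)
    (hw : IsControlledWeight w C k) (hg : g ≠ 0) : CompleteSpace X := by
  obtain ⟨q, hq, A, hA, h⟩ := hN.norm_apply_le hw hg
  refine Metric.complete_of_cauchySeq_tendsto fun u hu => ?_
  have h1 (x : X) (φ : 𝓢(Rd d, ℂ)) : ‖J x φ‖ ≤ A * q φ * ‖x‖ := by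
    rw [hJ.norm_eq]
    exact h _ (hJ.lt_top x) φ
  have h2 (φ : 𝓢(Rd d, ℂ)) : CauchySeq fun n => J (u n) φ := by
    rw [Metric.cauchySeq_iff']
    intro ε hε
    have hpos : 0 < A * q φ + 1 := by have := apply_nonneg q φ; positivity
    obtain ⟨n₀, hn₀⟩ := Metric.cauchySeq_iff'.1 hu (ε / (A * q φ + 1)) (by positivity)
    refine ⟨n₀, fun n hn => ?_⟩
    have h3 := hn₀ n hn
    rw [dist_eq_norm, lt_div_iff₀ hpos] at h3
    have h4 := h1 (u n - u n₀) φ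
    rw [map_sub] at h4
    rw [dist_eq_norm]
    refine lt_of_le_of_lt h4 ?_
    nlinarith [norm_nonneg (u n - u n₀)]
  obtain ⟨M, hM⟩ := hu.norm_bddAbove
  have hM' (n : ℕ) : ‖u n‖ ≤ M := hM ⟨n, rfl⟩
  obtain ⟨F, hF⟩ := exists_distribution_of_cauchySeq (f := fun n => J (u n)) (M := A * M) hq h2
    fun n φ => (h1 (u n) φ).trans (by
      have := apply_nonneg q φ
      have := mul_le_mul_of_nonneg_left (hM' n) (mul_nonneg hA this)
      linarith)
  have hFz (m : ℕ) : stftNorm N w g (F - J (u m)) ≤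
      liminf (fun n => ENNReal.ofReal ‖u n - u m‖) atTop := by
    have e (z : Rd d × Rd d) : ‖stft g (F - J (u m)) z * (w z : ℂ)‖ₑ =
        liminf (fun n => ‖stft g (J (u n - u m)) z * (w z : ℂ)‖ₑ) atTop := by
      refine (Tendsto.liminf_eq ?_).symm
      refine Tendsto.enorm (Tendsto.mul_const _ ?_)
      simp only [map_sub, stft_sub]
      exact (hF _).sub_const _
    unfold stftNorm
    simp only [e]
    refine (hN.liminf_le fun n => hw.aemeasurable_stft g _).trans_eq ?_
    congr 1
    funext n
    exact hJ.stftNorm_eq _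
  have key (ε : ℝ) (hε : 0 < ε) : ∃ n₀, ∀ m ≥ n₀,
      stftNorm N w g (F - J (u m)) ≤ ENNReal.ofReal ε := by
    obtain ⟨n₀, hn₀⟩ := Metric.cauchySeq_iff.1 hu ε hε
    refine ⟨n₀, fun m hm => (hFz m).trans ?_⟩
    refine liminf_le_of_frequently_le' (Eventually.frequently ?_)
    filter_upwards [eventually_ge_atTop n₀] with n hn
    refine ENNReal.ofReal_le_ofReal ?_
    rw [← dist_eq_norm]
    exact (hn₀ n hn m hm).le
  -- Any finite bound would do: one difference F - J (u n₁) of finite norm shows that F itself comes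
  -- from X.
  obtain ⟨n₁, hn₁⟩ := key 1 one_pos
  obtain ⟨y, hy⟩ := hJ.surj _ ((hn₁ n₁ le_rfl).trans_lt ENNReal.ofReal_lt_top)
  have hx : J (y + u n₁) = F := by rw [map_add, hy, sub_add_cancel]
  refine ⟨y + u n₁, Metric.tendsto_atTop.2 fun ε hε => ?_⟩
  obtain ⟨n₀, hn₀⟩ := key (ε / 2) (by positivity)
  refine ⟨n₀, fun m hm => ?_⟩
  have h5 := hn₀ m hm
  rw [← hx, ← map_sub, hJ.stftNorm_eq, ENNReal.ofReal_le_ofReal_iff (by positivity)] at h5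
  rw [dist_comm, dist_eq_norm]
  linarith

end Space

/-! ### The metric approximation property -/

/-- Contractions are equicontinuous, so pointwise convergence at the centres of a finite ε/3-cover
of K gives uniform convergence on K. -/
lemma metricApproximationProperty_of_tendsto {X : Type*} [SeminormedAddCommGroup X]
    [NormedSpace ℂ X] (S : ℕ → X →L[ℂ] X)
    (hfin : ∀ n, FiniteDimensional ℂ (LinearMap.range (S n : X →ₗ[ℂ] X)))
    (hnorm : ∀ n, ‖S n‖ ≤ 1) (hlim : ∀ x, Tendsto (fun n => S n x) atTop (𝓝 x)) :
    MetricApproximationProperty X := by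
  intro K hK ε hε
  obtain ⟨t, -, ht, hcov⟩ := hK.finite_cover_balls (show 0 < ε / 3 by positivity)
  have h1 : ∀ᶠ n in atTop, ∀ x ∈ t, dist (S n x) x < ε / 3 :=
    (eventually_all_finite ht).2 fun x _ => Metric.tendsto_nhds.1 (hlim x) _ (by positivity)
  obtain ⟨n, hn⟩ := h1.exists
  refine ⟨S n, hfin n, hnorm n, fun y hy => ?_⟩
  obtain ⟨x, hx, hyx⟩ := Set.mem_iUnion₂.1 (hcov hy)
  have h2 := hn x hx
  rw [Metric.mem_ball] at hyx
  have h3 : dist (S n x) (S n y) ≤ dist x y := by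
    rw [dist_eq_norm, ← map_sub, dist_eq_norm]
    exact (ContinuousLinearMap.le_of_opNorm_le _ (hnorm n) _).trans_eq (one_mul _)
  rw [← dist_eq_norm, dist_comm]
  have h4 := dist_triangle4 (S n y) (S n x) x y
  rw [dist_comm (S n y) (S n x), dist_comm x y] at h4
  rw [dist_comm x y] at h3
  linarith

lemma finiteDimensional_range_sum_smulRight {X ι : Type*} [SeminormedAddCommGroup X]
    [NormedSpace ℂ X] (s : Finset ι) (l : ι → X →L[ℂ] ℂ) (e : ι → X) :
    FiniteDimensional ℂ (LinearMap.range
      ((∑ i ∈ s, (l i).smulRight (e i) : X →L[ℂ] X) : X →ₗ[ℂ] X)) := by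
  have hfd : FiniteDimensional ℂ (Submodule.span ℂ (e '' s)) :=
    FiniteDimensional.span_of_finite ℂ (s.finite_toSet.image e)
  refine Submodule.finiteDimensional_of_le (S₂ := Submodule.span ℂ (e '' s)) ?_
  rintro - ⟨x, rfl⟩
  change (∑ i ∈ s, (l i).smulRight (e i) : X →L[ℂ] X) x ∈ _
  rw [_root_.sum_apply]
  exact Submodule.sum_mem _ fun i hi => Submodule.smul_mem _ _
    (Submodule.subset_span ⟨i, hi, rfl⟩)

section Approximation

variable {d : ℕ} {N : (Rd d × Rd d → ℝ≥0∞) → ℝ≥0∞} {w : Rd d × Rd d → ℝ} {C : ℝ} {k : ℕ}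
  {g : 𝓢(Rd d, ℂ)} {X : Type*} [SeminormedAddCommGroup X] [NormedSpace ℂ X]
  {J : X →ₗ[ℂ] 𝓢'(Rd d, ℂ)}

/-- A slowly varying cutoff function on phase space. -/
def cutoff (δ : ℝ) (z : Rd d × Rd d) : ℝ := max 0 (1 - δ * ‖z‖)

lemma cutoff_nonneg (δ : ℝ) (z : Rd d × Rd d) : 0 ≤ cutoff δ z := le_max_left _ _

lemma cutoff_le_one {δ : ℝ} (hδ : 0 ≤ δ) (z : Rd d × Rd d) : cutoff δ z ≤ 1 :=
  max_le zero_le_one (by have := norm_nonneg z; nlinarith)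

lemma cutoff_eq_zero {δ : ℝ} (hδ : 0 < δ) {z : Rd d × Rd d} (hz : 1 / δ < ‖z‖) :
    cutoff δ z = 0 := by
  refine max_eq_left ?_
  rw [div_lt_iff₀ hδ] at hz
  linarith

lemma continuous_cutoff (δ : ℝ) : Continuous (cutoff (d := d) δ) := by
  unfold cutoff; fun_prop

lemma abs_cutoff_sub_le {δ : ℝ} (hδ : 0 ≤ δ) (z z' : Rd d × Rd d) :
    |cutoff δ z' - cutoff δ z| ≤ δ * ‖z - z'‖ := by
  unfold cutoff
  refine (abs_max_sub_max_le_max _ _ _ _).trans ?_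
  rw [sub_self, abs_zero, max_eq_right (abs_nonneg _)]
  have e : 1 - δ * ‖z'‖ - (1 - δ * ‖z‖) = δ * (‖z‖ - ‖z'‖) := by ring
  rw [e, abs_mul, abs_of_nonneg hδ]
  exact mul_le_mul_of_nonneg_left (abs_norm_sub_norm_le z z') hδ

lemma phaseWeight_pow_le_of_norm_le {R : ℝ} {z : Rd d × Rd d} (hz : ‖z‖ ≤ R) (n : ℕ) :
    phaseWeight z ^ n ≤ ((1 + R) * (1 + R)) ^ n := by
  refine pow_le_pow_left₀ (phaseWeight_pos z).le ((phaseWeight_le_norm z).trans ?_) n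
  have : 0 ≤ R := (norm_nonneg z).trans hz
  gcongr

/-- For large z one spare power of decay makes both kernel values small; for the remaining z the
kernel is uniformly continuous on a compact set. -/
lemma exists_stftKernel_uniform (g : 𝓢(Rd d, ℂ)) (R : ℝ) (m : ℕ) {ε : ℝ} (hε : 0 < ε) :
    ∃ η : ℝ, 0 < η ∧ ∀ y y' : Rd d × Rd d, ‖y‖ ≤ R → ‖y'‖ ≤ R → dist y y' < η →
      ∀ z, phaseWeight z ^ m * ‖stftKernel g z y - stftKernel g z y'‖ ≤ ε := by
  obtain ⟨B, hB, h⟩ := exists_phaseWeight_pow_mul_stftKernel_le g (m + 1)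
  set D := ((1 + R) * (1 + R)) ^ (m + 1) with hD
  have hfar (z y : Rd d × Rd d) (hy : ‖y‖ ≤ R) :
      phaseWeight z ^ m * ‖stftKernel g z y‖ * phaseWeight z ≤ D * B := by
    have hp := phaseWeight_pos z
    have hpy := phaseWeight_pos y
    calc _ = phaseWeight z ^ (m + 1) * ‖stftKernel g z y‖ := by ring
      _ ≤ (phaseWeight (z - y) * phaseWeight y) ^ (m + 1) * ‖stftKernel g z y‖ := by
          gcongr
          exact phaseWeight_le_sub_mul z y
      _ = phaseWeight y ^ (m + 1) * (phaseWeight (z - y) ^ (m + 1) * ‖stftKernel g z y‖) := by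
          ring
      _ ≤ D * B := mul_le_mul (phaseWeight_pow_le_of_norm_le hy _) (h z y)
          (by have := phaseWeight_pos (z - y); positivity)
          (pow_nonneg (mul_self_nonneg _) _)
  -- Beyond this radius each of the two kernel terms is less than ε/2, by `hfar`.
  set R' := 2 * (D * B) / ε with hR'
  have hc : Continuous fun a : (Rd d × Rd d) × (Rd d × Rd d) =>
      ((phaseWeight a.1 ^ m : ℝ) : ℂ) * stftKernel g a.1 a.2 := by
    have h1 := continuous_stftKernel g
    have h2 : Continuous (phaseWeight (d := d)) := by unfold phaseWeight; fun_prop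
    exact (Complex.continuous_ofReal.comp ((h2.comp continuous_fst).pow m)).mul h1
  have hK : IsCompact (Metric.closedBall (0 : Rd d × Rd d) R' ×ˢ
      Metric.closedBall (0 : Rd d × Rd d) R) :=
    (isCompact_closedBall _ _).prod (isCompact_closedBall _ _)
  have hu := hK.uniformContinuousOn_of_continuous hc.continuousOn
  obtain ⟨η, hη, hη'⟩ := Metric.uniformContinuousOn_iff.1 hu ε hε
  refine ⟨η, hη, fun y y' hy hy' hyy z => ?_⟩
  have hp := phaseWeight_pos z
  rcases le_or_gt ‖z‖ R' with hz | hz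
  · have := hη' (z, y) (by simp [hz, hy]) (z, y') (by simp [hz, hy'])
      (by rw [Prod.dist_eq, dist_self]; simpa [hη] using hyy)
    rw [dist_eq_norm, ← mul_sub, norm_mul, Complex.norm_real, Real.norm_of_nonneg (by positivity)]
      at this
    exact this.le
  · have h1 := hfar z y hy
    have h2 := hfar z y' hy'
    have h3 := norm_le_phaseWeight z
    have h4 : 2 * (D * B) < ε * phaseWeight z := by
      rw [hR', div_lt_iff₀ hε] at hz
      nlinarith
    have h5 := norm_sub_le (stftKernel g z y) (stftKernel g z y')
    refine le_of_mul_le_mul_right (le_trans ?_ h4.le) hp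
    calc _ ≤ phaseWeight z ^ m * (‖stftKernel g z y‖ + ‖stftKernel g z y'‖) * phaseWeight z := by
          gcongr
      _ = phaseWeight z ^ m * ‖stftKernel g z y‖ * phaseWeight z +
          phaseWeight z ^ m * ‖stftKernel g z y'‖ * phaseWeight z := by ring
      _ ≤ _ := by linarith

lemma exists_simpleFunc_stftKernel_le (g : 𝓢(Rd d, ℂ)) (R : ℝ) (m : ℕ) {ε : ℝ} (hε : 0 < ε) :
    ∃ ζ : SimpleFunc (Rd d × Rd d) (Rd d × Rd d), ∀ y, ‖y‖ ≤ R → ∀ z,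
      phaseWeight z ^ m * ‖stftKernel g z (ζ y) - stftKernel g z y‖ ≤ ε := by
  -- The radius R + 1 leaves room for sample points outside the ball of radius R; they stay within
  -- distance 1 of y because r ≤ 1.
  obtain ⟨η, hη, h⟩ := exists_stftKernel_uniform g (R + 1) m hε
  let e := TopologicalSpace.denseSeq (Rd d × Rd d)
  set r := min η 1 with hr
  have hr0 : 0 < r := lt_min hη one_pos
  have hcov : Metric.closedBall (0 : Rd d × Rd d) R ⊆ ⋃ i, Metric.ball (e i) r := fun y _ => by
    obtain ⟨i, hi⟩ := (TopologicalSpace.denseRange_denseSeq (Rd d × Rd d)).exists_dist_lt y hr0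
    exact Set.mem_iUnion.2 ⟨i, hi⟩
  obtain ⟨t, ht⟩ := (isCompact_closedBall (0 : Rd d × Rd d) R).elim_finite_subcover
    (fun i => Metric.ball (e i) r) (fun _ => Metric.isOpen_ball) hcov
  -- The map sends y to the nearest of the first points of a dense sequence, up to the largest index
  -- in the finite subcover.
  refine ⟨SimpleFunc.nearestPt e (t.sup id), fun y hy z => ?_⟩
  obtain ⟨i, hi, hyi⟩ := Set.mem_iUnion₂.1 (ht (show y ∈ Metric.closedBall 0 R by simpa using hy))
  have h1 := SimpleFunc.edist_nearestPt_le e y (Finset.le_sup (f := id) hi)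
  rw [edist_dist, edist_dist, ENNReal.ofReal_le_ofReal_iff dist_nonneg] at h1
  have h2 : dist (SimpleFunc.nearestPt e (t.sup id) y) y < r := by
    refine h1.trans_lt ?_
    rw [dist_comm]
    exact hyi
  refine h _ y ?_ (by linarith) (h2.trans_le (min_le_left _ _)) z
  have h3 := h2.trans_le (min_le_right _ _)
  rw [dist_eq_norm] at h3
  have h4 := norm_add_le (SimpleFunc.nearestPt e (t.sup id) y - y) y
  rw [sub_add_cancel] at h4
  linarith

lemma stft_map_sum (J : X →ₗ[ℂ] 𝓢'(Rd d, ℂ)) {ι : Type*} (s : Finset ι) (c : ι → ℂ) (e : ι → X)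
    (z : Rd d × Rd d) :
    stft g (J (∑ i ∈ s, c i • e i)) z = ∑ i ∈ s, c i * stft g (J (e i)) z := by
  let L : 𝓢'(Rd d, ℂ) →ₗ[ℂ] ℂ :=
    { toFun := fun f => stft g f z
      map_add' := fun _ _ => rfl
      map_smul' := fun _ _ => rfl }
  change L (J _) = _
  rw [map_sum, map_sum]
  refine Finset.sum_congr rfl fun i _ => ?_
  rw [map_smul, map_smul]
  rfl

lemma IsStftSpace.exists_clm_integral (hJ : IsStftSpace N w g J) (hN : AdmissibleNorm N)
    (hw : IsControlledWeight w C k) {H : Rd d × Rd d → ℂ} (hm : AEStronglyMeasurable H volume)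
    {D : ℝ} (hH : ∀ z, phaseWeight z ^ (d + 1 + k) * ‖H z‖ ≤ D) :
    ∃ l : X →L[ℂ] ℂ, ∀ x, l x = ∫ z, H z * stft g (J x) z := by
  obtain ⟨A, hA, h⟩ := hN.norm_integral_mul_stft_le hw g
  have hi (x : X) := hN.integrable_mul_stft hw (hJ.lt_top x) hm hH
  refine ⟨LinearMap.mkContinuous
    { toFun := fun x : X => ∫ z, H z * stft g (J x) z
      map_add' := fun x y => by
        rw [← integral_add (hi x) (hi y)]
        refine integral_congr_ae (Eventually.of_forall fun z => ?_)
        have : stft g (J (x + y)) z = stft g (J x) z + stft g (J y) z := by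
          rw [map_add]; rfl
        simp only [this, mul_add]
      map_smul' := fun c x => by
        rw [RingHom.id_apply, smul_eq_mul, ← integral_const_mul]
        refine integral_congr_ae (Eventually.of_forall fun z => ?_)
        have : stft g (J (c • x)) z = c * stft g (J x) z := by
          rw [map_smul]; rfl
        simp only [this, mul_left_comm] }
    (A * D) fun x => ?_, fun x => rfl⟩
  rw [hJ.norm_eq]
  exact h (J x) H D (hJ.lt_top x) hH

lemma norm_cutoff_mul_le {δ : ℝ} (hδ : 0 < δ) {m : ℕ} {c : ℂ} {a : ℝ} (z : Rd d × Rd d)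
    (ha : 0 ≤ a) (hc : ‖z‖ ≤ 1 / δ → ‖c‖ ≤ a) :
    phaseWeight z ^ m * ‖(cutoff δ z : ℂ) * c‖ ≤ ((1 + 1 / δ) * (1 + 1 / δ)) ^ m * a := by
  rcases le_or_gt ‖z‖ (1 / δ) with hz | hz
  · rw [norm_mul, Complex.norm_real, Real.norm_of_nonneg (cutoff_nonneg δ z)]
    refine mul_le_mul (phaseWeight_pow_le_of_norm_le hz m) ?_
      (mul_nonneg (cutoff_nonneg δ z) (norm_nonneg _)) (by positivity)
    exact (mul_le_of_le_one_left (norm_nonneg _) (cutoff_le_one hδ.le z)).trans (hc hz)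
  · rw [cutoff_eq_zero hδ hz]
    simp only [Complex.ofReal_zero, zero_mul, norm_zero, mul_zero]
    positivity

/-- The kernel of the error made by discretising the reproducing kernel with a simple function. -/
def discretisationKernel (g : 𝓢(Rd d, ℂ)) (δ : ℝ) (ζ : SimpleFunc (Rd d × Rd d) (Rd d × Rd d))
    (z z' : Rd d × Rd d) : ℂ :=
  (cutoff δ z' : ℂ) * (stftKernel g z (ζ z') - stftKernel g z z')

/-- The kernel of the commutator of the cutoff with the reproducing kernel. -/
def commutatorKernel (g : 𝓢(Rd d, ℂ)) (δ : ℝ) (z z' : Rd d × Rd d) : ℂ :=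
  ((cutoff δ z' - cutoff δ z : ℝ) : ℂ) * stftKernel g z z'

lemma continuous_stftKernel_right (g : 𝓢(Rd d, ℂ)) (z : Rd d × Rd d) :
    Continuous (stftKernel g z) :=
  continuous_shiftPairing g (stftAtom g z.1 z.2)

lemma continuous_ofReal_cutoff (δ : ℝ) : Continuous fun z : Rd d × Rd d => (cutoff δ z : ℂ) :=
  Complex.continuous_ofReal.comp (continuous_cutoff δ)

lemma aestronglyMeasurable_discretisationKernel (g : 𝓢(Rd d, ℂ)) (δ : ℝ)
    (ζ : SimpleFunc (Rd d × Rd d) (Rd d × Rd d)) (z : Rd d × Rd d) :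
    AEStronglyMeasurable (discretisationKernel g δ ζ z) volume :=
  (continuous_ofReal_cutoff δ).aestronglyMeasurable.mul
    (((continuous_stftKernel_right g z).measurable.comp ζ.measurable).aestronglyMeasurable.sub
      (continuous_stftKernel_right g z).aestronglyMeasurable)

lemma integrable_stftKernel_mul (g : 𝓢(Rd d, ℂ)) (f : 𝓢'(Rd d, ℂ)) (z : Rd d × Rd d) :
    Integrable (fun z' => stftKernel g z z' * stft g f z') volume :=
  integrable_shiftPairing_mul_stft g _ _

lemma integrable_commutatorKernel_mul (g : 𝓢(Rd d, ℂ)) (f : 𝓢'(Rd d, ℂ)) {δ : ℝ} (hδ : 0 ≤ δ)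
    (z : Rd d × Rd d) : Integrable (fun z' => commutatorKernel g δ z z' * stft g f z') volume := by
  have := (integrable_stftKernel_mul g f z).bdd_mul (c := 1)
    (f := fun z' => ((cutoff δ z' - cutoff δ z : ℝ) : ℂ))
    (Complex.continuous_ofReal.comp
      ((continuous_cutoff δ).sub continuous_const)).aestronglyMeasurable
    (Eventually.of_forall fun z' => by
      rw [Complex.norm_real, Real.norm_eq_abs, abs_le]
      constructor <;> linarith [cutoff_nonneg δ z, cutoff_nonneg δ z', cutoff_le_one hδ z,
        cutoff_le_one hδ z'])
  simpa only [commutatorKernel, mul_assoc] using this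

/-- The part of the cutoff living on a fibre of a simple function. -/
def cutoffPiece (δ : ℝ) (ζ : SimpleFunc (Rd d × Rd d) (Rd d × Rd d)) (y : Rd d × Rd d) :
    Rd d × Rd d → ℂ :=
  (ζ ⁻¹' {y}).indicator fun z => (cutoff δ z : ℂ)

lemma aestronglyMeasurable_cutoffPiece (δ : ℝ) (ζ : SimpleFunc (Rd d × Rd d) (Rd d × Rd d))
    (y : Rd d × Rd d) : AEStronglyMeasurable (cutoffPiece δ ζ y) volume :=
  (continuous_ofReal_cutoff δ).aestronglyMeasurable.indicator (ζ.measurableSet_fiber y)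

lemma phaseWeight_pow_mul_cutoffPiece_le {δ : ℝ} (hδ : 0 < δ)
    (ζ : SimpleFunc (Rd d × Rd d) (Rd d × Rd d)) (m : ℕ) (y z : Rd d × Rd d) :
    phaseWeight z ^ m * ‖cutoffPiece δ ζ y z‖ ≤ ((1 + 1 / δ) * (1 + 1 / δ)) ^ m := by
  have h1 : ‖cutoffPiece δ ζ y z‖ ≤ ‖(cutoff δ z : ℂ) * 1‖ := by
    rw [mul_one]
    exact norm_indicator_le_norm_self _ _
  have h2 := norm_cutoff_mul_le (m := m) (c := 1) hδ z zero_le_one fun _ => by simp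
  exact (mul_le_mul_of_nonneg_left h1 (pow_nonneg (phaseWeight_pos z).le m)).trans
    (h2.trans_eq (mul_one _))

lemma sum_cutoffPiece_mul_stftKernel {f : 𝓢'(Rd d, ℂ)} {δ : ℝ}
    {ζ : SimpleFunc (Rd d × Rd d) (Rd d × Rd d)}
    (hi : ∀ y, Integrable (fun z => cutoffPiece δ ζ y z * stft g f z) volume) (z : Rd d × Rd d) :
    ∑ y ∈ ζ.range, (∫ z', cutoffPiece δ ζ y z' * stft g f z') * stftKernel g z y =
      ∫ z', (cutoff δ z' : ℂ) * stftKernel g z (ζ z') * stft g f z' := by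
  simp only [← integral_mul_const]
  rw [← integral_finsetSum _ fun y _ => (hi y).mul_const _]
  refine integral_congr_ae (Eventually.of_forall fun z' => ?_)
  beta_reduce
  rw [Finset.sum_eq_single (ζ z')]
  · have : cutoffPiece δ ζ (ζ z') z' = (cutoff δ z' : ℂ) := Set.indicator_of_mem (by simp) _
    rw [this]
    ring
  · intro y _ hy
    have : cutoffPiece δ ζ y z' = 0 := Set.indicator_of_notMem (by simpa using hy.symm) _
    rw [this, zero_mul, zero_mul]
  · exact fun hn => absurd (ζ.mem_range_self z') hn

/-- The kernel cutoff(z') K(z, ζ z') is split into the error from replacing ζ z' by z', the error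
from replacing cutoff(z') by cutoff(z), and cutoff(z) K(z, z'), which the reproducing formula
evaluates. -/
lemma integral_cutoff_mul_stftKernel {f : 𝓢'(Rd d, ℂ)} {δ : ℝ} (hδ : 0 ≤ δ)
    {ζ : SimpleFunc (Rd d × Rd d) (Rd d × Rd d)} {z : Rd d × Rd d}
    (hi : Integrable (fun z' => discretisationKernel g δ ζ z z' * stft g f z') volume) :
    ∫ z', (cutoff δ z' : ℂ) * stftKernel g z (ζ z') * stft g f z' =
      (∫ z', discretisationKernel g δ ζ z z' * stft g f z') +
        (∫ z', commutatorKernel g δ z z' * stft g f z') +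
        moyalConst g * (cutoff δ z * stft g f z) := by
  have h3 := (integrable_stftKernel_mul g f z).const_mul (cutoff δ z : ℂ)
  have h2 := integrable_commutatorKernel_mul g f hδ z
  have e : (moyalConst g : ℂ) * (cutoff δ z * stft g f z) =
      ∫ z', (cutoff δ z : ℂ) * (stftKernel g z z' * stft g f z') := by
    rw [integral_const_mul, integral_stftKernel_mul_stft, mul_left_comm]
  have h12 : Integrable (fun z' => discretisationKernel g δ ζ z z' * stft g f z' +
      commutatorKernel g δ z z' * stft g f z') volume := hi.add h2
  rw [e, ← integral_add hi h2, ← integral_add h12 h3]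
  refine integral_congr_ae (Eventually.of_forall fun z' => ?_)
  simp only [discretisationKernel, commutatorKernel]
  push_cast
  ring

lemma IsControlledWeight.enorm_integral_commutatorKernel_le (hw : IsControlledWeight w C k)
    {B : ℝ} (hB : 0 ≤ B) (hBb : ∀ z z' : Rd d × Rd d, ‖z - z'‖ * ‖stftKernel g z z'‖ * w z ≤
      B * (phaseWeight (z - z') ^ (d + 1))⁻¹ * w z') (f : 𝓢'(Rd d, ℂ)) {δ : ℝ} (hδ : 0 ≤ δ)
    (z : Rd d × Rd d) :
    ‖(∫ z', commutatorKernel g δ z z' * stft g f z') * (w z : ℂ)‖ₑ ≤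
      ENNReal.ofReal (δ * B) * ∫⁻ z', phaseDecay (z - z') * ‖stft g f z' * (w z' : ℂ)‖ₑ := by
  rw [← integral_mul_const, ← lintegral_const_mul' _ _ ENNReal.ofReal_ne_top]
  refine (enorm_integral_le_lintegral_enorm _).trans (lintegral_mono fun z' => ?_)
  rw [← ofReal_norm, ← ofReal_norm, phaseDecay, ← ENNReal.ofReal_mul (by
    have := phaseWeight_pos (z - z'); positivity), ← ENNReal.ofReal_mul (by positivity)]
  refine ENNReal.ofReal_le_ofReal ?_
  have hwz := hw.nonneg z
  simp only [commutatorKernel, norm_mul, Complex.norm_real, Real.norm_of_nonneg hwz,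
    Real.norm_of_nonneg (hw.nonneg z'), Real.norm_eq_abs]
  calc |cutoff δ z' - cutoff δ z| * ‖stftKernel g z z'‖ * ‖stft g f z'‖ * w z
      ≤ δ * ‖z - z'‖ * ‖stftKernel g z z'‖ * ‖stft g f z'‖ * w z := by
        gcongr
        exact abs_cutoff_sub_le hδ z z'
    _ = δ * ‖stft g f z'‖ * (‖z - z'‖ * ‖stftKernel g z z'‖ * w z) := by ring
    _ ≤ δ * ‖stft g f z'‖ * (B * (phaseWeight (z - z') ^ (d + 1))⁻¹ * w z') :=
        mul_le_mul_of_nonneg_left (hBb z z') (by positivity)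
    _ = _ := by ring

/-- The Lipschitz bound on the cutoff yields δ‖z - z'‖, which the kernel absorbs, so Young's
inequality gives a bound linear in δ. A measurable majorant G is returned because subadditivity of N
requires measurability. -/
lemma AdmissibleNorm.commutator_le (hN : AdmissibleNorm N) (hw : IsControlledWeight w C k)
    (g : 𝓢(Rd d, ℂ)) : ∃ A : ℝ, 0 ≤ A ∧ ∀ (f : 𝓢'(Rd d, ℂ)) (δ : ℝ), 0 ≤ δ →
      ∃ G : Rd d × Rd d → ℝ≥0∞, Measurable G ∧
        (∀ z, ‖(∫ z', commutatorKernel g δ z z' * stft g f z') * (w z : ℂ)‖ₑ ≤ G z) ∧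
        N G ≤ ENNReal.ofReal (A * δ) * stftNorm N w g f := by
  obtain ⟨B, hB, hBb⟩ := hw.exists_kernel_le g
  set I := (∫⁻ z : Rd d × Rd d, phaseDecay z).toReal with hI
  have hI0 : 0 ≤ I := ENNReal.toReal_nonneg
  refine ⟨B * I, by positivity, fun f δ hδ => ?_⟩
  have hF := hw.aemeasurable_stft g f
  refine ⟨_, (measurable_conv measurable_phaseDecay hF).const_mul (ENNReal.ofReal (δ * B)),
    hw.enorm_integral_commutatorKernel_le hB hBb f hδ, ?_⟩
  have e : ENNReal.ofReal (B * I * δ) = ENNReal.ofReal (δ * B) * ∫⁻ z : Rd d × Rd d, phaseDecay z := by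
    rw [← ENNReal.ofReal_toReal lintegral_phaseDecay_lt_top.ne,
      ← ENNReal.ofReal_mul (by positivity)]
    congr 1
    ring
  rw [hN.const_mul ENNReal.ofReal_ne_top, e, mul_assoc]
  gcongr
  exact hN.conv_le measurable_phaseDecay (fun z => ENNReal.ofReal_ne_top) hF

/-- The discretisation error can be made small, uniformly on bounded sets. -/
lemma AdmissibleNorm.discretisation_le (hN : AdmissibleNorm N) (hw : IsControlledWeight w C k)
    (g : 𝓢(Rd d, ℂ)) {δ : ℝ} (hδ : 0 < δ) :
    ∃ ζ : SimpleFunc (Rd d × Rd d) (Rd d × Rd d), ∀ f : 𝓢'(Rd d, ℂ), stftNorm N w g f < ∞ →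
      (∀ z, Integrable (fun z' => discretisationKernel g δ ζ z z' * stft g f z') volume) ∧
      ∃ G : Rd d × Rd d → ℝ≥0∞, Measurable G ∧
        (∀ z, ‖(∫ z', discretisationKernel g δ ζ z z' * stft g f z') * (w z : ℂ)‖ₑ ≤ G z) ∧
        N G ≤ ENNReal.ofReal δ * stftNorm N w g f := by
  obtain ⟨A, hA, hAb⟩ := hN.norm_integral_mul_stft_le hw g
  have hC := hw.const_pos
  set ν := (N phaseDecay).toReal with hν
  have hν0 : 0 ≤ ν := ENNReal.toReal_nonneg
  set D := ((1 + 1 / δ) * (1 + 1 / δ)) ^ (d + 1 + k) with hD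
  have hD0 : 0 < D := by positivity
  -- The accumulated constants are C from the weight, A from the pairing, D from the size of
  -- `phaseWeight` on the support of the cutoff, and ν, the norm of `phaseDecay`; the summand 1
  -- keeps the denominator positive.
  set ε := δ / (C * (A * D) * ν + 1) with hε
  have hε0 : 0 < ε := by positivity
  obtain ⟨ζ, hζ⟩ := exists_simpleFunc_stftKernel_le g (1 / δ) (d + 1 + k) hε0
  -- Decay in z' comes from the compact support of the cutoff, decay in z from the weighted uniform
  -- closeness of the kernel columns.
  have hH (z z' : Rd d × Rd d) : phaseWeight z' ^ (d + 1 + k) * ‖discretisationKernel g δ ζ z z'‖ ≤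
      D * (ε / phaseWeight z ^ (d + 1 + k)) := by
    have hp := phaseWeight_pos z
    refine norm_cutoff_mul_le hδ z' (by positivity) fun hz' => ?_
    rw [le_div_iff₀ (by positivity), mul_comm]
    exact hζ z' hz' z
  refine ⟨ζ, fun f hf => ⟨fun z => hN.integrable_mul_stft hw hf
    (aestronglyMeasurable_discretisationKernel g δ ζ z) (hH z), ?_⟩⟩
  set r := (stftNorm N w g f).toReal with hr
  have hr0 : 0 ≤ r := ENNReal.toReal_nonneg
  refine ⟨_, measurable_phaseDecay.const_mul (ENNReal.ofReal (C * (A * (D * ε) * r))),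
    hw.enorm_mul_le fun z => ?_, ?_⟩
  · have hp := phaseWeight_pos z
    have h1 := hAb f (discretisationKernel g δ ζ z) _ hf (hH z)
    calc _ ≤ phaseWeight z ^ (d + 1 + k) * (A * (D * (ε / phaseWeight z ^ (d + 1 + k))) * r) := by
          gcongr
      _ = _ := by field_simp
  · rw [hN.const_mul ENNReal.ofReal_ne_top, ← ENNReal.ofReal_toReal hN.decay_lt_top.ne,
      ← ENNReal.ofReal_toReal hf.ne, ← ENNReal.ofReal_mul (by positivity),
      ← ENNReal.ofReal_mul (by positivity)]
    refine ENNReal.ofReal_le_ofReal ?_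
    have h1 : C * (A * D) * ν * ε ≤ δ := by
      rw [hε, mul_div_assoc', div_le_iff₀ (by positivity)]
      nlinarith
    calc C * (A * (D * ε) * r) * ν = C * (A * D) * ν * ε * r := by ring
      _ ≤ δ * r := by gcongr

/-- Discretised localisation operators: finite rank operators whose action on the short-time Fourier
transform is multiplication by the cutoff, up to a uniformly small error. -/
lemma IsStftSpace.exists_finiteRank (hJ : IsStftSpace N w g J) (hN : AdmissibleNorm N)
    (hw : IsControlledWeight w C k) (hg : g ≠ 0) :
    ∃ A : ℝ, 0 ≤ A ∧ ∀ δ : ℝ, 0 < δ → ∃ T : X →L[ℂ] X,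
      FiniteDimensional ℂ (LinearMap.range (T : X →ₗ[ℂ] X)) ∧
      ∀ x, N (fun z => ‖(stft g (J (T x)) z - cutoff δ z * stft g (J x) z) * (w z : ℂ)‖ₑ) ≤
        ENNReal.ofReal (A * δ * ‖x‖) := by
  obtain ⟨A, hA, hAb⟩ := hN.commutator_le hw g
  have hM := moyalConst_pos hg
  have hM' : (moyalConst g : ℂ) ≠ 0 := by exact_mod_cast hM.ne'
  refine ⟨(moyalConst g)⁻¹ * (A + 1), by positivity, fun δ hδ => ?_⟩
  obtain ⟨ζ, hζ⟩ := hN.discretisation_le hw g hδ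
  choose l hl using fun y => hJ.exists_clm_integral hN hw
    (aestronglyMeasurable_cutoffPiece δ ζ y) (phaseWeight_pow_mul_cutoffPiece_le hδ ζ _ y)
  choose e he using fun y => hJ.surj _ (hN.stftNorm_shiftDistribution_lt_top hw g y)
  -- A quadrature of the localisation operator: the cutoff transform is integrated over each fibre
  -- of ζ and multiplied by the window shifted to the sample point y.
  refine ⟨∑ y ∈ ζ.range, ((moyalConst g : ℂ)⁻¹ • l y).smulRight (e y),
    finiteDimensional_range_sum_smulRight _ _ _, fun x => ?_⟩
  have hfin := hJ.lt_top x
  obtain ⟨hi, G₁, hG₁, hb₁, hn₁⟩ := hζ _ hfin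
  obtain ⟨G₂, hG₂, hb₂, hn₂⟩ := hAb (J x) δ hδ.le
  have hdiff (z : Rd d × Rd d) :
      stft g (J ((∑ y ∈ ζ.range, ((moyalConst g : ℂ)⁻¹ • l y).smulRight (e y) : X →L[ℂ] X) x)) z -
        cutoff δ z * stft g (J x) z = (moyalConst g : ℂ)⁻¹ *
          ((∫ z', discretisationKernel g δ ζ z z' * stft g (J x) z') +
            ∫ z', commutatorKernel g δ z z' * stft g (J x) z') := by
    have h1 : stft g (J ((∑ y ∈ ζ.range, ((moyalConst g : ℂ)⁻¹ • l y).smulRight (e y) :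
        X →L[ℂ] X) x)) z = (moyalConst g : ℂ)⁻¹ *
          ∑ y ∈ ζ.range, (∫ z', cutoffPiece δ ζ y z' * stft g (J x) z') * stftKernel g z y := by
      rw [_root_.sum_apply]
      refine (stft_map_sum (g := g) J ζ.range
        (fun y => ((moyalConst g : ℂ)⁻¹ • l y) x) e z).trans ?_
      rw [Finset.mul_sum]
      refine Finset.sum_congr rfl fun y _ => ?_
      rw [he, stft_shiftDistribution, ← hl, ← mul_assoc]
      rfl
    rw [h1, sum_cutoffPiece_mul_stftKernel (fun y => hN.integrable_mul_stft hw hfin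
      (aestronglyMeasurable_cutoffPiece δ ζ y) (phaseWeight_pow_mul_cutoffPiece_le hδ ζ _ y)),
      integral_cutoff_mul_stftKernel hδ.le (hi z), mul_add _ _ ((moyalConst g : ℂ) * _),
      inv_mul_cancel_left₀ hM', add_sub_cancel_right]
  have hc : ‖(moyalConst g : ℂ)⁻¹‖ₑ = ENNReal.ofReal (moyalConst g)⁻¹ := by
    rw [← ofReal_norm, norm_inv, Complex.norm_real, Real.norm_of_nonneg hM.le]
  calc _ ≤ N (fun z => ENNReal.ofReal (moyalConst g)⁻¹ * (G₁ z + G₂ z)) := by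
        refine hN.mono fun z => ?_
        rw [hdiff, mul_assoc, enorm_mul, hc, add_mul]
        gcongr
        exact (enorm_add_le _ _).trans (add_le_add (hb₁ z) (hb₂ z))
    _ ≤ ENNReal.ofReal (moyalConst g)⁻¹ * (N G₁ + N G₂) := by
        rw [hN.const_mul ENNReal.ofReal_ne_top]
        gcongr
        exact hN.add_le hG₁.aemeasurable hG₂.aemeasurable
    _ ≤ ENNReal.ofReal (moyalConst g)⁻¹ * (ENNReal.ofReal δ * ENNReal.ofReal ‖x‖ +
          ENNReal.ofReal (A * δ) * ENNReal.ofReal ‖x‖) := by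
        rw [← hJ.stftNorm_eq]
        gcongr
    _ = _ := by
        rw [← ENNReal.ofReal_mul hδ.le, ← ENNReal.ofReal_mul (by positivity),
          ← ENNReal.ofReal_add (by positivity) (by positivity), ← ENNReal.ofReal_mul (by positivity)]
        congr 1
        ring

lemma tendsto_cutoff_one_div (z : Rd d × Rd d) :
    Tendsto (fun n : ℕ => cutoff (1 / ((n : ℝ) + 1)) z) atTop (𝓝 1) := by
  have h1 : Tendsto (fun n : ℕ => max 0 (1 - 1 / ((n : ℝ) + 1) * ‖z‖)) atTop
      (𝓝 (max 0 (1 - 0 * ‖z‖))) :=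
    tendsto_const_nhds.max
      (tendsto_const_nhds.sub (tendsto_one_div_add_atTop_nhds_zero_nat.mul_const _))
  simpa [cutoff] using h1

/-- The exact constant 1 is reachable because multiplication by a cutoff with values in [0, 1] is a
contraction on the transform side; only the O(δ) error has to be normalised away. -/
lemma IsStftSpace.metricApproximationProperty (hJ : IsStftSpace N w g J) (hN : AdmissibleNorm N)
    (hw : IsControlledWeight w C k) (hg : g ≠ 0) : MetricApproximationProperty X := by
  obtain ⟨A, hA, hT⟩ := hJ.exists_finiteRank hN hw hg
  let δ (n : ℕ) : ℝ := 1 / ((n : ℝ) + 1)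
  have hδ (n : ℕ) : 0 < δ n := by positivity
  have hδ0 : Tendsto δ atTop (𝓝 0) := tendsto_one_div_add_atTop_nhds_zero_nat
  choose T hfin hTb using fun n => hT (δ n) (hδ n)
  have hm (n : ℕ) (x : X) : AEMeasurable fun z =>
      ‖(stft g (J (T n x)) z - cutoff (δ n) z * stft g (J x) z) * (w z : ℂ)‖ₑ := by
    refine (hw.aestronglyMeasurable_mul (F := fun z =>
      stft g (J (T n x)) z - cutoff (δ n) z * stft g (J x) z) ?_).enorm
    exact (continuous_stft g _).sub
      ((Complex.continuous_ofReal.comp (continuous_cutoff _)).mul (continuous_stft g _))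
  have hnorm (n : ℕ) (x : X) : ‖T n x‖ ≤ (1 + A * δ n) * ‖x‖ := by
    have := (hδ n).le
    rw [← ENNReal.ofReal_le_ofReal_iff (by positivity), ← hJ.stftNorm_eq]
    calc stftNorm N w g (J (T n x))
        ≤ N (fun z => ‖stft g (J x) z * (w z : ℂ)‖ₑ +
          ‖(stft g (J (T n x)) z - cutoff (δ n) z * stft g (J x) z) * (w z : ℂ)‖ₑ) := by
          refine hN.mono fun z => ?_
          have e : stft g (J (T n x)) z * (w z : ℂ) =
              cutoff (δ n) z * (stft g (J x) z * (w z : ℂ)) +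
              (stft g (J (T n x)) z - cutoff (δ n) z * stft g (J x) z) * (w z : ℂ) := by ring
          rw [e]
          refine (enorm_add_le _ _).trans (add_le_add_left ?_ _)
          rw [enorm_mul]
          refine mul_le_of_le_one_left' ?_
          rw [← ofReal_norm, Complex.norm_real, Real.norm_of_nonneg (cutoff_nonneg _ _)]
          exact ENNReal.ofReal_le_one.2 (cutoff_le_one (hδ n).le z)
      _ ≤ ENNReal.ofReal ‖x‖ + ENNReal.ofReal (A * δ n * ‖x‖) := by
          refine (hN.add_le (hw.aemeasurable_stft g _) (hm n x)).trans ?_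
          exact add_le_add (hJ.stftNorm_eq x).le (hTb n x)
      _ = _ := by
          rw [← ENNReal.ofReal_add (norm_nonneg _) (by positivity)]
          congr 1
          ring
  -- On the transform side T n x - x is (cutoff - 1) times the transform of x plus the O(δ) error.
  -- The first term tends to zero in norm by dominated convergence, with the transform itself as
  -- majorant.
  have hlim (x : X) : Tendsto (fun n => T n x) atTop (𝓝 x) := by
    have h1 : Tendsto (fun n => N fun z =>
        ‖(cutoff (δ n) z - 1 : ℂ) * (stft g (J x) z * (w z : ℂ))‖ₑ) atTop (𝓝 0) := by
      refine hN.tendsto_zero (G := fun z => ‖stft g (J x) z * (w z : ℂ)‖ₑ) (fun n => ?_)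
        (hw.aemeasurable_stft g _) (fun n => Eventually.of_forall fun z => ?_) (hJ.lt_top x)
        (Eventually.of_forall fun z => ?_)
      · have hc : Continuous fun z : Rd d × Rd d => (cutoff (δ n) z - 1 : ℂ) :=
          (Complex.continuous_ofReal.comp (continuous_cutoff _)).sub continuous_const
        exact (hc.aestronglyMeasurable.mul
          (hw.aestronglyMeasurable_mul (continuous_stft g (J x)))).enorm
      · beta_reduce
        rw [enorm_mul]
        refine mul_le_of_le_one_left' ?_
        rw [← ofReal_norm, ← Complex.ofReal_one, ← Complex.ofReal_sub, Complex.norm_real,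
          Real.norm_eq_abs]
        refine ENNReal.ofReal_le_one.2 (abs_le.2 ⟨?_, ?_⟩) <;>
          linarith [cutoff_nonneg (δ n) z, cutoff_le_one (hδ n).le z]
      · have h2 : Tendsto (fun n => (cutoff (δ n) z - 1 : ℂ) * (stft g (J x) z * (w z : ℂ))) atTop
            (𝓝 ((1 - 1) * (stft g (J x) z * (w z : ℂ)))) := by
          refine Tendsto.mul_const _ (Tendsto.sub_const ?_ 1)
          have := (Complex.continuous_ofReal.tendsto 1).comp (tendsto_cutoff_one_div z)
          rwa [Complex.ofReal_one] at this
        simpa using h2.enorm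
    have h3 : Tendsto (fun n => ENNReal.ofReal (A * δ n * ‖x‖)) atTop (𝓝 0) := by
      have : Tendsto (fun n => A * δ n * ‖x‖) atTop (𝓝 (A * 0 * ‖x‖)) :=
        (hδ0.const_mul A).mul_const _
      simpa using ENNReal.tendsto_ofReal this
    have h13 := h1.add h3
    rw [add_zero] at h13
    have h4 : Tendsto (fun n => ENNReal.ofReal ‖T n x - x‖) atTop (𝓝 0) := by
      refine tendsto_of_tendsto_of_tendsto_of_le_of_le tendsto_const_nhds
        h13 (fun _ => zero_le) fun n => ?_
      beta_reduce
      rw [← hJ.stftNorm_eq, map_sub]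
      calc stftNorm N w g (J (T n x) - J x)
          ≤ N (fun z => ‖(cutoff (δ n) z - 1 : ℂ) * (stft g (J x) z * (w z : ℂ))‖ₑ +
            ‖(stft g (J (T n x)) z - cutoff (δ n) z * stft g (J x) z) * (w z : ℂ)‖ₑ) := by
            refine hN.mono fun z => ?_
            rw [stft_sub]
            refine le_trans (le_of_eq ?_) (enorm_add_le _ _)
            congr 1
            ring
        _ ≤ _ := by
            refine (hN.add_le ?_ (hm n x)).trans (add_le_add_right (hTb n x) _)
            have hc : Continuous fun z : Rd d × Rd d => (cutoff (δ n) z - 1 : ℂ) :=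
              (Complex.continuous_ofReal.comp (continuous_cutoff _)).sub continuous_const
            exact (hc.aestronglyMeasurable.mul
              (hw.aestronglyMeasurable_mul (continuous_stft g (J x)))).enorm
    rw [tendsto_iff_norm_sub_tendsto_zero]
    have := (ENNReal.tendsto_toReal ENNReal.zero_ne_top).comp h4
    simpa [Function.comp_def] using this
  -- Dividing by 1 + A * δ n makes the operators contractions and leaves the strong limit unchanged,
  -- since this factor tends to 1.
  refine metricApproximationProperty_of_tendsto
    (fun n => ((1 + A * δ n : ℝ) : ℂ)⁻¹ • T n) (fun n => ?_) (fun n => ?_) fun x => ?_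
  · have := hfin n
    refine Submodule.finiteDimensional_of_le (S₂ := LinearMap.range (T n : X →ₗ[ℂ] X)) ?_
    rintro - ⟨x, rfl⟩
    exact Submodule.smul_mem _ _ ⟨x, rfl⟩
  · have hpos : 0 < 1 + A * δ n := by have := (hδ n).le; positivity
    rw [norm_smul, norm_inv, Complex.norm_real, Real.norm_of_nonneg hpos.le,
      inv_mul_le_iff₀ hpos, mul_one]
    exact ContinuousLinearMap.opNorm_le_bound _ hpos.le (hnorm n)
  · have h1 : Tendsto (fun n => ((1 + A * δ n : ℝ) : ℂ)⁻¹) atTop (𝓝 1) := by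
      have h2 : Tendsto (fun n => 1 + A * δ n) atTop (𝓝 (1 + A * 0)) :=
        (hδ0.const_mul A).const_add 1
      have h3 := (Complex.continuous_ofReal.tendsto _).comp h2
      have h4 := h3.inv₀ (by simp)
      simpa using h4
    have := h1.smul (hlim x)
    simpa using this

end Approximation

/-! ### Modulation and Wiener amalgam spaces -/

section Spaces

variable {d : ℕ} {p q : ℝ} [hp : Fact (1 ≤ p)] [hq : Fact (1 ≤ q)] {w : Rd d × Rd d → ℝ}
  {C : ℝ} {k : ℕ}

/-- The inclusion of the modulation space into the tempered distributions. -/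
def ModulationSpace.inclusion (p q : ℝ) [Fact (1 ≤ p)] [Fact (1 ≤ q)] (w : Rd d × Rd d → ℝ)
    (g : 𝓢(Rd d, ℂ)) : ModulationSpace p q w g →ₗ[ℂ] 𝓢'(Rd d, ℂ) :=
  Submodule.subtype ((mixedLp d p q).comap (weightedStft w g))

/-- The inclusion of the Wiener amalgam space into the tempered distributions. -/
def WienerAmalgamSpace.inclusion (p q : ℝ) [Fact (1 ≤ p)] [Fact (1 ≤ q)] (w : Rd d × Rd d → ℝ)
    (g : 𝓢(Rd d, ℂ)) : WienerAmalgamSpace p q w g →ₗ[ℂ] 𝓢'(Rd d, ℂ) :=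
  Submodule.subtype ((mixedLp d q p).comap (flipMap d ∘ₗ weightedStft w g))

lemma ModulationSpace.isStftSpace (hw : IsControlledWeight w C k) (g : 𝓢(Rd d, ℂ)) :
    IsStftSpace (mixN p q) w g (ModulationSpace.inclusion p q w g) := by
  have e (f : 𝓢'(Rd d, ℂ)) : mixedNorm p q (weightedStft w g f) = stftNorm (mixN p q) w g f :=
    mixedNorm_eq_mixN hp.out _
  refine ⟨Subtype.val_injective, fun x => ?_, fun x => ?_, fun f hf => ?_⟩
  · rw [← e]
    exact x.2.2
  · rw [← e]
    rfl
  · exact ⟨⟨f, hw.aestronglyMeasurable_mul (continuous_stft g f), (e f).trans_lt hf⟩, rfl⟩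

lemma WienerAmalgamSpace.isStftSpace (hw : IsControlledWeight w C k) (g : 𝓢(Rd d, ℂ)) :
    IsStftSpace (fun F => mixN q p fun z => F z.swap) w g
      (WienerAmalgamSpace.inclusion p q w g) := by
  have e (f : 𝓢'(Rd d, ℂ)) : mixedNorm q p (flipMap d (weightedStft w g f)) =
      stftNorm (fun F => mixN q p fun z => F z.swap) w g f :=
    mixedNorm_eq_mixN hq.out _
  refine ⟨Subtype.val_injective, fun x => ?_, fun x => ?_, fun f hf => ?_⟩
  · rw [← e]
    exact x.2.2
  · rw [← e]
    rfl
  · exact ⟨⟨f, AEStronglyMeasurable.prod_swap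
      (hw.aestronglyMeasurable_mul (continuous_stft g f)), (e f).trans_lt hf⟩, rfl⟩

end Spaces

end

theorem corollary2p2 (d : ℕ) (p q : ℝ) [Fact (1 ≤ p)] [Fact (1 ≤ q)]
    (w : Rd d × Rd d → ℝ) (hw : IsWeight w) (hw0 : w ≠ 0)
    (hsub : IsSubmultiplicative w) (hmod : IsPolynomiallyModerate w)
    (g : 𝓢(Rd d, ℂ)) (hg : g ≠ 0) :
    (T0Space (ModulationSpace p q w g) ∧ CompleteSpace (ModulationSpace p q w g) ∧
      MetricApproximationProperty (ModulationSpace p q w g)) ∧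
    (T0Space (WienerAmalgamSpace p q w g) ∧ CompleteSpace (WienerAmalgamSpace p q w g) ∧
      MetricApproximationProperty (WienerAmalgamSpace p q w g)) := by
  have hp : 1 ≤ p := Fact.out
  have hq : 1 ≤ q := Fact.out
  obtain ⟨C, k, hwC⟩ := exists_isControlledWeight hw hw0 hmod
  have hM := ModulationSpace.isStftSpace (p := p) (q := q) hwC g
  have hW := WienerAmalgamSpace.isStftSpace (p := p) (q := q) hwC g
  have nM : AdmissibleNorm (mixN (d := d) p q) := admissibleNorm_mixN hp hq
  have nW := (admissibleNorm_mixN (d := d) hq hp).swap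
  exact ⟨⟨hM.t0Space nM hwC hg, hM.completeSpace nM hwC hg,
      hM.metricApproximationProperty nM hwC hg⟩,
    ⟨hW.t0Space nW hwC hg, hW.completeSpace nW hwC hg,
      hW.metricApproximationProperty nW hwC hg⟩⟩
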